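/- Let $I,J\subset\mathbb{R}$ be open, let $\eta_1=\eta_1(x)$ and $\eta_2=\eta_2(y)$ be smooth real functions on $I$ and $J$ respectively, not such that $\eta_1(x)=\eta_2(y)$ for all $(x,y)\in I\times J$, and let $\mathcal{E}$ be the infinitely prolonged system $$u_{yy}=\frac{\frac12\eta_1'v^2v_x+\frac12\eta_2'uvu_y+(\eta_1-\eta_2)uu_yv_y+u^2v^3}{uv(\eta_1-\eta_2)},\qquad v_{xx}=\frac{\frac12\eta_1'uvv_x+\frac12\eta_2'u^2u_y+(\eta_2-\eta_1)vv_xu_x+u^3v^2}{uv(\eta_2-\eta_1)}$$ for real functions $u,v$ of $(x,y)\in I\times J$, considered where $u\ne0$, $v\ne0$, $\eta_1\neq\eta_2$. Let $\alpha^j_{m}$, $\alpha^{jl}_{m}$ ($\{j,l\}=\{1,2\}$) be the coefficients at $\mu^m$ of the formal Taylor expansions in $\mu$ of $(1+\eta_j\mu^2)^{-1/2}$ and $(1+\eta_j\mu^2)^{1/2}(1+\eta_l\mu^2)^{-1/2}$. For complex variables $\theta_0,\theta_1,\dots$ put $T=1+\theta_1\mu+\theta_2\mu^2+\cdots$ and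 $X^{21}_0=Y^{12}_0=1$, $X^1_0=Y^2_0=0$, and for $s\ge1$ let $X^{21}_s,\ Y^{12}_s,\ X^1_s,\ Y^2_s$ be the coefficients at $\mu^s$ of, respectively, $$\Big(\sum_{m\ge 2}\alpha^{21}_m\mu^m\Big)T,\quad \Big(\sum_{m\ge 2}\alpha^{12}_m\mu^m\Big)T,\quad \frac{\mu}{2}\Big(\sum_{m\ge0}\alpha^1_m\mu^m\Big)\big(e^{\theta_0}T^2+e^{-\theta_0}\big),\quad \frac{\mu}{2}\Big(\sum_{m\ge0}\alpha^2_m\mu^m\Big)\big(e^{\theta_0}T^2-e^{-\theta_0}\big).$$ These involve only $\theta_0,\dots,\theta_{s-1}$. Let $$\omega_s=\Big(\frac{iu_y}{v}X^{21}_s+uX^1_s\Big)\,dx-\Big(\frac{iv_x}{u}Y^{12}_s+ivY^2_s\Big)\,dy ,$$ and let $\mathcal{E}_{s}$ be the covering of $\mathcal{E}$ obtained by adjoining nonlocal variables $\theta_0,\dots,\theta_s\in\mathbb{C}$ with $\theta_{k,x}\,dx+\theta_{k,y}\,dy=\omega_k$, $k=0,\dots,s$; put $\mathcal{E}_{-1}=\mathcal{E}$.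 Denote by $D_x,D_y$ the corresponding total derivatives. Then for every $s=0,1,2,\dots$ the form $\omega_s$ is a nontrivial conservation law on $\mathcal{E}_{s-1}$: writing $\omega_s=A\,dx+B\,dy$, one has $D_yA=D_xB$ on $\mathcal{E}_{s-1}$, and there is no smooth complex-valued function $f$ on $\mathcal{E}_{s-1}$ (that is, a function depending smoothly on finitely many of the jet variables and on $\theta_0,\dots,\theta_{s-1}$) with $\omega_s=d_hf=D_xf\,dx+D_yf\,dy$. Thus $\omega_0,\omega_1,\omega_2,\dots$ is an infinite hierarchy of nontrivial nonlocal conservation laws for the system. -/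

import Mathlib

open scoped ContDiff PowerSeries

noncomputable section

namespace SDeform

/-! Infinite jets of a pair of real functions `(u, v)` of two real variables `(x, y)`. -/

/-- The space of infinite jets: `(x, y, u_{ij}, v_{ij})`, where the index pair `i j` means
`i` derivatives in `x` and `j` derivatives in `y`. -/
abbrev Jet : Type := ℝ × ℝ × (ℕ → ℕ → ℝ) × (ℕ → ℕ → ℝ)

/-- The independent variable `x`. -/
def jx (p : Jet) : ℝ := p.1

/-- The independent variable `y`. -/
def jy (p : Jet) : ℝ := p.2.1

/-- The jet coordinate `∂_x^i ∂_y^j u`. -/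
def ju (i j : ℕ) (p : Jet) : ℝ := p.2.2.1 i j

/-- The jet coordinate `∂_x^i ∂_y^j v`. -/
def jv (i j : ℕ) (p : Jet) : ℝ := p.2.2.2 i j

/-- The value at `p` of the total derivative field
`∂/∂x + ∑ u_{i+1,j} ∂/∂u_{ij} + ∑ v_{i+1,j} ∂/∂v_{ij}`. -/
def jetFieldX (p : Jet) : Jet := (1, 0, fun i j => ju (i + 1) j p, fun i j => jv (i + 1) j p)

/-- The value at `p` of the total derivative field
`∂/∂y + ∑ u_{i,j+1} ∂/∂u_{ij} + ∑ v_{i,j+1} ∂/∂v_{ij}`. -/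
def jetFieldY (p : Jet) : Jet := (0, 1, fun i j => ju i (j + 1) p, fun i j => jv i (j + 1) p)

/-- The total derivative `D_x` on the jet space. -/
def jetDx (g : Jet → ℝ) (p : Jet) : ℝ := lineDeriv ℝ g p (jetFieldX p)

/-- The total derivative `D_y` on the jet space. -/
def jetDy (g : Jet → ℝ) (p : Jet) : ℝ := lineDeriv ℝ g p (jetFieldY p)

/-- The part of the jet space where the system is defined: `η₁ = η₁(x)` is given on `I`,
`η₂ = η₂(y)` is given on `J`, and the denominators `u`, `v`, `η₁ - η₂` do not vanish. -/
def jetDomain (η₁ η₂ : ℝ → ℝ) (I J : Set ℝ) : Set Jet :=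
  {p | jx p ∈ I ∧ jy p ∈ J ∧ η₁ (jx p) ≠ η₂ (jy p) ∧ ju 0 0 p ≠ 0 ∧ jv 0 0 p ≠ 0}

/-- The first equation, as the function `u_yy - (right-hand side)` of jets. -/
def eqnU (η₁ η₂ : ℝ → ℝ) (p : Jet) : ℝ :=
  let e₁ := η₁ (jx p); let e₂ := η₂ (jy p)
  let d₁ := deriv η₁ (jx p); let d₂ := deriv η₂ (jy p)
  let u := ju 0 0 p; let v := jv 0 0 p
  let u_y := ju 0 1 p; let v_x := jv 1 0 p; let v_y := jv 0 1 p
  ju 0 2 p -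
    (1 / 2 * d₁ * v ^ 2 * v_x + 1 / 2 * d₂ * u * v * u_y + (e₁ - e₂) * u * u_y * v_y
      + u ^ 2 * v ^ 3) / (u * v * (e₁ - e₂))

/-- The second equation, as the function `v_xx - (right-hand side)` of jets. -/
def eqnV (η₁ η₂ : ℝ → ℝ) (p : Jet) : ℝ :=
  let e₁ := η₁ (jx p); let e₂ := η₂ (jy p)
  let d₁ := deriv η₁ (jx p); let d₂ := deriv η₂ (jy p)
  let u := ju 0 0 p; let v := jv 0 0 p
  let u_x := ju 1 0 p; let u_y := ju 0 1 p; let v_x := jv 1 0 p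
  jv 2 0 p -
    (1 / 2 * d₁ * u * v * v_x + 1 / 2 * d₂ * u ^ 2 * u_y + (e₂ - e₁) * v * v_x * u_x
      + u ^ 3 * v ^ 2) / (u * v * (e₂ - e₁))

/-- The system `𝓔` as an infinitely prolonged equation: all jets at which the two equations and
all their total derivatives hold. -/
def equationManifold (η₁ η₂ : ℝ → ℝ) (I J : Set ℝ) : Set Jet :=
  {p | p ∈ jetDomain η₁ η₂ I J ∧ ∀ i j : ℕ,
    (jetDx^[i] (jetDy^[j] (eqnU η₁ η₂))) p = 0 ∧ (jetDx^[i] (jetDy^[j] (eqnV η₁ η₂))) p = 0}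

/-! The tower of coverings. -/

/-- The jet space extended by `n` complex nonlocal variables `θ_0, …, θ_{n-1}`. -/
abbrev Cov (n : ℕ) : Type := Jet × (Fin n → ℂ)

/-- The nonlocal variable `θ_k` (for `k < n`; extended by zero). -/
def theta {n : ℕ} (k : ℕ) (p : Cov n) : ℂ := if h : k < n then p.2 ⟨k, h⟩ else 0

/-- The formal Taylor expansion of `(1 + c μ²)^r` in the variable `μ`: the coefficient at `μ^{2k}`
is `r (r - 1) ⋯ (r - k + 1) / k! * c^k`. -/
def powSeries (r c : ℝ) : ℂ⟦X⟧ :=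
  PowerSeries.mk fun m => if Even m then
    ((((∏ i ∈ Finset.range (m / 2), (r - i)) / (Nat.factorial (m / 2) : ℝ)) * c ^ (m / 2) : ℝ) : ℂ)
    else 0

/-- The expansion `∑ α_{2k} μ^{2k}` of `1 / √(1 + c μ²)`; with `c = η_j` this gives `α_{2k}^j`. -/
def alphaSeries (c : ℝ) : ℂ⟦X⟧ := powSeries (-1 / 2) c

/-- The expansion of `√((1 + c μ²) / (1 + d μ²))`; with `c = η_j`, `d = η_l` this gives
`α_{2k}^{jl}`. -/
def alphaRatioSeries (c d : ℝ) : ℂ⟦X⟧ := powSeries (1 / 2) c * powSeries (-1 / 2) d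

/-- The formal series `1 + θ_1 μ + θ_2 μ² + ⋯`, so that `w = e^{θ_0} (1 + θ_1 μ + θ_2 μ² + ⋯)`. -/
def thetaSeries {n : ℕ} (p : Cov n) : ℂ⟦X⟧ :=
  PowerSeries.mk fun k => if k = 0 then 1 else theta k p

/-- `X_s^{21}`: equal to `1` for `s = 0`, and otherwise
`∑_{1 ≤ j ≤ s/2} α_{2j}^{21} θ_{s-2j}` with `θ_0` replaced by `1`. -/
def X21 (η₁ η₂ : ℝ → ℝ) (s : ℕ) {n : ℕ} (p : Cov n) : ℂ :=
  if s = 0 then 1 else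
    PowerSeries.coeff s ((alphaRatioSeries (η₂ (jy p.1)) (η₁ (jx p.1)) - 1) * thetaSeries p)

/-- `Y_s^{12}`: as `X_s^{21}`, with `α^{12}` in place of `α^{21}`. -/
def Y12 (η₁ η₂ : ℝ → ℝ) (s : ℕ) {n : ℕ} (p : Cov n) : ℂ :=
  if s = 0 then 1 else
    PowerSeries.coeff s ((alphaRatioSeries (η₁ (jx p.1)) (η₂ (jy p.1)) - 1) * thetaSeries p)

/-- `X_s^1`: the coefficient at `μ^s` of
`(μ / 2) (1 + η₁ μ²)^{-1/2} (e^{θ_0} (1 + θ_1 μ + ⋯)² + e^{-θ_0})`. -/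
def X1 (η₁ : ℝ → ℝ) (s : ℕ) {n : ℕ} (p : Cov n) : ℂ :=
  PowerSeries.coeff s (PowerSeries.C (1 / 2 : ℂ) * PowerSeries.X * alphaSeries (η₁ (jx p.1)) *
    (PowerSeries.C (Complex.exp (theta 0 p)) * thetaSeries p ^ 2
      + PowerSeries.C (Complex.exp (-theta 0 p))))

/-- `Y_s^2`: the coefficient at `μ^s` of
`(μ / 2) (1 + η₂ μ²)^{-1/2} (e^{θ_0} (1 + θ_1 μ + ⋯)² - e^{-θ_0})`. -/
def Y2 (η₂ : ℝ → ℝ) (s : ℕ) {n : ℕ} (p : Cov n) : ℂ :=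
  PowerSeries.coeff s (PowerSeries.C (1 / 2 : ℂ) * PowerSeries.X * alphaSeries (η₂ (jy p.1)) *
    (PowerSeries.C (Complex.exp (theta 0 p)) * thetaSeries p ^ 2
      - PowerSeries.C (Complex.exp (-theta 0 p))))

/-- The `dx`-coefficient of `ω_s`: `(i u_y / v) X_s^{21} + u X_s^1`. It involves only the nonlocal
variables `θ_k` with `k < s` (and is used on `Cov n` for `s ≤ n` only). -/
def omegaX (η₁ η₂ : ℝ → ℝ) (s : ℕ) {n : ℕ} (p : Cov n) : ℂ :=
  Complex.I * (ju 0 1 p.1 : ℂ) / (jv 0 0 p.1 : ℂ) * X21 η₁ η₂ s p + (ju 0 0 p.1 : ℂ) * X1 η₁ s p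

/-- The `dy`-coefficient of `ω_s`: `-((i v_x / u) Y_s^{12} + i v Y_s^2)`. -/
def omegaY (η₁ η₂ : ℝ → ℝ) (s : ℕ) {n : ℕ} (p : Cov n) : ℂ :=
  -(Complex.I * (jv 1 0 p.1 : ℂ) / (ju 0 0 p.1 : ℂ) * Y12 η₁ η₂ s p
    + Complex.I * (jv 0 0 p.1 : ℂ) * Y2 η₂ s p)

/-- The total derivative `D_x` on the covering with fibre coordinates `θ_0, …, θ_{n-1}`: the
derivative along the field that extends the total derivative field of the jet space by
`(θ_k)_x = (i u_y / v) X_k^{21} + u X_k^1`. -/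
def covDx (η₁ η₂ : ℝ → ℝ) {n : ℕ} (f : Cov n → ℂ) (p : Cov n) : ℂ :=
  lineDeriv ℝ f p (jetFieldX p.1, fun k : Fin n => omegaX η₁ η₂ k p)

/-- The total derivative `D_y` on the covering with fibre coordinates `θ_0, …, θ_{n-1}`. -/
def covDy (η₁ η₂ : ℝ → ℝ) {n : ℕ} (f : Cov n → ℂ) (p : Cov n) : ℂ :=
  lineDeriv ℝ f p (jetFieldY p.1, fun k : Fin n => omegaY η₁ η₂ k p)

/-- The part of `Cov n` lying over `jetDomain`. -/
def covDomain (η₁ η₂ : ℝ → ℝ) (I J : Set ℝ) (n : ℕ) : Set (Cov n) :=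
  {p | p.1 ∈ jetDomain η₁ η₂ I J}

/-- The covering equation with nonlocal variables `θ_0, …, θ_{n-1}`, i.e. `𝓔_{n-1}`, where
`𝓔_{-1} = 𝓔`. -/
def covEquation (η₁ η₂ : ℝ → ℝ) (I J : Set ℝ) (n : ℕ) : Set (Cov n) :=
  {p | p.1 ∈ equationManifold η₁ η₂ I J}

/-- The projection to finitely many coordinates: `x`, `y`, the jet coordinates `u_{ij}`, `v_{ij}`
with `i, j < k`, and all `θ`s. -/
def truncate (k n : ℕ) (p : Cov n) :
    ℝ × ℝ × (Fin k → Fin k → ℝ) × (Fin k → Fin k → ℝ) × (Fin n → ℂ) :=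
  (jx p.1, jy p.1, fun i j => ju i j p.1, fun i j => jv i j p.1, p.2)

/-- Smooth complex-valued functions on an open part `Ω` of the extended jet space: functions that
depend on finitely many coordinates only, and smoothly so (in the real sense). The smooth functions
on `covEquation` are the restrictions of the smooth functions on `covDomain`. -/
def IsSmooth {n : ℕ} (Ω : Set (Cov n)) (f : Cov n → ℂ) : Prop :=
  ∃ (k : ℕ) (F : ℝ × ℝ × (Fin k → Fin k → ℝ) × (Fin k → Fin k → ℝ) × (Fin n → ℂ) → ℂ),
    ContDiffOn ℝ ∞ F (truncate k n '' Ω) ∧ ∀ p ∈ Ω, f p = F (truncate k n p)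

/-- The horizontal form `A dx + B dy` on `𝓔_{n-1}` is a conservation law: its coefficients are
smooth and `D_y A = D_x B` holds on `𝓔_{n-1}`. -/
def IsConservationLaw (η₁ η₂ : ℝ → ℝ) (I J : Set ℝ) {n : ℕ} (A B : Cov n → ℂ) : Prop :=
  IsSmooth (covDomain η₁ η₂ I J n) A ∧ IsSmooth (covDomain η₁ η₂ I J n) B ∧
    ∀ p ∈ covEquation η₁ η₂ I J n, covDy η₁ η₂ A p = covDx η₁ η₂ B p

/-- The horizontal form `A dx + B dy` is trivial on `𝓔_{n-1}`: it is `d_h f = D_x f dx + D_y f dy`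
on `𝓔_{n-1}` for a smooth function `f`. -/
def IsTrivialForm (η₁ η₂ : ℝ → ℝ) (I J : Set ℝ) {n : ℕ} (A B : Cov n → ℂ) : Prop :=
  ∃ f : Cov n → ℂ, IsSmooth (covDomain η₁ η₂ I J n) f ∧
    ∀ p ∈ covEquation η₁ η₂ I J n, covDx η₁ η₂ f p = A p ∧ covDy η₁ η₂ f p = B p

end SDeform

end

/-! Put `W = e^{θ_0} (1 + θ_1 μ + θ_2 μ² + ⋯)`. The covering is the expansion in `μ` of two Riccati
equations `W_x = a W² + b W + c` and `W_y = a' W² + b' W + c'`, whose coefficients are power series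
depending on the jet (`riccatiX`, `riccatiY`). The components of `ω_s` are the coefficients at `μ^s`
of the induced equations for the `θ_k` (`omegaX_eq`, `omegaY_eq`), and they involve only `θ_k` with
`k < s`. Conservation is the compatibility of the two Riccati equations: the zero curvature identity
`riccati_flat`, in which the system enters through the linear coefficient only, is carried over to
coefficients by `coeff_flowDeriv_sub`.

For nontriviality, suppose `ω_s = d_h f`. The infinitely prolonged equation is a graph over the
parametric coordinates `u_{ij}` with `j < 2` and `v_{ij}` with `i < 2`, so `f` may be replaced by a
function `h` of these and the `θ_k` (`exists_isPotential`). Compare `D_x h` at two points of the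
equation that differ only in parametric `u`-coordinates one order above those in `h`: the form has
the same value there, hence `h` does not depend on its highest `u`-coordinates. The same with `D_y`
removes the highest `v`-coordinates. By descent, for `u, v > 0` the function `h` depends only on
`x`, `y` and the `θ_k` (`IsPotential.respects_baseAgree`).

Now fix `(x, y)` and vary `u` and `u_y`. Differences of the equation for `D_x h` say that the vector
fields of the Riccati equations `(0, iρ, 0)` and `(μα/2, 0, μα/2)`, taken on `θ_0, …, θ_s`, are
tangent to the graph `θ_s = h(θ_0, …, θ_{s-1})`. Tangency is inherited by linear combinations and
commutators (`Lifts.bracket`). Since `ρ² - 1 = (η₂ - η₁) μ² α²`, iterated commutators give, for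
every `s`, a Riccati equation whose field at `θ = 0` starts exactly at `μ^s`. Such a field is
vertical and nonzero at a point of the graph, so it is not tangent to it (`not_lifts`).

The jet space is an infinite product without a norm. Smoothness and openness are therefore tested on
coordinatewise smooth maps from normed spaces, and total derivatives are line derivatives. -/

noncomputable section

namespace SDeform

/-! ### Smoothness on the infinite jet space and commuting total derivatives -/

open Filter Topology

/-- A map into the jet space all of whose coordinates are smooth at `e`. -/
def JetPlot {E : Type} [NormedAddCommGroup E] [NormedSpace ℝ E] (γ : E → Jet) (e : E) : Prop :=
  ContDiffAt ℝ ∞ (fun z => jx (γ z)) e ∧ ContDiffAt ℝ ∞ (fun z => jy (γ z)) e ∧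
    (∀ i j, ContDiffAt ℝ ∞ (fun z => ju i j (γ z)) e) ∧
    ∀ i j, ContDiffAt ℝ ∞ (fun z => jv i j (γ z)) e

/-- Smoothness of a function of jets, tested on coordinatewise smooth maps. -/
def JetSmoothAt (g : Jet → ℝ) (p : Jet) : Prop :=
  ∀ (E : Type) [NormedAddCommGroup E] [NormedSpace ℝ E] (γ : E → Jet) (e : E),
    JetPlot γ e → γ e = p → ContDiffAt ℝ ∞ (fun z => g (γ z)) e

/-- A set of jets that is a neighbourhood of each of its points along coordinatewise smooth maps. -/
def JetOpen (Ω : Set Jet) : Prop :=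
  ∀ (E : Type) [NormedAddCommGroup E] [NormedSpace ℝ E] (γ : E → Jet) (e : E),
    JetPlot γ e → γ e ∈ Ω → ∀ᶠ z in 𝓝 e, γ z ∈ Ω

/-- Smoothness at all points of `Ω`. -/
def JetSmoothOn (Ω : Set Jet) (g : Jet → ℝ) : Prop := ∀ p ∈ Ω, JetSmoothAt g p

/-- A vector field on the jet space with smooth coordinates. -/
def JetField (W : Jet → Jet) : Prop :=
  ∀ (E : Type) [NormedAddCommGroup E] [NormedSpace ℝ E] (γ : E → Jet) (e : E),
    JetPlot γ e → JetPlot (fun z => W (γ z)) e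

section Plots

variable {E F : Type} [NormedAddCommGroup E] [NormedSpace ℝ E] [NormedAddCommGroup F]
  [NormedSpace ℝ F] {γ δ : E → Jet} {e : E}

lemma jetPlot_const (p : Jet) : JetPlot (fun _ : E => p) e :=
  ⟨contDiffAt_const, contDiffAt_const, fun _ _ => contDiffAt_const, fun _ _ => contDiffAt_const⟩

lemma JetPlot.add (hγ : JetPlot γ e) (hδ : JetPlot δ e) : JetPlot (fun z => γ z + δ z) e :=
  ⟨hγ.1.add hδ.1, hγ.2.1.add hδ.2.1, fun i j => (hγ.2.2.1 i j).add (hδ.2.2.1 i j),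
    fun i j => (hγ.2.2.2 i j).add (hδ.2.2.2 i j)⟩

lemma JetPlot.smul {c : E → ℝ} (hc : ContDiffAt ℝ ∞ c e) (hγ : JetPlot γ e) :
    JetPlot (fun z => c z • γ z) e :=
  ⟨hc.mul hγ.1, hc.mul hγ.2.1, fun i j => hc.mul (hγ.2.2.1 i j),
    fun i j => hc.mul (hγ.2.2.2 i j)⟩

lemma JetPlot.comp {φ : F → E} {f : F} (hγ : JetPlot γ e) (hφ : ContDiffAt ℝ ∞ φ f)
    (h : φ f = e) : JetPlot (fun z => γ (φ z)) f := by
  subst h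
  exact ⟨hγ.1.comp f hφ, hγ.2.1.comp f hφ, fun i j => (hγ.2.2.1 i j).comp f hφ,
    fun i j => (hγ.2.2.2 i j).comp f hφ⟩

lemma jetPlot_line (p v : Jet) (t : ℝ) : JetPlot (fun t : ℝ => p + t • v) t :=
  (jetPlot_const p).add ((jetPlot_const v).smul contDiffAt_id)

end Plots

lemma jetField_jetFieldX : JetField jetFieldX := fun _ _ _ _ _ hγ =>
  ⟨contDiffAt_const, contDiffAt_const, fun i j => hγ.2.2.1 (i + 1) j,
    fun i j => hγ.2.2.2 (i + 1) j⟩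

lemma jetField_jetFieldY : JetField jetFieldY := fun _ _ _ _ _ hγ =>
  ⟨contDiffAt_const, contDiffAt_const, fun i j => hγ.2.2.1 i (j + 1),
    fun i j => hγ.2.2.2 i (j + 1)⟩

/-- The map `(z, t) ↦ γ z + t • W (γ z)` is again coordinatewise smooth, so `g` along it is smooth
at `(e, 0)`, and the line derivative is the `t`-derivative at `0`. This allows total derivatives to
be iterated. -/
lemma JetSmoothAt.lineDeriv {W : Jet → Jet} (hW : JetField W) {g : Jet → ℝ} {p : Jet}
    (hg : JetSmoothAt g p) : JetSmoothAt (fun q => lineDeriv ℝ g q (W q)) p := by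
  intro E _ _ γ e hγ he
  have h1 : JetPlot (fun z : E × ℝ => γ z.1 + z.2 • W (γ z.1)) (e, 0) :=
    (hγ.comp contDiffAt_fst rfl).add
      (((hW E γ e hγ).comp contDiffAt_fst rfl).smul contDiffAt_snd)
  have h2 := hg _ _ _ h1 (by simp [he])
  have h3 : ContDiffAt ℝ ∞
      (fun z : E => fderiv ℝ (fun t : ℝ => g (γ z + t • W (γ z))) 0) e :=
    ContDiffAt.fderiv (f := fun (z : E) (t : ℝ) => g (γ z + t • W (γ z))) (g := fun _ => 0)
      (n := ∞) h2 contDiffAt_const (by simp)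
  exact h3.clm_apply (contDiffAt_const (c := (1 : ℝ)))

lemma JetSmoothAt.differentiableAt_line {g : Jet → ℝ} {p : Jet} (hg : JetSmoothAt g p) (v : Jet) :
    DifferentiableAt ℝ (fun t : ℝ => g (p + t • v)) 0 :=
  (hg ℝ _ 0 (jetPlot_line p v 0) (by simp)).differentiableAt (by simp)

lemma lineDeriv_congr_of_jetOpen {Ω : Set Jet} (hΩ : JetOpen Ω) {g h : Jet → ℝ}
    (hgh : ∀ p ∈ Ω, g p = h p) {p : Jet} (hp : p ∈ Ω) (v : Jet) :
    lineDeriv ℝ g p v = lineDeriv ℝ h p v := by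
  have := hΩ ℝ _ 0 (jetPlot_line p v 0) (by simpa using hp)
  exact Filter.EventuallyEq.deriv_eq (this.mono fun t ht => hgh _ ht)

lemma jetSmoothOn_jetDx {Ω : Set Jet} {g : Jet → ℝ} (hg : JetSmoothOn Ω g) :
    JetSmoothOn Ω (jetDx g) := fun p hp => (hg p hp).lineDeriv jetField_jetFieldX

lemma jetSmoothOn_jetDy {Ω : Set Jet} {g : Jet → ℝ} (hg : JetSmoothOn Ω g) :
    JetSmoothOn Ω (jetDy g) := fun p hp => (hg p hp).lineDeriv jetField_jetFieldY

/-- Mixed partial derivatives of a smooth function of two real variables agree. -/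
lemma deriv_deriv_comm {H : ℝ × ℝ → ℝ} (hH : ContDiffAt ℝ ∞ H (0, 0)) :
    deriv (fun s => deriv (fun t => H (s, t)) 0) 0
      = deriv (fun t => deriv (fun s => H (s, t)) 0) 0 := by
  have hev : ∀ᶠ z in 𝓝 ((0 : ℝ), (0 : ℝ)), DifferentiableAt ℝ H z := by
    have := (hH.of_le (m := 1) (by exact_mod_cast le_top)).eventually (by simp)
    exact this.mono fun z hz => hz.differentiableAt (by simp)
  have hD : DifferentiableAt ℝ (fderiv ℝ H) (0, 0) :=
    (hH.fderiv_right (m := ∞) (by simp)).differentiableAt (by simp)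
  have hsymm : IsSymmSndFDerivAt ℝ H (0, 0) := hH.isSymmSndFDerivAt (by
    rw [minSmoothness_of_isRCLikeNormedField]; exact WithTop.coe_le_coe.2 (le_top : (2 : ℕ∞) ≤ ⊤))
  have e1 : (fun s => deriv (fun t => H (s, t)) 0) =ᶠ[𝓝 0]
      fun s => fderiv ℝ H (s, 0) (0, 1) := by
    have hc : Tendsto (fun s : ℝ => (s, (0 : ℝ))) (𝓝 0) (𝓝 (0, 0)) :=
      (by fun_prop : Continuous fun s : ℝ => (s, (0 : ℝ))).tendsto' _ _ rfl
    filter_upwards [hc.eventually hev] with s hs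
    have : HasDerivAt (fun t : ℝ => (s, t)) (0, 1) (0 : ℝ) :=
      (hasDerivAt_const _ _).prodMk (hasDerivAt_id _)
    exact (hs.hasFDerivAt.comp_hasDerivAt (0 : ℝ) this).deriv
  have e2 : (fun t => deriv (fun s => H (s, t)) 0) =ᶠ[𝓝 0]
      fun t => fderiv ℝ H (0, t) (1, 0) := by
    have hc : Tendsto (fun s : ℝ => ((0 : ℝ), s)) (𝓝 0) (𝓝 (0, 0)) :=
      (by fun_prop : Continuous fun s : ℝ => ((0 : ℝ), s)).tendsto' _ _ rfl
    filter_upwards [hc.eventually hev] with s hs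
    have : HasDerivAt (fun t : ℝ => (t, s)) (1, 0) (0 : ℝ) :=
      (hasDerivAt_id _).prodMk (hasDerivAt_const _ _)
    exact (hs.hasFDerivAt.comp_hasDerivAt (0 : ℝ) this).deriv
  rw [e1.deriv_eq, e2.deriv_eq]
  have h1 : HasDerivAt (fun t : ℝ => (t, (0 : ℝ))) (1, 0) (0 : ℝ) :=
    (hasDerivAt_id _).prodMk (hasDerivAt_const _ _)
  have h2 : HasDerivAt (fun t : ℝ => ((0 : ℝ), t)) (0, 1) (0 : ℝ) :=
    (hasDerivAt_const _ _).prodMk (hasDerivAt_id _)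
  have k1 := ((HasFDerivAt.comp_hasDerivAt (f := fun t : ℝ => (t, (0 : ℝ))) (0 : ℝ) hD.hasFDerivAt h1).clm_apply
    (hasDerivAt_const (0 : ℝ) ((0 : ℝ), (1 : ℝ)))).deriv
  have k2 := ((HasFDerivAt.comp_hasDerivAt (f := fun t : ℝ => ((0 : ℝ), t)) (0 : ℝ) hD.hasFDerivAt h2).clm_apply
    (hasDerivAt_const (0 : ℝ) ((1 : ℝ), (0 : ℝ)))).deriv
  simp only [Function.comp_def, map_zero, add_zero] at k1 k2
  rw [k1, k2]
  exact hsymm.eq _ _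

lemma jetDx_jetDy_comm {g : Jet → ℝ} {p : Jet} (hg : JetSmoothAt g p) :
    jetDx (jetDy g) p = jetDy (jetDx g) p := by
  -- Since `jetFieldY (p + s • jetFieldX p) = jetFieldY p + s • Z`, and likewise with the fields
  -- exchanged, the term `s t Z` turns both families of coordinate lines of `L` into the straight
  -- lines defining `jetDy` and `jetDx`. Symmetry of second derivatives of `g ∘ L` then gives the
  -- claim.
  set Z : Jet := (0, 0, fun i j => ju (i + 1) (j + 1) p, fun i j => jv (i + 1) (j + 1) p) with hZ
  let L : ℝ × ℝ → Jet := fun z =>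
    p + z.1 • jetFieldX p + z.2 • jetFieldY p + (z.1 * z.2) • Z
  have hL : JetPlot L (0, 0) :=
    (((jetPlot_const p).add ((jetPlot_const _).smul contDiffAt_fst)).add
      ((jetPlot_const _).smul contDiffAt_snd)).add
      ((jetPlot_const _).smul (contDiffAt_fst.mul contDiffAt_snd))
  have hH := hg _ L (0, 0) hL (by simp [L])
  have h1 : ∀ s t : ℝ, L (s, t) = p + s • jetFieldX p + t • jetFieldY (p + s • jetFieldX p) := by
    intro s t
    ext <;> simp [L, hZ, jetFieldX, jetFieldY, ju, jv] <;> ring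
  have h2 : ∀ s t : ℝ, L (s, t) = p + t • jetFieldY p + s • jetFieldX (p + t • jetFieldY p) := by
    intro s t
    ext <;> simp [L, hZ, jetFieldX, jetFieldY, ju, jv] <;> ring
  have h3 := deriv_deriv_comm hH
  have h4 : (fun s => deriv (fun t => g (L (s, t))) 0) = fun s => jetDy g (p + s • jetFieldX p) := by
    funext s; simp only [h1]; rfl
  have h5 : (fun t => deriv (fun s => g (L (s, t))) 0) = fun t => jetDx g (p + t • jetFieldY p) := by
    funext s; simp only [h2]; rfl
  rw [h4, h5] at h3
  exact h3

section Iterates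

variable {Ω : Set Jet} {g h : Jet → ℝ}

lemma JetSmoothOn.iterate_jetDx (hg : JetSmoothOn Ω g) (i : ℕ) : JetSmoothOn Ω (jetDx^[i] g) := by
  induction i with
  | zero => exact hg
  | succ i ih => rw [Function.iterate_succ_apply']; exact jetSmoothOn_jetDx ih

lemma JetSmoothOn.iterate_jetDy (hg : JetSmoothOn Ω g) (i : ℕ) : JetSmoothOn Ω (jetDy^[i] g) := by
  induction i with
  | zero => exact hg
  | succ i ih => rw [Function.iterate_succ_apply']; exact jetSmoothOn_jetDy ih

lemma jetDy_iterate_jetDx (hΩ : JetOpen Ω) (hg : JetSmoothOn Ω g) (i : ℕ) :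
    ∀ p ∈ Ω, jetDy (jetDx^[i] g) p = (jetDx^[i] (jetDy g)) p := by
  induction i with
  | zero => exact fun _ _ => rfl
  | succ i ih =>
    intro p hp
    rw [Function.iterate_succ_apply', Function.iterate_succ_apply',
      ← jetDx_jetDy_comm (hg.iterate_jetDx i p hp)]
    exact lineDeriv_congr_of_jetOpen hΩ ih hp _

end Iterates

/-! ### Functions of finite order and the chain rule along curves -/

/-- The jets `p` and `q` agree in `x`, `y` and all derivatives of order at most `n`. -/
def AgreeTo (n : ℕ) (p q : Jet) : Prop :=
  jx p = jx q ∧ jy p = jy q ∧ ∀ i j, i + j ≤ n → ju i j p = ju i j q ∧ jv i j p = jv i j q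

/-- On `Ω`, the function `g` depends only on jets of order at most `n`. -/
def HasOrder (Ω : Set Jet) (n : ℕ) (g : Jet → ℝ) : Prop :=
  ∀ p ∈ Ω, ∀ q ∈ Ω, AgreeTo n p q → g p = g q

lemma AgreeTo.symm {n : ℕ} {p q : Jet} (h : AgreeTo n p q) : AgreeTo n q p :=
  ⟨h.1.symm, h.2.1.symm, fun i j hij => ⟨(h.2.2 i j hij).1.symm, (h.2.2 i j hij).2.symm⟩⟩

lemma AgreeTo.refl (n : ℕ) (p : Jet) : AgreeTo n p p :=
  ⟨rfl, rfl, fun _ _ _ => ⟨rfl, rfl⟩⟩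

lemma AgreeTo.trans {n : ℕ} {p q r : Jet} (h : AgreeTo n p q) (k : AgreeTo n q r) :
    AgreeTo n p r :=
  ⟨h.1.trans k.1, h.2.1.trans k.2.1, fun i j hij =>
    ⟨(h.2.2 i j hij).1.trans (k.2.2 i j hij).1, (h.2.2 i j hij).2.trans (k.2.2 i j hij).2⟩⟩

lemma AgreeTo.mono {m n : ℕ} (hmn : m ≤ n) {p q : Jet} (h : AgreeTo n p q) : AgreeTo m p q :=
  ⟨h.1, h.2.1, fun i j hij => h.2.2 i j (hij.trans hmn)⟩

lemma AgreeTo.add_smul {n : ℕ} {p q v w : Jet} (h : AgreeTo n p q) (k : AgreeTo n v w) (t : ℝ) :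
    AgreeTo n (p + t • v) (q + t • w) := by
  refine ⟨?_, ?_, fun i j hij => ⟨?_, ?_⟩⟩
  · exact congrArg₂ (fun a b => a + t * b) h.1 k.1
  · exact congrArg₂ (fun a b => a + t * b) h.2.1 k.2.1
  · exact congrArg₂ (fun a b => a + t * b) (h.2.2 i j hij).1 (k.2.2 i j hij).1
  · exact congrArg₂ (fun a b => a + t * b) (h.2.2 i j hij).2 (k.2.2 i j hij).2

lemma AgreeTo.jetFieldX {n : ℕ} {p q : Jet} (h : AgreeTo (n + 1) p q) :
    AgreeTo n (jetFieldX p) (jetFieldX q) :=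
  ⟨rfl, rfl, fun i j hij => h.2.2 (i + 1) j (by omega)⟩

lemma AgreeTo.jetFieldY {n : ℕ} {p q : Jet} (h : AgreeTo (n + 1) p q) :
    AgreeTo n (jetFieldY p) (jetFieldY q) :=
  ⟨rfl, rfl, fun i j hij => h.2.2 i (j + 1) (by omega)⟩

lemma HasOrder.mono {Ω : Set Jet} {m n : ℕ} (hmn : m ≤ n) {g : Jet → ℝ} (hg : HasOrder Ω m g) :
    HasOrder Ω n g := fun p hp q hq h => hg p hp q hq (h.mono hmn)

lemma HasOrder.lineDeriv_eq {Ω : Set Jet} (hΩ : JetOpen Ω) {n : ℕ} {g : Jet → ℝ}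
    (hg : HasOrder Ω n g) {p q v w : Jet} (hp : p ∈ Ω) (hq : q ∈ Ω) (h : AgreeTo n p q)
    (k : AgreeTo n v w) : lineDeriv ℝ g p v = lineDeriv ℝ g q w := by
  have h1 := hΩ ℝ _ 0 (jetPlot_line p v 0) (by simpa using hp)
  have h2 := hΩ ℝ _ 0 (jetPlot_line q w 0) (by simpa using hq)
  refine Filter.EventuallyEq.deriv_eq ?_
  filter_upwards [h1, h2] with t ht1 ht2
  exact hg _ ht1 _ ht2 (h.add_smul k t)

lemma hasOrder_jetDx {Ω : Set Jet} (hΩ : JetOpen Ω) {n : ℕ} {g : Jet → ℝ}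
    (hg : HasOrder Ω n g) : HasOrder Ω (n + 1) (jetDx g) := fun _ hp _ hq h =>
  hg.lineDeriv_eq hΩ hp hq (h.mono (Nat.le_succ n)) h.jetFieldX

lemma hasOrder_jetDy {Ω : Set Jet} (hΩ : JetOpen Ω) {n : ℕ} {g : Jet → ℝ}
    (hg : HasOrder Ω n g) : HasOrder Ω (n + 1) (jetDy g) := fun _ hp _ hq h =>
  hg.lineDeriv_eq hΩ hp hq (h.mono (Nat.le_succ n)) h.jetFieldY

lemma HasOrder.iterate_jetDx {Ω : Set Jet} (hΩ : JetOpen Ω) {n : ℕ} {g : Jet → ℝ}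
    (hg : HasOrder Ω n g) (i : ℕ) : HasOrder Ω (n + i) (jetDx^[i] g) := by
  induction i with
  | zero => exact hg
  | succ i ih => rw [Function.iterate_succ_apply']; exact hasOrder_jetDx hΩ ih

lemma HasOrder.iterate_jetDy {Ω : Set Jet} (hΩ : JetOpen Ω) {n : ℕ} {g : Jet → ℝ}
    (hg : HasOrder Ω n g) (i : ℕ) : HasOrder Ω (n + i) (jetDy^[i] g) := by
  induction i with
  | zero => exact hg
  | succ i ih => rw [Function.iterate_succ_apply']; exact hasOrder_jetDy hΩ ih

/-- The curve `γ` has velocity `v` at `0`, in all coordinates of order at most `n`. -/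
def HasVelocity (n : ℕ) (γ : ℝ → Jet) (v : Jet) : Prop :=
  HasDerivAt (fun t => jx (γ t)) (jx v) 0 ∧ HasDerivAt (fun t => jy (γ t)) (jy v) 0 ∧
    ∀ i j, i + j ≤ n → HasDerivAt (fun t => ju i j (γ t)) (ju i j v) 0 ∧
      HasDerivAt (fun t => jv i j (γ t)) (jv i j v) 0

lemma hasVelocity_line (n : ℕ) (p v : Jet) : HasVelocity n (fun t : ℝ => p + t • v) v := by
  have h : ∀ a b : ℝ, HasDerivAt (fun t : ℝ => a + t * b) b 0 := fun a b => by
    simpa using ((hasDerivAt_id (0 : ℝ)).mul_const b).const_add a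
  exact ⟨h _ _, h _ _, fun i j _ => ⟨h _ _, h _ _⟩⟩

/-- The finite-dimensional space of jet coordinates with both indices at most `n`. -/
abbrev JetBox (n : ℕ) : Type :=
  ℝ × ℝ × (Fin (n + 1) → Fin (n + 1) → ℝ) × (Fin (n + 1) → Fin (n + 1) → ℝ)

/-- The coordinates of order at most `n`. -/
def jetTrunc (n : ℕ) (p : Jet) : JetBox n :=
  (jx p, jy p, fun i j => if (i : ℕ) + j ≤ n then ju i j p else 0,
    fun i j => if (i : ℕ) + j ≤ n then jv i j p else 0)

/-- Extension of finitely many coordinates by zero. -/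
def extendZero {k : ℕ} (a : Fin k → Fin k → ℝ) (i j : ℕ) : ℝ :=
  if h : i < k ∧ j < k then a ⟨i, h.1⟩ ⟨j, h.2⟩ else 0

lemma contDiff_extendZero {k : ℕ} (i j : ℕ) :
    ContDiff ℝ ∞ fun a : Fin k → Fin k → ℝ => extendZero a i j := by
  unfold extendZero
  split_ifs with h
  · fun_prop
  · fun_prop

/-- The jet whose coordinates outside the box vanish. -/
def jetExt {n : ℕ} (e : JetBox n) : Jet := (e.1, e.2.1, extendZero e.2.2.1, extendZero e.2.2.2)

lemma jetPlot_jetExt {n : ℕ} (e : JetBox n) : JetPlot (jetExt : JetBox n → Jet) e := by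
  refine ⟨contDiffAt_fst, (contDiff_fst.comp contDiff_snd).contDiffAt, fun i j => ?_, fun i j => ?_⟩
  · exact ((contDiff_extendZero i j).comp
      (contDiff_fst.comp (contDiff_snd.comp contDiff_snd))).contDiffAt
  · exact ((contDiff_extendZero i j).comp
      (contDiff_snd.comp (contDiff_snd.comp contDiff_snd))).contDiffAt

lemma agreeTo_add_jetExt (n : ℕ) (p q : Jet) : AgreeTo n q (p + jetExt (jetTrunc n (q - p))) := by
  refine ⟨?_, ?_, fun i j hij => ?_⟩
  · simp [jetExt, jetTrunc, jx]
  · simp [jetExt, jetTrunc, jy]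
  · have h1 : i < n + 1 ∧ j < n + 1 := by omega
    simp [jetExt, jetTrunc, ju, jv, extendZero, h1, hij]

lemma HasVelocity.hasDerivAt_jetTrunc {n : ℕ} {γ : ℝ → Jet} {v : Jet} (h : HasVelocity n γ v)
    (p : Jet) : HasDerivAt (fun t => jetTrunc n (γ t - p)) (jetTrunc n v) 0 := by
  refine (h.1.sub_const _).prodMk ((h.2.1.sub_const _).prodMk (HasDerivAt.prodMk ?_ ?_))
  · refine hasDerivAt_pi.2 fun i => hasDerivAt_pi.2 fun j => ?_
    by_cases hij : (i : ℕ) + j ≤ n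
    · simpa [hij, ju] using (h.2.2 i j hij).1.sub_const (ju i j p)
    · simpa [hij] using hasDerivAt_const (0 : ℝ) (0 : ℝ)
  · refine hasDerivAt_pi.2 fun i => hasDerivAt_pi.2 fun j => ?_
    by_cases hij : (i : ℕ) + j ≤ n
    · simpa [hij, jv] using (h.2.2 i j hij).2.sub_const (jv i j p)
    · simpa [hij] using hasDerivAt_const (0 : ℝ) (0 : ℝ)

/-- The chain rule for functions of finite order along curves in the jet space. -/
lemma HasOrder.hasDerivAt_comp {Ω : Set Jet} (hΩ : JetOpen Ω) {n : ℕ} {g : Jet → ℝ}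
    (hg : HasOrder Ω n g) {p : Jet} (hs : JetSmoothAt g p) (hp : p ∈ Ω) {γ : ℝ → Jet}
    (hγ : JetPlot γ 0) (h0 : γ 0 = p) {v : Jet} (hv : HasVelocity n γ v) :
    HasDerivAt (fun t => g (γ t)) (lineDeriv ℝ g p v) 0 := by
  have hpl : ∀ e, JetPlot (fun e : JetBox n => p + jetExt e) e := fun e =>
    (jetPlot_const p).add (jetPlot_jetExt e)
  have hz : p + jetExt (0 : JetBox n) = p := by
    ext <;> simp [jetExt, extendZero]
  have hd : HasFDerivAt (fun e : JetBox n => g (p + jetExt e))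
      (fderiv ℝ (fun e : JetBox n => g (p + jetExt e)) 0) 0 :=
    ((hs _ _ 0 (hpl 0) hz).differentiableAt (by simp)).hasFDerivAt
  -- A function of order `n` factors near `0`, along `δ`, through the finite-dimensional family `e ↦
  -- p + jetExt e`, where the ordinary chain rule holds. The resulting derivative depends on `v`
  -- alone, so comparison with the straight line identifies it as the line derivative.
  have key : ∀ δ : ℝ → Jet, JetPlot δ 0 → δ 0 = p → HasVelocity n δ v →
      HasDerivAt (fun t => g (δ t))
        (fderiv ℝ (fun e : JetBox n => g (p + jetExt e)) 0 (jetTrunc n v)) 0 := by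
    intro δ hδ hδ0 hδv
    have ht := hδv.hasDerivAt_jetTrunc p
    have h0' : jetTrunc n (δ 0 - p) = 0 := by
      rw [hδ0, sub_self]; ext <;> simp [jetTrunc, jx, jy, ju, jv]
    have hc := HasFDerivAt.comp_hasDerivAt_of_eq (0 : ℝ) hd ht h0'.symm
    refine hc.congr_of_eventuallyEq ?_
    have e1 := hΩ ℝ δ 0 hδ (hδ0 ▸ hp)
    have e2 : ∀ᶠ e in 𝓝 (0 : JetBox n), p + jetExt e ∈ Ω := hΩ _ _ 0 (hpl 0) (hz.symm ▸ hp)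
    have e3 := (h0' ▸ ht.continuousAt.tendsto).eventually e2
    filter_upwards [e1, e3] with t ht1 ht3
    exact hg _ ht1 _ ht3 (agreeTo_add_jetExt n p (δ t))
  have hl := key _ (jetPlot_line p v 0) (by simp) (hasVelocity_line n p v)
  have : lineDeriv ℝ g p v = _ := hl.deriv
  rw [this]
  exact key γ hγ h0 hv

end SDeform

end

/-! ### The prolonged equation as a graph over the parametric coordinates -/

noncomputable section

namespace SDeform

open Filter Topology

/-- The standing assumptions on the data of the system. -/
structure SmoothData (η₁ η₂ : ℝ → ℝ) (I J : Set ℝ) : Prop where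
  isOpen_left : IsOpen I
  isOpen_right : IsOpen J
  contDiffOn_left : ContDiffOn ℝ ∞ η₁ I
  contDiffOn_right : ContDiffOn ℝ ∞ η₂ J

lemma contDiffAt_deriv {f : ℝ → ℝ} {x : ℝ} (hf : ContDiffAt ℝ ∞ f x) :
    ContDiffAt ℝ ∞ (deriv f) x :=
  (hf.fderiv_right (m := ∞) (by simp)).clm_apply contDiffAt_const

/-- The right-hand side of the first equation. -/
def rhsU (η₁ η₂ : ℝ → ℝ) (p : Jet) : ℝ :=
  (1 / 2 * deriv η₁ (jx p) * jv 0 0 p ^ 2 * jv 1 0 p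
    + 1 / 2 * deriv η₂ (jy p) * ju 0 0 p * jv 0 0 p * ju 0 1 p
    + (η₁ (jx p) - η₂ (jy p)) * ju 0 0 p * ju 0 1 p * jv 0 1 p
    + ju 0 0 p ^ 2 * jv 0 0 p ^ 3) / (ju 0 0 p * jv 0 0 p * (η₁ (jx p) - η₂ (jy p)))

/-- The right-hand side of the second equation. -/
def rhsV (η₁ η₂ : ℝ → ℝ) (p : Jet) : ℝ :=
  (1 / 2 * deriv η₁ (jx p) * ju 0 0 p * jv 0 0 p * jv 1 0 p
    + 1 / 2 * deriv η₂ (jy p) * ju 0 0 p ^ 2 * ju 0 1 p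
    + (η₂ (jy p) - η₁ (jx p)) * jv 0 0 p * jv 1 0 p * ju 1 0 p
    + ju 0 0 p ^ 3 * jv 0 0 p ^ 2) / (ju 0 0 p * jv 0 0 p * (η₂ (jy p) - η₁ (jx p)))

lemma eqnU_eq (η₁ η₂ : ℝ → ℝ) : eqnU η₁ η₂ = fun p => ju 0 2 p - rhsU η₁ η₂ p := rfl

lemma eqnV_eq (η₁ η₂ : ℝ → ℝ) : eqnV η₁ η₂ = fun p => jv 2 0 p - rhsV η₁ η₂ p := rfl

/-- The prolonged right-hand sides `D_x^i D_y^j` of the first equation. -/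
def prolongU (η₁ η₂ : ℝ → ℝ) (i j : ℕ) : Jet → ℝ := jetDx^[i] (jetDy^[j] (rhsU η₁ η₂))

/-- The prolonged right-hand sides `D_x^i D_y^j` of the second equation. -/
def prolongV (η₁ η₂ : ℝ → ℝ) (i j : ℕ) : Jet → ℝ := jetDx^[i] (jetDy^[j] (rhsV η₁ η₂))

section Totals

variable {Ω : Set Jet} {r : Jet → ℝ}

lemma lineDeriv_ju_sub {p v : Jet} (hr : JetSmoothAt r p) (i j : ℕ) :
    lineDeriv ℝ (fun q => ju i j q - r q) p v = ju i j v - lineDeriv ℝ r p v :=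
  HasDerivAt.deriv (((hasVelocity_line (i + j) p v).2.2 i j le_rfl).1.sub
    (hr.differentiableAt_line v).hasDerivAt)

lemma lineDeriv_jv_sub {p v : Jet} (hr : JetSmoothAt r p) (i j : ℕ) :
    lineDeriv ℝ (fun q => jv i j q - r q) p v = jv i j v - lineDeriv ℝ r p v :=
  HasDerivAt.deriv (((hasVelocity_line (i + j) p v).2.2 i j le_rfl).2.sub
    (hr.differentiableAt_line v).hasDerivAt)

lemma iterate_total_ju_sub (hΩ : JetOpen Ω) (hr : JetSmoothOn Ω r) (a b i j : ℕ) :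
    ∀ p ∈ Ω, (jetDx^[i] (jetDy^[j] fun q => ju a b q - r q)) p
      = ju (a + i) (b + j) p - (jetDx^[i] (jetDy^[j] r)) p := by
  have hy : ∀ p ∈ Ω, (jetDy^[j] fun q => ju a b q - r q) p
      = ju a (b + j) p - (jetDy^[j] r) p := by
    induction j with
    | zero => exact fun _ _ => rfl
    | succ j ih =>
      intro p hp
      rw [Function.iterate_succ_apply', Function.iterate_succ_apply']
      exact (lineDeriv_congr_of_jetOpen hΩ ih hp _).trans
        (lineDeriv_ju_sub (hr.iterate_jetDy j p hp) a (b + j))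
  induction i with
  | zero => exact hy
  | succ i ih =>
    intro p hp
    rw [Function.iterate_succ_apply', Function.iterate_succ_apply']
    exact (lineDeriv_congr_of_jetOpen hΩ ih hp _).trans
      (lineDeriv_ju_sub ((hr.iterate_jetDy j).iterate_jetDx i p hp) (a + i) (b + j))

lemma iterate_total_jv_sub (hΩ : JetOpen Ω) (hr : JetSmoothOn Ω r) (a b i j : ℕ) :
    ∀ p ∈ Ω, (jetDx^[i] (jetDy^[j] fun q => jv a b q - r q)) p
      = jv (a + i) (b + j) p - (jetDx^[i] (jetDy^[j] r)) p := by
  have hy : ∀ p ∈ Ω, (jetDy^[j] fun q => jv a b q - r q) p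
      = jv a (b + j) p - (jetDy^[j] r) p := by
    induction j with
    | zero => exact fun _ _ => rfl
    | succ j ih =>
      intro p hp
      rw [Function.iterate_succ_apply', Function.iterate_succ_apply']
      exact (lineDeriv_congr_of_jetOpen hΩ ih hp _).trans
        (lineDeriv_jv_sub (hr.iterate_jetDy j p hp) a (b + j))
  induction i with
  | zero => exact hy
  | succ i ih =>
    intro p hp
    rw [Function.iterate_succ_apply', Function.iterate_succ_apply']
    exact (lineDeriv_congr_of_jetOpen hΩ ih hp _).trans
      (lineDeriv_jv_sub ((hr.iterate_jetDy j).iterate_jetDx i p hp) (a + i) (b + j))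

end Totals

/-- Replace the principal coordinates `u_{i,j+2}`, `v_{i+2,j}` by the values which the system
prescribes for them. -/
def eqnStep (η₁ η₂ : ℝ → ℝ) (p : Jet) : Jet :=
  (jx p, jy p, fun i j => if 2 ≤ j then prolongU η₁ η₂ i (j - 2) p else ju i j p,
    fun i j => if 2 ≤ i then prolongV η₁ η₂ (i - 2) j p else jv i j p)

/-- The point of the equation with the same parametric coordinates as `p`. -/
def jetNormal (η₁ η₂ : ℝ → ℝ) (p : Jet) : Jet :=
  (jx p, jy p, fun i j => ju i j ((eqnStep η₁ η₂)^[i + j] p),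
    fun i j => jv i j ((eqnStep η₁ η₂)^[i + j] p))

/-- Agreement of `x`, `y` and the parametric coordinates of order at most `n`. -/
def AgreeParam (n : ℕ) (p q : Jet) : Prop :=
  jx p = jx q ∧ jy p = jy q ∧ ∀ i j, i + j ≤ n →
    (j < 2 → ju i j p = ju i j q) ∧ (i < 2 → jv i j p = jv i j q)

lemma AgreeTo.agreeParam {n : ℕ} {p q : Jet} (h : AgreeTo n p q) : AgreeParam n p q :=
  ⟨h.1, h.2.1, fun i j hij => ⟨fun _ => (h.2.2 i j hij).1, fun _ => (h.2.2 i j hij).2⟩⟩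

lemma AgreeParam.symm {n : ℕ} {p q : Jet} (h : AgreeParam n p q) : AgreeParam n q p :=
  ⟨h.1.symm, h.2.1.symm, fun i j hij =>
    ⟨fun hj => ((h.2.2 i j hij).1 hj).symm, fun hi => ((h.2.2 i j hij).2 hi).symm⟩⟩

lemma AgreeParam.refl (n : ℕ) (p : Jet) : AgreeParam n p p := (AgreeTo.refl n p).agreeParam

lemma AgreeParam.trans {n : ℕ} {p q r : Jet} (h : AgreeParam n p q) (k : AgreeParam n q r) :
    AgreeParam n p r :=
  ⟨h.1.trans k.1, h.2.1.trans k.2.1, fun i j hij =>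
    ⟨fun hj => ((h.2.2 i j hij).1 hj).trans ((k.2.2 i j hij).1 hj),
      fun hi => ((h.2.2 i j hij).2 hi).trans ((k.2.2 i j hij).2 hi)⟩⟩

lemma AgreeParam.mono {m n : ℕ} (hmn : m ≤ n) {p q : Jet} (h : AgreeParam n p q) :
    AgreeParam m p q :=
  ⟨h.1, h.2.1, fun i j hij => h.2.2 i j (hij.trans hmn)⟩

lemma AgreeParam.agreeTo {n : ℕ} (hn : n ≤ 1) {p q : Jet} (h : AgreeParam n p q) :
    AgreeTo n p q :=
  ⟨h.1, h.2.1, fun i j hij => ⟨(h.2.2 i j hij).1 (by omega), (h.2.2 i j hij).2 (by omega)⟩⟩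

lemma AgreeParam.add_smul {n : ℕ} {p q v w : Jet} (h : AgreeParam n p q) (k : AgreeParam n v w)
    (t : ℝ) : AgreeParam n (p + t • v) (q + t • w) := by
  refine ⟨?_, ?_, fun i j hij => ⟨fun hj => ?_, fun hi => ?_⟩⟩
  · exact congrArg₂ (fun a b => a + t * b) h.1 k.1
  · exact congrArg₂ (fun a b => a + t * b) h.2.1 k.2.1
  · exact congrArg₂ (fun a b => a + t * b) ((h.2.2 i j hij).1 hj) ((k.2.2 i j hij).1 hj)
  · exact congrArg₂ (fun a b => a + t * b) ((h.2.2 i j hij).2 hi) ((k.2.2 i j hij).2 hi)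

lemma agreeParam_eqnStep (η₁ η₂ : ℝ → ℝ) (n : ℕ) (p : Jet) :
    AgreeParam n (eqnStep η₁ η₂ p) p :=
  ⟨rfl, rfl, fun _ _ _ => ⟨fun hj => if_neg (by omega), fun hi => if_neg (by omega)⟩⟩

lemma agreeParam_iterate_eqnStep (η₁ η₂ : ℝ → ℝ) (n m : ℕ) (p : Jet) :
    AgreeParam n ((eqnStep η₁ η₂)^[m] p) p := by
  induction m with
  | zero => exact AgreeParam.refl n p
  | succ m ih =>
    rw [Function.iterate_succ_apply']
    exact (agreeParam_eqnStep η₁ η₂ n _).trans ih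

lemma agreeParam_jetNormal (η₁ η₂ : ℝ → ℝ) (n : ℕ) (p : Jet) :
    AgreeParam n (jetNormal η₁ η₂ p) p :=
  ⟨rfl, rfl, fun i j _ =>
    ⟨fun hj => ((agreeParam_iterate_eqnStep η₁ η₂ (i + j) (i + j) p).2.2 i j le_rfl).1 hj,
      fun hi => ((agreeParam_iterate_eqnStep η₁ η₂ (i + j) (i + j) p).2.2 i j le_rfl).2 hi⟩⟩

lemma eq_of_agreeTo {p q : Jet} (h : ∀ n, AgreeTo n p q) : p = q :=
  Prod.ext (h 0).1 (Prod.ext (h 0).2.1 (Prod.ext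
    (funext fun i => funext fun j => ((h (i + j)).2.2 i j le_rfl).1)
    (funext fun i => funext fun j => ((h (i + j)).2.2 i j le_rfl).2)))

section System

variable {η₁ η₂ : ℝ → ℝ} {I J : Set ℝ}

lemma mem_jetDomain_of_agreeParam {n : ℕ} {p q : Jet} (h : AgreeParam n p q)
    (hp : p ∈ jetDomain η₁ η₂ I J) : q ∈ jetDomain η₁ η₂ I J := by
  have h1 := (h.2.2 0 0 (by omega)).1 (by omega)
  have h2 := (h.2.2 0 0 (by omega)).2 (by omega)
  simp only [jetDomain, Set.mem_ofPred_eq] at hp ⊢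
  rwa [← h.1, ← h.2.1, ← h1, ← h2]

lemma iterate_eqnStep_mem {p : Jet} (hp : p ∈ jetDomain η₁ η₂ I J) (m : ℕ) :
    (eqnStep η₁ η₂)^[m] p ∈ jetDomain η₁ η₂ I J :=
  mem_jetDomain_of_agreeParam (agreeParam_iterate_eqnStep η₁ η₂ 0 m p).symm hp

lemma jetNormal_mem {p : Jet} (hp : p ∈ jetDomain η₁ η₂ I J) :
    jetNormal η₁ η₂ p ∈ jetDomain η₁ η₂ I J :=
  mem_jetDomain_of_agreeParam (agreeParam_jetNormal η₁ η₂ 0 p).symm hp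

lemma hasOrder_rhsU : HasOrder (jetDomain η₁ η₂ I J) 1 (rhsU η₁ η₂) := by
  intro p _ q _ h
  have h00 := h.2.2 0 0 (by omega)
  have h10 := h.2.2 1 0 (by omega)
  have h01 := h.2.2 0 1 (by omega)
  simp only [rhsU, h.1, h.2.1, h00.1, h00.2, h10.2, h01.1, h01.2]

lemma hasOrder_rhsV : HasOrder (jetDomain η₁ η₂ I J) 1 (rhsV η₁ η₂) := by
  intro p _ q _ h
  have h00 := h.2.2 0 0 (by omega)
  have h10 := h.2.2 1 0 (by omega)
  have h01 := h.2.2 0 1 (by omega)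
  simp only [rhsV, h.1, h.2.1, h00.1, h00.2, h10.1, h10.2, h01.1]

variable (hd : SmoothData η₁ η₂ I J)
include hd

lemma SmoothData.contDiffAt_left {x : ℝ} (hx : x ∈ I) : ContDiffAt ℝ ∞ η₁ x :=
  hd.contDiffOn_left.contDiffAt (hd.isOpen_left.mem_nhds hx)

lemma SmoothData.contDiffAt_right {y : ℝ} (hy : y ∈ J) : ContDiffAt ℝ ∞ η₂ y :=
  hd.contDiffOn_right.contDiffAt (hd.isOpen_right.mem_nhds hy)

lemma jetOpen_jetDomain : JetOpen (jetDomain η₁ η₂ I J) := by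
  intro E _ _ γ e hγ he
  have c1 : ContinuousAt (fun z => η₁ (jx (γ z))) e :=
    ContinuousAt.comp (f := fun z => jx (γ z)) (hd.contDiffAt_left he.1).continuousAt
      hγ.1.continuousAt
  have c2 : ContinuousAt (fun z => η₂ (jy (γ z))) e :=
    ContinuousAt.comp (f := fun z => jy (γ z)) (hd.contDiffAt_right he.2.1).continuousAt
      hγ.2.1.continuousAt
  filter_upwards [hγ.1.continuousAt.eventually_mem (hd.isOpen_left.mem_nhds he.1),
    hγ.2.1.continuousAt.eventually_mem (hd.isOpen_right.mem_nhds he.2.1),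
    (c1.sub c2).eventually_ne (sub_ne_zero.2 he.2.2.1), (hγ.2.2.1 0 0).continuousAt.eventually_ne he.2.2.2.1,
    (hγ.2.2.2 0 0).continuousAt.eventually_ne he.2.2.2.2] with z h1 h2 h3 h4 h5
  exact ⟨h1, h2, sub_ne_zero.1 h3, h4, h5⟩

lemma jetSmoothOn_rhs : JetSmoothOn (jetDomain η₁ η₂ I J) (rhsU η₁ η₂) ∧
    JetSmoothOn (jetDomain η₁ η₂ I J) (rhsV η₁ η₂) := by
  have key : ∀ p ∈ jetDomain η₁ η₂ I J, ∀ (E : Type) [NormedAddCommGroup E] [NormedSpace ℝ E]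
      (γ : E → Jet) (e : E), JetPlot γ e → γ e = p →
      ContDiffAt ℝ ∞ (fun z => rhsU η₁ η₂ (γ z)) e ∧
      ContDiffAt ℝ ∞ (fun z => rhsV η₁ η₂ (γ z)) e := by
    rintro _ hp E _ _ γ e hγ rfl
    have e1 : ContDiffAt ℝ ∞ (fun z => η₁ (jx (γ z))) e :=
      (hd.contDiffAt_left hp.1).comp e hγ.1
    have e2 : ContDiffAt ℝ ∞ (fun z => η₂ (jy (γ z))) e :=
      (hd.contDiffAt_right hp.2.1).comp e hγ.2.1
    have d1 : ContDiffAt ℝ ∞ (fun z => deriv η₁ (jx (γ z))) e :=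
      ContDiffAt.comp (g := deriv η₁) e (contDiffAt_deriv (hd.contDiffAt_left hp.1)) hγ.1
    have d2 : ContDiffAt ℝ ∞ (fun z => deriv η₂ (jy (γ z))) e :=
      ContDiffAt.comp (g := deriv η₂) e
        (contDiffAt_deriv (hd.contDiffAt_right hp.2.1)) hγ.2.1
    have u0 := hγ.2.2.1 0 0
    have v0 := hγ.2.2.2 0 0
    have ux := hγ.2.2.1 1 0
    have uy := hγ.2.2.1 0 1
    have vx := hγ.2.2.2 1 0
    have vy := hγ.2.2.2 0 1
    constructor
    · refine ContDiffAt.div ?_ ((u0.mul v0).mul (e1.sub e2))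
        (mul_ne_zero (mul_ne_zero hp.2.2.2.1 hp.2.2.2.2) (sub_ne_zero.2 hp.2.2.1))
      exact ((((contDiffAt_const.mul d1).mul (v0.pow 2)).mul vx).add
        ((((contDiffAt_const.mul d2).mul u0).mul v0).mul uy)).add
        ((((e1.sub e2).mul u0).mul uy).mul vy) |>.add ((u0.pow 2).mul (v0.pow 3))
    · refine ContDiffAt.div ?_ ((u0.mul v0).mul (e2.sub e1))
        (mul_ne_zero (mul_ne_zero hp.2.2.2.1 hp.2.2.2.2) (sub_ne_zero.2 hp.2.2.1.symm))
      exact ((((contDiffAt_const.mul d1).mul u0).mul v0).mul vx).add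
        (((contDiffAt_const.mul d2).mul (u0.pow 2)).mul uy) |>.add
        ((((e2.sub e1).mul v0).mul vx).mul ux) |>.add ((u0.pow 3).mul (v0.pow 2))
  exact ⟨fun p hp E _ _ γ e h1 h2 => (key p hp E γ e h1 h2).1,
    fun p hp E _ _ γ e h1 h2 => (key p hp E γ e h1 h2).2⟩

lemma jetSmoothOn_prolongU (i j : ℕ) :
    JetSmoothOn (jetDomain η₁ η₂ I J) (prolongU η₁ η₂ i j) :=
  ((jetSmoothOn_rhs hd).1.iterate_jetDy j).iterate_jetDx i

lemma jetSmoothOn_prolongV (i j : ℕ) :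
    JetSmoothOn (jetDomain η₁ η₂ I J) (prolongV η₁ η₂ i j) :=
  ((jetSmoothOn_rhs hd).2.iterate_jetDy j).iterate_jetDx i

lemma hasOrder_prolongU (i j : ℕ) :
    HasOrder (jetDomain η₁ η₂ I J) (1 + j + i) (prolongU η₁ η₂ i j) :=
  (hasOrder_rhsU.iterate_jetDy (jetOpen_jetDomain hd) j).iterate_jetDx (jetOpen_jetDomain hd) i

lemma hasOrder_prolongV (i j : ℕ) :
    HasOrder (jetDomain η₁ η₂ I J) (1 + j + i) (prolongV η₁ η₂ i j) :=
  (hasOrder_rhsV.iterate_jetDy (jetOpen_jetDomain hd) j).iterate_jetDx (jetOpen_jetDomain hd) i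

/-- The prolonged equations read `u_{i,j+2} = D_x^i D_y^j rhsU` and `v_{i+2,j} = D_x^i D_y^j rhsV`,
and `eqnStep` substitutes exactly these values and leaves the other coordinates alone. -/
lemma mem_equationManifold_iff {p : Jet} : p ∈ equationManifold η₁ η₂ I J ↔
    p ∈ jetDomain η₁ η₂ I J ∧ eqnStep η₁ η₂ p = p := by
  refine and_congr_right fun hp => ?_
  have hU := fun i j => iterate_total_ju_sub (jetOpen_jetDomain hd) (jetSmoothOn_rhs hd).1
    0 2 i j p hp
  have hV := fun i j => iterate_total_jv_sub (jetOpen_jetDomain hd) (jetSmoothOn_rhs hd).2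
    2 0 i j p hp
  simp only [eqnU_eq, eqnV_eq, hU, hV, sub_eq_zero, zero_add]
  constructor
  · intro h
    refine Prod.ext rfl (Prod.ext rfl (Prod.ext ?_ ?_)) <;> funext i j
    · by_cases hj : 2 ≤ j
      · have := (h i (j - 2)).1
        rw [show 2 + (j - 2) = j by omega] at this
        exact (if_pos hj).trans this.symm
      · exact if_neg hj
    · by_cases hi : 2 ≤ i
      · have := (h (i - 2) j).2
        rw [show 2 + (i - 2) = i by omega] at this
        exact (if_pos hi).trans this.symm
      · exact if_neg hi
  · intro h i j
    constructor
    · have := congrArg (ju i (2 + j)) h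
      simpa [eqnStep, ju, prolongU] using this.symm
    · have := congrArg (jv (2 + i) j) h
      simpa [eqnStep, jv, prolongV] using this.symm

/-- The right-hand side prescribed for a principal coordinate of order `k` has order `k - 1`. This
gain of one order makes the iteration of `eqnStep` stabilise. -/
lemma eqnStep_principal {n : ℕ} {p q : Jet} (hp : p ∈ jetDomain η₁ η₂ I J)
    (hq : q ∈ jetDomain η₁ η₂ I J) (h : AgreeTo n p q) (i j : ℕ) (hij : i + j ≤ n + 1) :
    (2 ≤ j → ju i j (eqnStep η₁ η₂ p) = ju i j (eqnStep η₁ η₂ q)) ∧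
      (2 ≤ i → jv i j (eqnStep η₁ η₂ p) = jv i j (eqnStep η₁ η₂ q)) := by
  constructor
  · intro hj
    refine (if_pos hj).trans (Eq.trans ?_ (if_pos hj).symm)
    exact hasOrder_prolongU hd i (j - 2) p hp q hq (h.mono (by omega))
  · intro hi
    refine (if_pos hi).trans (Eq.trans ?_ (if_pos hi).symm)
    exact hasOrder_prolongV hd (i - 2) j p hp q hq (h.mono (by omega))

lemma agreeTo_eqnStep {n : ℕ} {p q : Jet} (hp : p ∈ jetDomain η₁ η₂ I J)
    (hq : q ∈ jetDomain η₁ η₂ I J) (h : AgreeTo n p q) (k : AgreeParam (n + 1) p q) :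
    AgreeTo (n + 1) (eqnStep η₁ η₂ p) (eqnStep η₁ η₂ q) := by
  have k' := ((agreeParam_eqnStep η₁ η₂ (n + 1) p).trans k).trans
    (agreeParam_eqnStep η₁ η₂ (n + 1) q).symm
  refine ⟨h.1, h.2.1, fun i j hij => ⟨?_, ?_⟩⟩
  · by_cases hj : 2 ≤ j
    · exact (eqnStep_principal hd hp hq h i j hij).1 hj
    · exact (k'.2.2 i j hij).1 (by omega)
  · by_cases hi : 2 ≤ i
    · exact (eqnStep_principal hd hp hq h i j hij).2 hi
    · exact (k'.2.2 i j hij).2 (by omega)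

/-- Coordinates of order `0` are all parametric, and each substitution settles one more order. After
`n` substitutions the coordinates of order at most `n` are functions of the parametric ones. -/
lemma agreeTo_iterate_eqnStep {p q : Jet} (hp : p ∈ jetDomain η₁ η₂ I J)
    (hq : q ∈ jetDomain η₁ η₂ I J) (n : ℕ) : ∀ m, n ≤ m → AgreeParam n p q →
    AgreeTo n ((eqnStep η₁ η₂)^[m] p) ((eqnStep η₁ η₂)^[m] q) := by
  have hpar : ∀ m n, AgreeParam n p q →
      AgreeParam n ((eqnStep η₁ η₂)^[m] p) ((eqnStep η₁ η₂)^[m] q) := fun m n k =>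
    ((agreeParam_iterate_eqnStep η₁ η₂ n m p).trans k).trans
      (agreeParam_iterate_eqnStep η₁ η₂ n m q).symm
  induction n with
  | zero => exact fun m _ k => (hpar m 0 k).agreeTo (by omega)
  | succ n ih =>
    intro m hm k
    obtain ⟨m, rfl⟩ : ∃ m', m = m' + 1 := ⟨m - 1, by omega⟩
    rw [Function.iterate_succ_apply', Function.iterate_succ_apply']
    exact agreeTo_eqnStep hd (iterate_eqnStep_mem hp m) (iterate_eqnStep_mem hq m)
      (ih m (by omega) (k.mono (by omega))) (hpar m _ k)

lemma agreeTo_iterate_iterate {p : Jet} (hp : p ∈ jetDomain η₁ η₂ I J) (n m d : ℕ) (hm : n ≤ m) :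
    AgreeTo n ((eqnStep η₁ η₂)^[m] p) ((eqnStep η₁ η₂)^[m + d] p) := by
  rw [Function.iterate_add_apply]
  exact agreeTo_iterate_eqnStep hd hp (iterate_eqnStep_mem hp d) n m hm
    (agreeParam_iterate_eqnStep η₁ η₂ n d p).symm

lemma agreeTo_jetNormal_iterate {p : Jet} (hp : p ∈ jetDomain η₁ η₂ I J) (n m : ℕ) (hm : n ≤ m) :
    AgreeTo n (jetNormal η₁ η₂ p) ((eqnStep η₁ η₂)^[m] p) := by
  have hpar := agreeParam_iterate_eqnStep η₁ η₂ 0 m p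
  refine ⟨hpar.1.symm, hpar.2.1.symm, fun i j hij => ?_⟩
  have := agreeTo_iterate_iterate hd hp (i + j) (i + j) (m - (i + j)) le_rfl
  rw [show i + j + (m - (i + j)) = m by omega] at this
  exact this.2.2 i j le_rfl

/-- Up to any given order the normal form is a high iterate of `eqnStep`, and one further
substitution no longer changes that order. -/
lemma eqnStep_jetNormal {p : Jet} (hp : p ∈ jetDomain η₁ η₂ I J) :
    eqnStep η₁ η₂ (jetNormal η₁ η₂ p) = jetNormal η₁ η₂ p := by
  refine eq_of_agreeTo fun n => ?_
  have h1 := agreeTo_jetNormal_iterate hd hp (n + 1) (n + 1) le_rfl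
  have h2 := agreeTo_eqnStep hd (jetNormal_mem hp) (iterate_eqnStep_mem hp _)
    (h1.mono (Nat.le_succ n)) h1.agreeParam
  rw [← Function.iterate_succ_apply' (eqnStep η₁ η₂)] at h2
  exact (h2.mono (Nat.le_succ n)).trans (agreeTo_jetNormal_iterate hd hp n _ (by omega)).symm

lemma jetNormal_mem_equationManifold {p : Jet} (hp : p ∈ jetDomain η₁ η₂ I J) :
    jetNormal η₁ η₂ p ∈ equationManifold η₁ η₂ I J :=
  (mem_equationManifold_iff hd).2 ⟨jetNormal_mem hp, eqnStep_jetNormal hd hp⟩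

lemma jetNormal_eq_self {p : Jet} (hp : p ∈ equationManifold η₁ η₂ I J) :
    jetNormal η₁ η₂ p = p := by
  have h := Function.iterate_fixed ((mem_equationManifold_iff hd).1 hp).2
  refine eq_of_agreeTo fun n => ⟨rfl, rfl, fun i j _ => ⟨?_, ?_⟩⟩
  · have := congrArg (ju i j) (h (i + j)); exact this
  · have := congrArg (jv i j) (h (i + j)); exact this

lemma agreeTo_jetNormal {n : ℕ} {p q : Jet} (hp : p ∈ jetDomain η₁ η₂ I J)
    (hq : q ∈ jetDomain η₁ η₂ I J) (h : AgreeParam n p q) :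
    AgreeTo n (jetNormal η₁ η₂ p) (jetNormal η₁ η₂ q) :=
  ((agreeTo_jetNormal_iterate hd hp n n le_rfl).trans
    (agreeTo_iterate_eqnStep hd hp hq n n le_rfl h)).trans
    (agreeTo_jetNormal_iterate hd hq n n le_rfl).symm

/-- On the equation, the principal coordinates of order `n + 1` are determined by the parametric
coordinates of order `n`. -/
lemma agreeTo_of_agreeParam {n : ℕ} {p q : Jet} (hp : p ∈ equationManifold η₁ η₂ I J)
    (hq : q ∈ equationManifold η₁ η₂ I J) (h : AgreeParam n p q) :
    AgreeTo n p q ∧ ∀ i j, i + j ≤ n + 1 →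
      (2 ≤ j → ju i j p = ju i j q) ∧ (2 ≤ i → jv i j p = jv i j q) := by
  have h1 := agreeTo_jetNormal hd hp.1 hq.1 h
  rw [jetNormal_eq_self hd hp, jetNormal_eq_self hd hq] at h1
  refine ⟨h1, fun i j hij => ?_⟩
  have h2 := eqnStep_principal hd hp.1 hq.1 h1 i j hij
  rwa [((mem_equationManifold_iff hd).1 hp).2, ((mem_equationManifold_iff hd).1 hq).2] at h2

section Plots

variable {E : Type} [NormedAddCommGroup E] [NormedSpace ℝ E] {γ : E → Jet} {e : E}

lemma JetPlot.eqnStep (hγ : JetPlot γ e) (he : γ e ∈ jetDomain η₁ η₂ I J) :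
    JetPlot (fun z => eqnStep η₁ η₂ (γ z)) e := by
  refine ⟨hγ.1, hγ.2.1, fun i j => ?_, fun i j => ?_⟩
  · by_cases hj : 2 ≤ j
    · simpa [SDeform.eqnStep, ju, hj] using
        jetSmoothOn_prolongU hd i (j - 2) _ he E γ e hγ rfl
    · simpa [SDeform.eqnStep, ju, hj] using hγ.2.2.1 i j
  · by_cases hi : 2 ≤ i
    · simpa [SDeform.eqnStep, jv, hi] using
        jetSmoothOn_prolongV hd (i - 2) j _ he E γ e hγ rfl
    · simpa [SDeform.eqnStep, jv, hi] using hγ.2.2.2 i j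

lemma JetPlot.iterate_eqnStep (hγ : JetPlot γ e) (he : γ e ∈ jetDomain η₁ η₂ I J) (m : ℕ) :
    JetPlot (fun z => (SDeform.eqnStep η₁ η₂)^[m] (γ z)) e := by
  induction m with
  | zero => exact hγ
  | succ m ih =>
    simp only [Function.iterate_succ_apply']
    exact ih.eqnStep hd (iterate_eqnStep_mem he m)

lemma JetPlot.jetNormal (hγ : JetPlot γ e) (he : γ e ∈ jetDomain η₁ η₂ I J) :
    JetPlot (fun z => jetNormal η₁ η₂ (γ z)) e :=
  ⟨hγ.1, hγ.2.1, fun i j => (hγ.iterate_eqnStep hd he (i + j)).2.2.1 i j,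
    fun i j => (hγ.iterate_eqnStep hd he (i + j)).2.2.2 i j⟩

end Plots

lemma eq_prolong_of_mem {p : Jet} (hp : p ∈ equationManifold η₁ η₂ I J) (i j : ℕ) :
    ju i (j + 2) p = prolongU η₁ η₂ i j p ∧ jv (i + 2) j p = prolongV η₁ η₂ i j p := by
  have h := ((mem_equationManifold_iff hd).1 hp).2
  constructor
  · have := congrArg (ju i (j + 2)) h
    simpa [eqnStep, ju] using this.symm
  · have := congrArg (jv (i + 2) j) h
    simpa [eqnStep, jv] using this.symm

/-- A vector satisfying the linearized system at a point of the equation is the velocity of a curve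
in the equation. -/
lemma hasVelocity_jetNormal {p v : Jet} (hp : p ∈ equationManifold η₁ η₂ I J)
    (hv : ∀ i j, ju i (j + 2) v = lineDeriv ℝ (prolongU η₁ η₂ i j) p v ∧
      jv (i + 2) j v = lineDeriv ℝ (prolongV η₁ η₂ i j) p v) (n : ℕ) :
    HasVelocity n (fun t => jetNormal η₁ η₂ (p + t • v)) v := by
  have hev := jetOpen_jetDomain hd ℝ _ 0 (jetPlot_line p v 0) (by simpa using hp.1)
  have hpl : JetPlot (fun t : ℝ => jetNormal η₁ η₂ (p + t • v)) 0 :=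
    (jetPlot_line p v 0).jetNormal hd (by simpa using hp.1)
  have h0 : jetNormal η₁ η₂ (p + (0 : ℝ) • v) = p := by simpa using jetNormal_eq_self hd hp
  have hparU : ∀ i j, j < 2 → HasDerivAt (fun t : ℝ => ju i j (jetNormal η₁ η₂ (p + t • v)))
      (ju i j v) 0 := fun i j hj =>
    ((hasVelocity_line (i + j) p v).2.2 i j le_rfl).1.congr_of_eventuallyEq
      (Eventually.of_forall fun t => ((agreeParam_jetNormal η₁ η₂ (i + j) _).2.2 i j le_rfl).1 hj)
  have hparV : ∀ i j, i < 2 → HasDerivAt (fun t : ℝ => jv i j (jetNormal η₁ η₂ (p + t • v)))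
      (jv i j v) 0 := fun i j hi =>
    ((hasVelocity_line (i + j) p v).2.2 i j le_rfl).2.congr_of_eventuallyEq
      (Eventually.of_forall fun t => ((agreeParam_jetNormal η₁ η₂ (i + j) _).2.2 i j le_rfl).2 hi)
  have hxy := hasVelocity_line 0 p v
  -- Along the curve a principal coordinate of order `n + 1` equals a prolonged right-hand side of
  -- order at most `n`. The chain rule and the velocity up to order `n` give its derivative, and
  -- `hv` says that this is the coordinate of `v`.
  induction n with
  | zero => exact ⟨hxy.1, hxy.2.1, fun i j hij => ⟨hparU i j (by omega), hparV i j (by omega)⟩⟩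
  | succ n ih =>
    refine ⟨hxy.1, hxy.2.1, fun i j hij => ⟨?_, ?_⟩⟩
    · by_cases hj : j < 2
      · exact hparU i j hj
      · obtain ⟨j, rfl⟩ : ∃ k, j = k + 2 := ⟨j - 2, by omega⟩
        rw [(hv i j).1]
        refine (((hasOrder_prolongU hd i j).mono (n := n) (by omega)).hasDerivAt_comp
          (jetOpen_jetDomain hd) (jetSmoothOn_prolongU hd i j p hp.1) hp.1 hpl h0
          ih).congr_of_eventuallyEq ?_
        filter_upwards [hev] with t ht
        exact (eq_prolong_of_mem hd (jetNormal_mem_equationManifold hd ht) i j).1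
    · by_cases hi : i < 2
      · exact hparV i j hi
      · obtain ⟨i, rfl⟩ : ∃ k, i = k + 2 := ⟨i - 2, by omega⟩
        rw [(hv i j).2]
        refine (((hasOrder_prolongV hd i j).mono (n := n) (by omega)).hasDerivAt_comp
          (jetOpen_jetDomain hd) (jetSmoothOn_prolongV hd i j p hp.1) hp.1 hpl h0
          ih).congr_of_eventuallyEq ?_
        filter_upwards [hev] with t ht
        exact (eq_prolong_of_mem hd (jetNormal_mem_equationManifold hd ht) i j).2

/-- The total derivative field is tangent to the equation, because the total derivative of a
prolonged equation is another prolonged equation. -/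
lemma hasVelocity_jetFieldX {p : Jet} (hp : p ∈ equationManifold η₁ η₂ I J) (n : ℕ) :
    HasVelocity n (fun t => jetNormal η₁ η₂ (p + t • jetFieldX p)) (jetFieldX p) := by
  refine hasVelocity_jetNormal hd hp (fun i j => ⟨?_, ?_⟩) n
  · refine ((eq_prolong_of_mem hd hp (i + 1) j).1).trans ?_
    rw [prolongU, Function.iterate_succ_apply']; rfl
  · refine (show jv (i + 2 + 1) j p = jv (i + 1 + 2) j p by congr 1).trans
      (((eq_prolong_of_mem hd hp (i + 1) j).2).trans ?_)
    rw [prolongV, Function.iterate_succ_apply']; rfl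

/-- As for `D_x`, except that `D_y` has to be moved past the iterates of `D_x`; this is where
commutation of the total derivatives is needed. -/
lemma hasVelocity_jetFieldY {p : Jet} (hp : p ∈ equationManifold η₁ η₂ I J) (n : ℕ) :
    HasVelocity n (fun t => jetNormal η₁ η₂ (p + t • jetFieldY p)) (jetFieldY p) := by
  refine hasVelocity_jetNormal hd hp (fun i j => ⟨?_, ?_⟩) n
  · refine (show ju i (j + 2 + 1) p = ju i (j + 1 + 2) p by congr 1).trans
      (((eq_prolong_of_mem hd hp i (j + 1)).1).trans ?_)
    rw [prolongU, Function.iterate_succ_apply']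
    exact (jetDy_iterate_jetDx (jetOpen_jetDomain hd)
      ((jetSmoothOn_rhs hd).1.iterate_jetDy j) i p hp.1).symm
  · refine ((eq_prolong_of_mem hd hp i (j + 1)).2).trans ?_
    rw [prolongV, Function.iterate_succ_apply']
    exact (jetDy_iterate_jetDx (jetOpen_jetDomain hd)
      ((jetSmoothOn_rhs hd).2.iterate_jetDy j) i p hp.1).symm

end System

end SDeform

end

/-! ### Binomial power series and coefficientwise calculus -/

noncomputable section

namespace SDeform

section BinomialSeries

open PowerSeries

lemma coeff_powSeries_odd (r c : ℝ) {m : ℕ} (hm : ¬ Even m) : coeff m (powSeries r c) = 0 := by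
  simp [powSeries, hm]

lemma coeff_powSeries_zero (r c : ℝ) : coeff 0 (powSeries r c) = 1 := by
  simp [powSeries]

lemma coeff_powSeries_add_two (r c : ℝ) (m : ℕ) :
    coeff (m + 2) (powSeries r c) * (m + 2)
      = ((2 * r - m) * c : ℝ) * coeff m (powSeries r c) := by
  by_cases hm : Even m
  · obtain ⟨k, rfl⟩ := hm
    have h1 : Even (k + k + 2) := by simp [parity_simps]
    have h2 : (k + k + 2) / 2 = k + 1 := by omega
    have h3 : (k + k) / 2 = k := by omega
    simp only [powSeries, coeff_mk, h1, h2, h3, if_true, Even.add_self]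
    norm_cast
    rw [Finset.prod_range_succ, Nat.factorial_succ]
    have : (Nat.factorial k : ℝ) ≠ 0 := by positivity
    push_cast
    field_simp
    ring
  · have h1 : ¬ Even (m + 2) := by simpa [parity_simps] using hm
    rw [coeff_powSeries_odd r c hm, coeff_powSeries_odd r c h1]; simp

/-- This is the two-step recursion of the binomial coefficients. With it, identities between formal
square roots follow by comparing derivatives and constant terms. -/
lemma derivative_powSeries (r c : ℝ) :
    (1 + C (c : ℂ) * X ^ 2) * derivative ℂ (powSeries r c)
      = C ((2 * r * c : ℝ) : ℂ) * X * powSeries r c := by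
  ext m
  rw [add_mul, one_mul, mul_assoc, mul_assoc, map_add, coeff_C_mul, coeff_C_mul,
    coeff_derivative]
  rcases m with _ | m
  · rw [coeff_powSeries_odd r c (by decide)]
    simp [pow_two, mul_assoc]
  · rw [coeff_succ_X_mul]
    have h := coeff_powSeries_add_two r c m
    rcases m with _ | m
    · have h2 : coeff (0 + 1) (X ^ 2 * derivative ℂ (powSeries r c)) = 0 := by
        rw [pow_two, mul_assoc, coeff_succ_X_mul]; simp
      rw [h2]
      push_cast at h ⊢
      linear_combination h
    · have h2 : coeff (m + 1 + 1) (X ^ 2 * derivative ℂ (powSeries r c))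
          = coeff (m + 1) (powSeries r c) * (m + 1) := by
        rw [pow_two, mul_assoc, coeff_succ_X_mul, coeff_succ_X_mul, coeff_derivative]
      rw [h2]
      push_cast at h ⊢
      linear_combination h

lemma one_add_C_mul_X_sq_ne_zero (c : ℂ) : (1 + C c * X ^ 2 : ℂ⟦X⟧) ≠ 0 := by
  intro h
  have := congrArg (coeff 0) h
  simp at this

lemma constantCoeff_powSeries (r c : ℝ) : constantCoeff (powSeries r c) = 1 := by
  rw [← coeff_zero_eq_constantCoeff_apply, coeff_powSeries_zero]

lemma powSeries_half_mul_neg_half (c : ℝ) :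
    powSeries (1 / 2) c * powSeries (-1 / 2) c = 1 := by
  refine derivative.ext ?_ (by simp [constantCoeff_powSeries])
  refine mul_left_cancel₀ (one_add_C_mul_X_sq_ne_zero (c : ℂ)) ?_
  have h1 := derivative_powSeries (1 / 2) c
  have h2 := derivative_powSeries (-1 / 2) c
  have h3 : C ((2 * (-1 / 2) * c : ℝ) : ℂ) = -C ((2 * (1 / 2) * c : ℝ) : ℂ) := by
    rw [← map_neg]; push_cast; ring_nf
  rw [h3] at h2
  rw [Derivation.leibniz, smul_eq_mul, smul_eq_mul, derivative_one]
  linear_combination powSeries (1 / 2) c * h2 + powSeries (-1 / 2) c * h1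

lemma one_add_mul_powSeries_neg_half_sq (c : ℝ) :
    (1 + C (c : ℂ) * X ^ 2) * powSeries (-1 / 2) c ^ 2 = 1 := by
  refine derivative.ext ?_ (by simp [constantCoeff_powSeries])
  have h2 := derivative_powSeries (-1 / 2) c
  have h3 : C ((2 * (-1 / 2) * c : ℝ) : ℂ) = -C (c : ℂ) := by
    rw [← map_neg]; push_cast; ring_nf
  rw [h3] at h2
  have h4 : derivative ℂ (1 + C (c : ℂ) * X ^ 2 : ℂ⟦X⟧) = 2 * C (c : ℂ) * X := by
    rw [map_add, derivative_one, Derivation.leibniz, smul_eq_mul, smul_eq_mul, derivative_C,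
      derivative_pow, derivative_X]
    push_cast; ring
  rw [Derivation.leibniz, smul_eq_mul, smul_eq_mul, derivative_one, h4, derivative_pow]
  push_cast
  linear_combination (2 * powSeries (-1 / 2) c) * h2

lemma one_add_mul_powSeries_neg_half (c : ℝ) :
    (1 + C (c : ℂ) * X ^ 2) * powSeries (-1 / 2) c = powSeries (1 / 2) c := by
  linear_combination (-(1 + C (c : ℂ) * X ^ 2) * powSeries (-1 / 2) c)
    * powSeries_half_mul_neg_half c + powSeries (1 / 2) c * one_add_mul_powSeries_neg_half_sq c

end BinomialSeries

section SeriesCalculus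

open PowerSeries

/-- Coefficientwise derivative of a curve of power series. -/
def HasSeriesDeriv (P : ℝ → ℂ⟦X⟧) (P' : ℂ⟦X⟧) (t : ℝ) : Prop :=
  ∀ k, HasDerivAt (fun s => coeff k (P s)) (coeff k P') t

/-- Coefficientwise smoothness of a family of power series. -/
def SeriesSmoothAt {E : Type} [NormedAddCommGroup E] [NormedSpace ℝ E] (P : E → ℂ⟦X⟧) (e : E) :
    Prop :=
  ∀ k, ContDiffAt ℝ ∞ (fun z => coeff k (P z)) e

variable {P Q : ℝ → ℂ⟦X⟧} {P' Q' : ℂ⟦X⟧} {t : ℝ}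

lemma hasSeriesDeriv_const (R : ℂ⟦X⟧) : HasSeriesDeriv (fun _ => R) 0 t := fun k => by
  simpa using hasDerivAt_const t (coeff k R)

lemma HasSeriesDeriv.add (hP : HasSeriesDeriv P P' t) (hQ : HasSeriesDeriv Q Q' t) :
    HasSeriesDeriv (fun s => P s + Q s) (P' + Q') t := fun k => by
  simpa using (hP k).fun_add (hQ k)

lemma HasSeriesDeriv.sub (hP : HasSeriesDeriv P P' t) (hQ : HasSeriesDeriv Q Q' t) :
    HasSeriesDeriv (fun s => P s - Q s) (P' - Q') t := fun k => by
  simpa using (hP k).fun_sub (hQ k)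

lemma HasSeriesDeriv.mul (hP : HasSeriesDeriv P P' t) (hQ : HasSeriesDeriv Q Q' t) :
    HasSeriesDeriv (fun s => P s * Q s) (P' * Q t + P t * Q') t := fun k => by
  simp only [map_add, coeff_mul, ← Finset.sum_add_distrib]
  exact HasDerivAt.fun_sum fun x _ => (hP x.1).fun_mul (hQ x.2)

lemma hasSeriesDeriv_C {f : ℝ → ℂ} {f' : ℂ} (hf : HasDerivAt f f' t) :
    HasSeriesDeriv (fun s => C (f s)) (C f') t := fun k => by
  simp only [coeff_C]
  split_ifs
  · exact hf
  · exact hasDerivAt_const _ _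

lemma HasSeriesDeriv.congr_deriv (hP : HasSeriesDeriv P P' t) (h : P' = Q') :
    HasSeriesDeriv P Q' t := h ▸ hP

section Smooth

variable {E : Type} [NormedAddCommGroup E] [NormedSpace ℝ E] {P Q : E → ℂ⟦X⟧} {e : E}

lemma seriesSmoothAt_const (R : ℂ⟦X⟧) : SeriesSmoothAt (fun _ : E => R) e :=
  fun _ => contDiffAt_const

lemma SeriesSmoothAt.add (hP : SeriesSmoothAt P e) (hQ : SeriesSmoothAt Q e) :
    SeriesSmoothAt (fun z => P z + Q z) e := fun k => by
  simpa using (hP k).add (hQ k)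

lemma SeriesSmoothAt.sub (hP : SeriesSmoothAt P e) (hQ : SeriesSmoothAt Q e) :
    SeriesSmoothAt (fun z => P z - Q z) e := fun k => by
  simpa using (hP k).sub (hQ k)

lemma SeriesSmoothAt.mul (hP : SeriesSmoothAt P e) (hQ : SeriesSmoothAt Q e) :
    SeriesSmoothAt (fun z => P z * Q z) e := fun k => by
  simp only [coeff_mul]
  exact ContDiffAt.sum fun x _ => (hP x.1).mul (hQ x.2)

lemma seriesSmoothAt_C {f : E → ℂ} (hf : ContDiffAt ℝ ∞ f e) :
    SeriesSmoothAt (fun z => C (f z)) e := fun k => by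
  simp only [coeff_C]
  split_ifs
  · exact hf
  · exact contDiffAt_const

lemma seriesSmoothAt_powSeries {f : E → ℝ} (hf : ContDiffAt ℝ ∞ f e) (r : ℝ) :
    SeriesSmoothAt (fun z => powSeries r (f z)) e := fun k => by
  simp only [powSeries, coeff_mk]
  split_ifs
  · exact Complex.ofRealCLM.contDiff.contDiffAt.comp e (contDiffAt_const.mul (hf.pow _))
  · exact contDiffAt_const

end Smooth

lemma exists_hasSeriesDeriv_powSeries {f : ℝ → ℝ} {f' : ℝ} (hf : HasDerivAt f f' t) (r : ℝ) :
    ∃ D, HasSeriesDeriv (fun s => powSeries r (f s)) D t := by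
  have : ∀ k, DifferentiableAt ℝ (fun s => coeff k (powSeries r (f s))) t := by
    intro k
    simp only [powSeries, coeff_mk]
    split_ifs
    · exact Complex.ofRealCLM.differentiableAt.comp t
        ((differentiableAt_const _).mul (hf.differentiableAt.pow _))
    · exact differentiableAt_const _
  exact ⟨PowerSeries.mk fun k => deriv (fun s => coeff k (powSeries r (f s))) t,
    fun k => by simpa using (this k).hasDerivAt⟩

lemma HasSeriesDeriv.unique (hP : HasSeriesDeriv P P' t) (hQ : HasSeriesDeriv P Q' t) :
    P' = Q' := by
  ext k
  exact (hP k).unique (hQ k)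

/-- Implicit differentiation of `(1 + f μ²) P² = 1`: the coefficients of `P` are multiples of powers
of `f`, so a derivative exists, and the relation determines it. -/
lemma hasSeriesDeriv_powSeries_neg_half {f : ℝ → ℝ} {f' : ℝ} (hf : HasDerivAt f f' t) :
    HasSeriesDeriv (fun s => powSeries (-1 / 2) (f s))
      (-(C ((f' : ℂ) / 2) * X ^ 2 * powSeries (-1 / 2) (f t) ^ 3)) t := by
  obtain ⟨D, hD⟩ := exists_hasSeriesDeriv_powSeries hf (-1 / 2)
  refine hD.congr_deriv ?_
  have h1 : HasSeriesDeriv (fun s => 1 + C ((f s : ℝ) : ℂ) * X ^ 2)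
      (0 + (C (f' : ℂ) * X ^ 2 + C ((f t : ℝ) : ℂ) * 0)) t :=
    (hasSeriesDeriv_const 1).add ((hasSeriesDeriv_C hf.ofReal_comp).mul (hasSeriesDeriv_const _))
  have h2 := h1.mul (hD.mul hD)
  have h3 : (fun s => (1 + C ((f s : ℝ) : ℂ) * X ^ 2) *
      (powSeries (-1 / 2) (f s) * powSeries (-1 / 2) (f s))) = fun _ => 1 := by
    funext s; rw [← pow_two]; exact one_add_mul_powSeries_neg_half_sq _
  rw [h3] at h2
  have h4 := (hasSeriesDeriv_const (1 : ℂ⟦X⟧)).unique h2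
  have h5 := one_add_mul_powSeries_neg_half_sq (f t)
  have h6 : C (f' : ℂ) = 2 * C ((f' : ℂ) / 2) := by
    rw [two_mul, ← map_add]; ring_nf
  rw [h6] at h4
  have h8 : (2 : ℂ⟦X⟧) ≠ 0 := fun h => by
    have := congrArg constantCoeff h
    rw [← one_add_one_eq_two, map_add, map_one, map_zero] at this
    norm_num at this
  refine mul_left_cancel₀ h8 ?_
  linear_combination (-2 * D) * h5 - powSeries (-1 / 2) (f t) * h4

lemma hasSeriesDeriv_powSeries_half {f : ℝ → ℝ} {f' : ℝ} (hf : HasDerivAt f f' t) :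
    HasSeriesDeriv (fun s => powSeries (1 / 2) (f s))
      (C ((f' : ℂ) / 2) * X ^ 2 * powSeries (-1 / 2) (f t)) t := by
  obtain ⟨D, hD⟩ := exists_hasSeriesDeriv_powSeries hf (1 / 2)
  refine hD.congr_deriv ?_
  have h2 := hD.mul (hasSeriesDeriv_powSeries_neg_half hf)
  simp only [powSeries_half_mul_neg_half] at h2
  have h4 := (hasSeriesDeriv_const (1 : ℂ⟦X⟧)).unique h2
  have h5 := powSeries_half_mul_neg_half (f t)
  linear_combination (-D + C ((f' : ℂ) / 2) * X ^ 2 * powSeries (-1 / 2) (f t)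
      * (powSeries (1 / 2) (f t) * powSeries (-1 / 2) (f t) + 1)) * h5
    - powSeries (1 / 2) (f t) * h4

end SeriesCalculus

end SDeform

end

/-! ### Riccati equations acting on the nonlocal variables, and lifting through a graph -/

noncomputable section

namespace SDeform

open PowerSeries

/-- Coefficients of a quadratic differential equation `W' = a W² + b W + c` over formal series. -/
abbrev Riccati : Type := ℂ⟦X⟧ × ℂ⟦X⟧ × ℂ⟦X⟧

/-- The nonlocal variable with index `k`, extended by zero. -/
def fibreVar {n : ℕ} (k : ℕ) (θ : Fin n → ℂ) : ℂ := if h : k < n then θ ⟨k, h⟩ else 0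

/-- The series `1 + θ_1 μ + θ_2 μ² + ⋯`. -/
def fibreSeries {n : ℕ} (θ : Fin n → ℂ) : ℂ⟦X⟧ :=
  PowerSeries.mk fun k => if k = 0 then 1 else fibreVar k θ

/-- The vector field induced on the variables `θ_k` by `W' = a W² + b W + c`, where
`W = e^{θ_0} (1 + θ_1 μ + ⋯)` and `a`, `c` have no constant terms: its components are the
coefficients of this series. -/
def flow {n : ℕ} (R : Riccati) (θ : Fin n → ℂ) : ℂ⟦X⟧ :=
  C (Complex.exp (fibreVar 0 θ)) * R.1 * (fibreSeries θ * fibreSeries θ)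
    + C (Complex.exp (-fibreVar 0 θ)) * R.2.2
    + (R.2.1 - C (constantCoeff R.2.1)) * fibreSeries θ + C (constantCoeff R.2.1)

/-- The vector field on the space of the first `n` nonlocal variables. -/
def flowField (n : ℕ) (R : Riccati) (θ : Fin n → ℂ) : Fin n → ℂ := fun k => coeff k (flow R θ)

/-- The commutator of two Riccati equations. -/
def riccatiBracket (R S : Riccati) : Riccati :=
  (S.1 * R.2.1 - R.1 * S.2.1, 2 * (S.1 * R.2.2 - R.1 * S.2.2), S.2.1 * R.2.2 - R.2.1 * S.2.2)

/-- The condition that the quadratic and constant parts have no constant terms. -/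
def Riccati.Small (R : Riccati) : Prop := constantCoeff R.1 = 0 ∧ constantCoeff R.2.2 = 0

lemma Riccati.Small.bracket {R S : Riccati} (hR : R.Small) (hS : S.Small) :
    (riccatiBracket R S).Small := by
  simp [Riccati.Small, riccatiBracket, hR.1, hR.2, hS.1, hS.2]

lemma flow_add {n : ℕ} (R S : Riccati) (θ : Fin n → ℂ) :
    flow (R + S) θ = flow R θ + flow S θ := by
  simp only [flow, Prod.fst_add, Prod.snd_add, map_add]; ring

lemma flow_sub {n : ℕ} (R S : Riccati) (θ : Fin n → ℂ) :
    flow (R - S) θ = flow R θ - flow S θ := by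
  simp only [flow, Prod.fst_sub, Prod.snd_sub, map_sub]; ring

lemma flow_smul {n : ℕ} (r : ℝ) (R : Riccati) (θ : Fin n → ℂ) :
    flow (r • R) θ = r • flow R θ := by
  have h : ∀ P : ℂ⟦X⟧, r • P = C (r : ℂ) * P := fun P => by
    ext k; simp [coeff_C_mul]
  simp only [flow, Prod.smul_fst, Prod.smul_snd, h, map_mul, constantCoeff_C]; ring

lemma constantCoeff_flow {n : ℕ} {R : Riccati} (hR : R.Small) (θ : Fin n → ℂ) :
    constantCoeff (flow R θ) = constantCoeff R.2.1 := by
  simp [flow, hR.1, hR.2]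

/-- The derivative of `fibreSeries` along a vector. -/
def fibreSeriesDeriv {n : ℕ} (v : Fin n → ℂ) : ℂ⟦X⟧ :=
  PowerSeries.mk fun k => if k = 0 then 0 else fibreVar k v

/-- The derivative of the series `flow R` along a vector in the space of nonlocal variables. -/
def flowDeriv {n : ℕ} (R : Riccati) (θ v : Fin n → ℂ) : ℂ⟦X⟧ :=
  C (fibreVar 0 v) * (C (Complex.exp (fibreVar 0 θ)) * R.1 * fibreSeries θ ^ 2
      - C (Complex.exp (-fibreVar 0 θ)) * R.2.2)
    + (2 * C (Complex.exp (fibreVar 0 θ)) * R.1 * fibreSeries θ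
      + (R.2.1 - C (constantCoeff R.2.1))) * fibreSeriesDeriv v

lemma hasDerivAt_fibreVar {n : ℕ} {θ : ℝ → Fin n → ℂ} {v : Fin n → ℂ} {t : ℝ}
    (h : HasDerivAt θ v t) (k : ℕ) : HasDerivAt (fun s => fibreVar k (θ s)) (fibreVar k v) t := by
  unfold fibreVar
  split_ifs with hk
  · exact hasDerivAt_pi.1 h _
  · exact hasDerivAt_const _ _

lemma hasSeriesDeriv_fibreSeries {n : ℕ} {θ : ℝ → Fin n → ℂ} {v : Fin n → ℂ} {t : ℝ}
    (h : HasDerivAt θ v t) :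
    HasSeriesDeriv (fun s => fibreSeries (θ s)) (fibreSeriesDeriv v) t := fun k => by
  simp only [fibreSeries, fibreSeriesDeriv, coeff_mk]
  split_ifs
  · exact hasDerivAt_const _ _
  · exact hasDerivAt_fibreVar h k

lemma hasSeriesDeriv_flow {n : ℕ} {R : ℝ → Riccati} {R' : Riccati} {θ : ℝ → Fin n → ℂ}
    {v : Fin n → ℂ} {t : ℝ} (ha : HasSeriesDeriv (fun s => (R s).1) R'.1 t)
    (hb : HasSeriesDeriv (fun s => (R s).2.1) R'.2.1 t)
    (hc : HasSeriesDeriv (fun s => (R s).2.2) R'.2.2 t) (h : HasDerivAt θ v t) :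
    HasSeriesDeriv (fun s => flow (R s) (θ s)) (flow R' (θ t) + flowDeriv (R t) (θ t) v) t := by
  have h0 := hasDerivAt_fibreVar h 0
  have hT := hasSeriesDeriv_fibreSeries h
  have hb0 : HasDerivAt (fun s => constantCoeff (R s).2.1) (constantCoeff R'.2.1) t := by
    simpa using hb 0
  have key := ((((hasSeriesDeriv_C h0.cexp).mul ha).mul (hT.mul hT)).add
    ((hasSeriesDeriv_C h0.fun_neg.cexp).mul hc)).add
    ((hb.sub (hasSeriesDeriv_C hb0)).mul hT) |>.add (hasSeriesDeriv_C hb0)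
  refine HasSeriesDeriv.congr_deriv (P := fun s => flow (R s) (θ s)) key ?_
  simp only [flow, flowDeriv, map_mul, map_neg]
  ring

/-- The truncated field reproduces the flow in degrees `1, …, n - 1`. The constant coefficient is
removed because it drives `θ_0`, which sits in the exponential factor and not in the series. -/
lemma fibreSeriesDeriv_flowField {n : ℕ} {R : Riccati} (hR : R.Small) (θ : Fin n → ℂ) :
    X ^ n ∣ fibreSeriesDeriv (flowField n R θ) - (flow R θ - C (constantCoeff R.2.1)) := by
  refine X_pow_dvd_iff.2 fun m hm => ?_
  rcases m with _ | m
  · simp [fibreSeriesDeriv, constantCoeff_flow hR]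
  · simp [fibreSeriesDeriv, fibreVar, hm, flowField]

/-- Commutators of Riccati equations become commutators of vector fields. Degree `k = n` is included
although `θ_n` is absent: `fibreSeriesDeriv` is correct modulo `X ^ n`, and in `flowDeriv` it is
multiplied by a series divisible by `X`. -/
lemma coeff_flowDeriv_sub {n : ℕ} {R S : Riccati} (hR : R.Small) (hS : S.Small) (θ : Fin n → ℂ)
    {k : ℕ} (hk : k ≤ n) :
    coeff k (flowDeriv S θ (flowField n R θ)) - coeff k (flowDeriv R θ (flowField n S θ))
      = coeff k (flow (riccatiBracket R S) θ) := by
  -- Without the variable `θ_0` its velocity is `0` by default and not the constant coefficient of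
  -- the flow, so `n = 0` is separate; there both sides vanish.
  rcases Nat.eq_zero_or_pos n with rfl | hn
  · obtain rfl : k = 0 := by omega
    have hz : ∀ v : Fin 0 → ℂ, fibreSeriesDeriv v = 0 := fun v => by
      ext k; simp [fibreSeriesDeriv, fibreVar]
    simp [flowDeriv, hz, fibreVar, constantCoeff_flow (hR.bracket hS)]
    simp [riccatiBracket, hR.1, hR.2, hS.1, hS.2]
  · have hz : ∀ {Q : Riccati}, Q.Small → fibreVar 0 (flowField n Q θ) = constantCoeff Q.2.1 := by
      intro Q hQ
      simp [fibreVar, hn, flowField, constantCoeff_flow hQ]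
    have hs : ∀ {Q : Riccati}, Q.Small → X ∣ 2 * C (Complex.exp (fibreVar 0 θ)) * Q.1
        * fibreSeries θ + (Q.2.1 - C (constantCoeff Q.2.1)) := by
      intro Q hQ
      rw [X_dvd_iff]; simp [hQ.1]
    have hb : constantCoeff (riccatiBracket R S).2.1 = 0 := by
      simp [riccatiBracket, hR.1, hR.2, hS.1, hS.2]
    have hd : X ^ (n + 1) ∣ flowDeriv S θ (flowField n R θ) - flowDeriv R θ (flowField n S θ)
        - flow (riccatiBracket R S) θ := by
      have d1 := mul_dvd_mul (hs hS) (fibreSeriesDeriv_flowField hR θ)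
      have d2 := mul_dvd_mul (hs hR) (fibreSeriesDeriv_flowField hS θ)
      rw [← pow_succ'] at d1 d2
      -- The exponentials meet in products of the quadratic part of one equation with the constant
      -- part of the other; these form the linear part of the bracket.
      have hE : (C (Complex.exp (fibreVar 0 θ)) * C (Complex.exp (-fibreVar 0 θ)) : ℂ⟦X⟧) = 1 := by
        rw [← map_mul, ← Complex.exp_add]; simp
      convert dvd_sub d1 d2 using 1
      rw [flowDeriv, flowDeriv, hz hR, hz hS]
      have eb : flow (riccatiBracket R S) θ
          = C (Complex.exp (fibreVar 0 θ)) * (riccatiBracket R S).1 * fibreSeries θ ^ 2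
          + C (Complex.exp (-fibreVar 0 θ)) * (riccatiBracket R S).2.2
          + (riccatiBracket R S).2.1 * fibreSeries θ := by
        rw [flow, hb]; simp [pow_two]
      rw [eb]
      simp only [flow, riccatiBracket]
      linear_combination (2 * fibreSeries θ * (S.1 * R.2.2 - R.1 * S.2.2)) * hE
    have := X_pow_dvd_iff.1 hd k (by omega)
    rw [map_sub, map_sub, sub_eq_zero] at this
    exact this

section Smooth

variable {E : Type} [NormedAddCommGroup E] [NormedSpace ℝ E] {n : ℕ} {θ : E → Fin n → ℂ} {e : E}

lemma contDiffAt_fibreVar (h : ContDiffAt ℝ ∞ θ e) (k : ℕ) :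
    ContDiffAt ℝ ∞ (fun z => fibreVar k (θ z)) e := by
  unfold fibreVar
  split_ifs with hk
  · exact contDiffAt_pi.1 h _
  · exact contDiffAt_const

lemma seriesSmoothAt_fibreSeries (h : ContDiffAt ℝ ∞ θ e) :
    SeriesSmoothAt (fun z => fibreSeries (θ z)) e := fun k => by
  simp only [fibreSeries, coeff_mk]
  split_ifs
  · exact contDiffAt_const
  · exact contDiffAt_fibreVar h k

lemma seriesSmoothAt_flow {R : E → Riccati} (ha : SeriesSmoothAt (fun z => (R z).1) e)
    (hb : SeriesSmoothAt (fun z => (R z).2.1) e) (hc : SeriesSmoothAt (fun z => (R z).2.2) e)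
    (h : ContDiffAt ℝ ∞ θ e) : SeriesSmoothAt (fun z => flow (R z) (θ z)) e := by
  have h0 := contDiffAt_fibreVar h 0
  have hT := seriesSmoothAt_fibreSeries h
  have hb0 : ContDiffAt ℝ ∞ (fun z => constantCoeff (R z).2.1) e := by
    simpa using hb 0
  have key := ((((seriesSmoothAt_C h0.cexp).mul ha).mul (hT.mul hT)).add
    ((seriesSmoothAt_C h0.neg.cexp).mul hc)).add
    ((hb.sub (seriesSmoothAt_C hb0)).mul hT) |>.add (seriesSmoothAt_C hb0)
  exact key

end Smooth

lemma contDiff_coeff_flow {n : ℕ} (R : Riccati) (k : ℕ) :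
    ContDiff ℝ ∞ fun θ : Fin n → ℂ => coeff k (flow R θ) :=
  contDiff_iff_contDiffAt.2 fun _ => seriesSmoothAt_flow (seriesSmoothAt_const _)
    (seriesSmoothAt_const _) (seriesSmoothAt_const _) contDiffAt_id k

lemma contDiff_flowField (n : ℕ) (R : Riccati) : ContDiff ℝ ∞ (flowField n R) :=
  contDiff_pi.2 fun k => contDiff_coeff_flow R k

lemma fderiv_coeff_flow {n : ℕ} (R : Riccati) (k : ℕ) (θ v : Fin n → ℂ) :
    fderiv ℝ (fun θ : Fin n → ℂ => coeff k (flow R θ)) θ v = coeff k (flowDeriv R θ v) := by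
  have hl : HasDerivAt (fun t : ℝ => θ + t • v) v 0 := by
    simpa using ((hasDerivAt_id (0 : ℝ)).smul_const v).const_add θ
  have h1 := hasSeriesDeriv_flow (R := fun _ => R) (R' := 0) (hasSeriesDeriv_const _)
    (hasSeriesDeriv_const _) (hasSeriesDeriv_const _) hl k
  have h2 := HasFDerivAt.comp_hasDerivAt_of_eq (0 : ℝ)
    ((contDiff_coeff_flow R k).differentiable (by simp) θ).hasFDerivAt hl (by simp)
  have h3 := h2.unique h1
  rw [h3]
  simp [flow]

/-- The Riccati equations whose vector field lifts, through the graph of `g`, to the space of the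
variables `θ_0, …, θ_n`. -/
def Lifts {n : ℕ} (g : (Fin n → ℂ) → ℂ) (R : Riccati) : Prop :=
  R.Small ∧ ∀ θ, fderiv ℝ g θ (flowField n R θ) = coeff n (flow R θ)

section Lifts

variable {n : ℕ} {g : (Fin n → ℂ) → ℂ}

lemma Lifts.add {R S : Riccati} (hR : Lifts g R) (hS : Lifts g S) : Lifts g (R + S) := by
  refine ⟨⟨by simp [hR.1.1, hS.1.1], by simp [hR.1.2, hS.1.2]⟩, fun θ => ?_⟩
  have : flowField n (R + S) θ = flowField n R θ + flowField n S θ := by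
    funext k; simp [flowField, flow_add]
  rw [this, map_add, hR.2, hS.2, flow_add, map_add]

lemma Lifts.smul {R : Riccati} (r : ℝ) (hR : Lifts g R) : Lifts g (r • R) := by
  refine ⟨⟨?_, ?_⟩, fun θ => ?_⟩
  · rw [Prod.smul_fst, ← coeff_zero_eq_constantCoeff_apply, coeff_smul]; simp [hR.1.1]
  · rw [Prod.smul_snd, Prod.smul_snd, ← coeff_zero_eq_constantCoeff_apply, coeff_smul]
    simp [hR.1.2]
  have : flowField n (r • R) θ = r • flowField n R θ := by
    funext k; simp [flowField, flow_smul]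
  rw [this, map_smul, hR.2, flow_smul, coeff_smul]

/-- Fields tangent to the graph `θ_n = g` have a tangent commutator. Its action on `g` is `V_R (V_S
g) - V_S (V_R g)`, where `V_S g` and `V_R g` are the known coefficients of degree `n`, so the case
`k = n` of `coeff_flowDeriv_sub` applies. -/
lemma Lifts.bracket (hg : ContDiff ℝ ∞ g) {R S : Riccati} (hR : Lifts g R) (hS : Lifts g S) :
    Lifts g (riccatiBracket R S) := by
  refine ⟨hR.1.bracket hS.1, fun θ => ?_⟩
  have hdiff : ∀ Q θ, DifferentiableAt ℝ (flowField n Q) θ := fun Q θ =>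
    (contDiff_flowField n Q).differentiable (by simp) θ
  have hcomp : ∀ (Q : Riccati) (v : Fin n → ℂ) (k : Fin n),
      fderiv ℝ (flowField n Q) θ v k = coeff k (flowDeriv Q θ v) := by
    intro Q v k
    rw [← fderiv_coeff_flow]
    exact (DFunLike.congr_fun (hasFDerivAt_pi'.1 (hdiff Q θ).hasFDerivAt k).fderiv v).symm
  have hV : VectorField.lieBracket ℝ (flowField n R) (flowField n S) θ
      = flowField n (riccatiBracket R S) θ := by
    funext k
    rw [VectorField.lieBracket, Pi.sub_apply, hcomp, hcomp,
      coeff_flowDeriv_sub hR.1 hS.1 θ k.2.le]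
    rfl
  rw [← hV, VectorField.fderiv_apply_lieBracket (n := ∞) hg.contDiffAt
    (by rw [minSmoothness_of_isRCLikeNormedField]
        exact WithTop.coe_le_coe.2 (le_top : (2 : ℕ∞) ≤ ⊤)) (hdiff S θ) (hdiff R θ)]
  simp only [hR.2, hS.2, fderiv_coeff_flow]
  exact coeff_flowDeriv_sub hR.1 hS.1 θ le_rfl

/-- A liftable Riccati equation cannot start exactly at the order `n`. -/
lemma Lifts.coeff_flow_eq_zero {R : Riccati} (hR : Lifts g R) (θ : Fin n → ℂ)
    (h : ∀ k < n, coeff k (flow R θ) = 0) : coeff n (flow R θ) = 0 := by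
  have : flowField n R θ = 0 := funext fun k => h k k.2
  rw [← hR.2 θ, this, map_zero]

end Lifts

end SDeform

end

/-! ### Impossibility of lifting -/

noncomputable section

namespace SDeform

open PowerSeries

section NoLift

lemma fibreSeries_zero (n : ℕ) : fibreSeries (0 : Fin n → ℂ) = 1 := by
  ext k
  simp [fibreSeries, fibreVar, coeff_one]

lemma flow_zero (n : ℕ) (R : Riccati) :
    flow R (0 : Fin n → ℂ) = R.1 + R.2.2 + R.2.1 := by
  have : fibreVar 0 (0 : Fin n → ℂ) = 0 := by simp [fibreVar]
  rw [flow, fibreSeries_zero, this]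
  simp only [neg_zero, Complex.exp_zero, map_one]
  ring

/-- At `θ = 0`, that is `W = 1`, the flow is the plain sum of the three coefficients. A liftable
equation cannot have the lowest term of this sum in degree `n`. -/
lemma Lifts.constantCoeff_eq_zero {n : ℕ} {g : (Fin n → ℂ) → ℂ} {R : Riccati} (hR : Lifts g R)
    {P : ℂ⟦X⟧} (h : R.1 + R.2.2 + R.2.1 = X ^ n * P) : constantCoeff P = 0 := by
  have := hR.coeff_flow_eq_zero 0 fun k hk => by
    rw [flow_zero, h, coeff_X_pow_mul', if_neg (by omega)]
  rwa [flow_zero, h, coeff_X_pow_mul', if_pos le_rfl, Nat.sub_self,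
    coeff_zero_eq_constantCoeff_apply] at this

lemma powSeries_half_sq (c : ℝ) : powSeries (1 / 2) c ^ 2 = 1 + C (c : ℂ) * X ^ 2 := by
  linear_combination (-powSeries (1 / 2) c) * one_add_mul_powSeries_neg_half c
    + (1 + C (c : ℂ) * X ^ 2) * powSeries_half_mul_neg_half c

/-- For `c ≠ d` the right-hand side is `μ²` times a unit, so multiplication by it raises the lowest
degree by exactly two. -/
lemma alphaRatioSeries_sq_sub_one (c d : ℝ) :
    alphaRatioSeries d c ^ 2 - 1 = C ((d : ℂ) - c) * X ^ 2 * alphaSeries c ^ 2 := by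
  rw [alphaRatioSeries, alphaSeries, map_sub]
  linear_combination powSeries (-1 / 2) c ^ 2 * powSeries_half_sq d
    + one_add_mul_powSeries_neg_half_sq c

/-- The two Riccati equations attached to the `x`-part of the coverings cannot both lift through
the graph of a smooth function. -/
lemma not_lifts {n : ℕ} {g : (Fin n → ℂ) → ℂ} (hg : ContDiff ℝ ∞ g) {c d : ℝ} (hcd : c ≠ d)
    (h1 : Lifts g (0, C Complex.I * alphaRatioSeries d c, 0))
    (h2 : Lifts g (C (1 / 2) * X * alphaSeries c, 0, C (1 / 2) * X * alphaSeries c)) : False := by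
  set ρ := alphaRatioSeries d c with hρ
  set α := alphaSeries c with hα
  have hsq := alphaRatioSeries_sq_sub_one c d
  rw [← hρ, ← hα] at hsq
  have hI : (C Complex.I * C Complex.I : ℂ⟦X⟧) = -1 := by rw [← map_mul]; simp
  have hhalf : (2 * C (1 / 2) : ℂ⟦X⟧) = 1 := by
    rw [two_mul, ← map_add]; norm_num
  have hα0 : constantCoeff α = 1 := constantCoeff_powSeries _ _
  have hρ0 : constantCoeff ρ = 1 := by
    simp [hρ, alphaRatioSeries, constantCoeff_powSeries]
  have hdc : (d : ℂ) - c ≠ 0 := by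
    rw [sub_ne_zero]; exact_mod_cast hcd.symm
  -- Bracketing twice with `(0, iρ, 0)` multiplies `(a, 0, c)` by `(iρ)² = -ρ²`. Adding the original
  -- and changing the sign multiplies it by `ρ² - 1`.
  have hodd : ∀ m : ℕ, Lifts g (C (1 / 2) * X * α * (ρ ^ 2 - 1) ^ m, 0,
      C (1 / 2) * X * α * (ρ ^ 2 - 1) ^ m) := by
    intro m
    induction m with
    | zero => simpa using h2
    | succ m ih =>
      have h3 := (((h1.bracket hg (h1.bracket hg ih)).add ih).smul (-1))
      convert h3 using 1
      refine Prod.ext ?_ (Prod.ext ?_ ?_)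
      · simp only [riccatiBracket, neg_smul, one_smul, Prod.fst_neg, Prod.fst_add]
        linear_combination (C (1 / 2) * X * α * (ρ ^ 2 - 1) ^ m * ρ ^ 2) * hI
      · simp [riccatiBracket]
      · simp only [riccatiBracket, neg_smul, one_smul, Prod.snd_neg, Prod.snd_add]
        linear_combination (C (1 / 2) * X * α * (ρ ^ 2 - 1) ^ m * ρ ^ 2) * hI
  -- For each `n` there is an equation starting in degree `n`. For `n = 0` it is `(0, iρ, 0)`. For
  -- `n = 2m + 1` it is `hodd m`, with leading coefficient `(d - c)^m`. For `n = 2m + 2`, bracketing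
  -- `hodd 0` with the bracket of `h1` and `hodd m` leaves only a linear part, with leading
  -- coefficient `i (d - c)^m`.
  rcases Nat.even_or_odd' n with ⟨m, rfl | rfl⟩
  · rcases m with _ | m
    · have := h1.constantCoeff_eq_zero (P := C Complex.I * ρ) (by simp)
      simp [hρ0] at this
    · have h3 := (hodd 0).bracket hg (h1.bracket hg (hodd m))
      have h4 := h3.constantCoeff_eq_zero
        (P := C Complex.I * ρ * C ((d : ℂ) - c) ^ m * α ^ (2 * m + 2)) (by
          simp only [riccatiBracket, hsq]
          linear_combination (C Complex.I * ρ * X ^ 2 * α ^ 2 * (C ((d : ℂ) - c) * X ^ 2 * α ^ 2) ^ m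
            * (2 * C (1 / 2) + 1)) * hhalf)
      simp [hρ0, hα0, hdc] at h4
  · have h4 := (hodd m).constantCoeff_eq_zero
      (P := C ((d : ℂ) - c) ^ m * α ^ (2 * m + 1)) (by
        simp only [hsq]
        linear_combination (X * α * (C ((d : ℂ) - c) * X ^ 2 * α ^ 2) ^ m) * hhalf)
    simp [hα0, hdc] at h4

end NoLift

/-! ### The zero curvature representation and the conservation laws -/

/-- The Riccati equation of the `x`-part of the covering. -/
def riccatiX (η₁ η₂ : ℝ → ℝ) (p : Jet) : Riccati :=
  (C (ju 0 0 p : ℂ) * (C (1 / 2) * X * alphaSeries (η₁ (jx p))),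
    C (Complex.I * (ju 0 1 p : ℂ) / (jv 0 0 p : ℂ)) * alphaRatioSeries (η₂ (jy p)) (η₁ (jx p)),
    C (ju 0 0 p : ℂ) * (C (1 / 2) * X * alphaSeries (η₁ (jx p))))

/-- The Riccati equation of the `y`-part of the covering. -/
def riccatiY (η₁ η₂ : ℝ → ℝ) (p : Jet) : Riccati :=
  (C (-(Complex.I * (jv 0 0 p : ℂ))) * (C (1 / 2) * X * alphaSeries (η₂ (jy p))),
    C (-(Complex.I * (jv 1 0 p : ℂ) / (ju 0 0 p : ℂ)))
      * alphaRatioSeries (η₁ (jx p)) (η₂ (jy p)),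
    C (Complex.I * (jv 0 0 p : ℂ)) * (C (1 / 2) * X * alphaSeries (η₂ (jy p))))

lemma small_riccatiX (η₁ η₂ : ℝ → ℝ) (p : Jet) : (riccatiX η₁ η₂ p).Small := by
  simp [Riccati.Small, riccatiX]

lemma small_riccatiY (η₁ η₂ : ℝ → ℝ) (p : Jet) : (riccatiY η₁ η₂ p).Small := by
  simp [Riccati.Small, riccatiY]

lemma constantCoeff_alphaRatioSeries (c d : ℝ) : constantCoeff (alphaRatioSeries c d) = 1 := by
  simp [alphaRatioSeries, constantCoeff_powSeries]

/-- As `ρ` has constant term `1`, the linear part of the flow splits into `b_0 (ρ - 1) T` and the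
constant `b_0`. The latter contributes only for `s = 0`, which is the convention `X_0^{21} = 1`. -/
lemma omegaX_eq (η₁ η₂ : ℝ → ℝ) (s : ℕ) {n : ℕ} (p : Cov n) :
    omegaX η₁ η₂ s p = coeff s (flow (riccatiX η₁ η₂ p.1) p.2) := by
  have hf : flow (riccatiX η₁ η₂ p.1) p.2
      = C (ju 0 0 p.1 : ℂ) * (C (1 / 2 : ℂ) * X * alphaSeries (η₁ (jx p.1)) *
        (C (Complex.exp (theta 0 p)) * thetaSeries p ^ 2 + C (Complex.exp (-theta 0 p))))
      + C (Complex.I * (ju 0 1 p.1 : ℂ) / (jv 0 0 p.1 : ℂ)) *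
        ((alphaRatioSeries (η₂ (jy p.1)) (η₁ (jx p.1)) - 1) * thetaSeries p)
      + C (Complex.I * (ju 0 1 p.1 : ℂ) / (jv 0 0 p.1 : ℂ)) := by
    have h0 : fibreVar 0 p.2 = theta 0 p := rfl
    have h1 : fibreSeries p.2 = thetaSeries p := rfl
    simp only [flow, riccatiX, map_mul, constantCoeff_C, constantCoeff_alphaRatioSeries, h0, h1,
      mul_one]
    ring
  rw [hf, map_add, map_add, coeff_C_mul, coeff_C_mul, omegaX, X1, X21]
  by_cases hs : s = 0
  · subst hs
    simp [constantCoeff_alphaRatioSeries]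
  · simp only [hs, if_false, coeff_C]
    ring

lemma omegaY_eq (η₁ η₂ : ℝ → ℝ) (s : ℕ) {n : ℕ} (p : Cov n) :
    omegaY η₁ η₂ s p = coeff s (flow (riccatiY η₁ η₂ p.1) p.2) := by
  have hf : flow (riccatiY η₁ η₂ p.1) p.2
      = -(C (Complex.I * (jv 0 0 p.1 : ℂ)) * (C (1 / 2 : ℂ) * X * alphaSeries (η₂ (jy p.1)) *
        (C (Complex.exp (theta 0 p)) * thetaSeries p ^ 2 - C (Complex.exp (-theta 0 p)))))
      - C (Complex.I * (jv 1 0 p.1 : ℂ) / (ju 0 0 p.1 : ℂ)) *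
        ((alphaRatioSeries (η₁ (jx p.1)) (η₂ (jy p.1)) - 1) * thetaSeries p)
      - C (Complex.I * (jv 1 0 p.1 : ℂ) / (ju 0 0 p.1 : ℂ)) := by
    have h0 : fibreVar 0 p.2 = theta 0 p := rfl
    have h1 : fibreSeries p.2 = thetaSeries p := rfl
    simp only [flow, riccatiY, map_mul, constantCoeff_C, constantCoeff_alphaRatioSeries, h0, h1,
      mul_one, map_neg]
    ring
  rw [hf, map_sub, map_sub, map_neg, coeff_C_mul, coeff_C_mul, omegaY, Y2, Y12]
  by_cases hs : s = 0
  · subst hs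
    simp [constantCoeff_alphaRatioSeries]
  · simp only [hs, if_false, coeff_C]
    ring

/-- The derivative of the Riccati equation of the `x`-part along `y`. -/
def riccatiXY (η₁ η₂ : ℝ → ℝ) (p : Jet) : Riccati :=
  let a : ℂ⟦X⟧ := C (ju 0 1 p : ℂ) * (C (1 / 2) * X * alphaSeries (η₁ (jx p)))
  (a, C (Complex.I * (((ju 0 2 p * jv 0 0 p - ju 0 1 p * jv 0 1 p) / jv 0 0 p ^ 2 : ℝ) : ℂ))
      * alphaRatioSeries (η₂ (jy p)) (η₁ (jx p))
    + C (Complex.I * (ju 0 1 p : ℂ) / (jv 0 0 p : ℂ)) * (C (((deriv η₂ (jy p) : ℝ) : ℂ) / 2) * X ^ 2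
      * alphaSeries (η₂ (jy p)) * alphaSeries (η₁ (jx p))), a)

/-- The derivative of the Riccati equation of the `y`-part along `x`. -/
def riccatiYX (η₁ η₂ : ℝ → ℝ) (p : Jet) : Riccati :=
  (C (-(Complex.I * (jv 1 0 p : ℂ))) * (C (1 / 2) * X * alphaSeries (η₂ (jy p))),
    C (-(Complex.I * (((jv 2 0 p * ju 0 0 p - jv 1 0 p * ju 1 0 p) / ju 0 0 p ^ 2 : ℝ) : ℂ)))
      * alphaRatioSeries (η₁ (jx p)) (η₂ (jy p))
    + C (-(Complex.I * (jv 1 0 p : ℂ) / (ju 0 0 p : ℂ))) * (C (((deriv η₁ (jx p) : ℝ) : ℂ) / 2) * X ^ 2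
      * alphaSeries (η₁ (jx p)) * alphaSeries (η₂ (jy p))),
    C (Complex.I * (jv 1 0 p : ℂ)) * (C (1 / 2) * X * alphaSeries (η₂ (jy p))))

lemma hasSeriesDeriv_alphaRatio_left {f : ℝ → ℝ} {f' t : ℝ} (hf : HasDerivAt f f' t) {g : ℝ → ℝ}
    (hg : ∀ s, g s = g t) :
    HasSeriesDeriv (fun s => alphaRatioSeries (f s) (g s))
      (C ((f' : ℂ) / 2) * X ^ 2 * alphaSeries (f t) * alphaSeries (g t)) t := by
  have := (hasSeriesDeriv_powSeries_half hf).mul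
    (hasSeriesDeriv_const (t := t) (powSeries (-1 / 2) (g t)))
  simp only [mul_zero, add_zero] at this
  simpa only [alphaRatioSeries, alphaSeries, hg] using this

section Conservation

variable {η₁ η₂ : ℝ → ℝ} {I J : Set ℝ}

/-- The zero curvature identity. -/
lemma riccati_flat {p : Jet} (hp : p ∈ equationManifold η₁ η₂ I J) :
    riccatiXY η₁ η₂ p - riccatiYX η₁ η₂ p
      + riccatiBracket (riccatiY η₁ η₂ p) (riccatiX η₁ η₂ p) = 0 := by
  have hU : ju 0 2 p = rhsU η₁ η₂ p := sub_eq_zero.1 (hp.2 0 0).1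
  have hV : jv 2 0 p = rhsV η₁ η₂ p := sub_eq_zero.1 (hp.2 0 0).2
  simp only [rhsU] at hU
  simp only [rhsV] at hV
  obtain ⟨-, -, he, hu, hv⟩ := hp.1
  set u := ju 0 0 p
  set v := jv 0 0 p
  set e₁ := η₁ (jx p)
  set e₂ := η₂ (jy p)
  set P := (ju 0 2 p * v - ju 0 1 p * jv 0 1 p) / v ^ 2 with hPdef
  set Q := (jv 2 0 p * u - jv 1 0 p * ju 1 0 p) / u ^ 2 with hQdef
  have he1 : e₁ - e₂ ≠ 0 := sub_ne_zero.2 he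
  have he2 : e₂ - e₁ ≠ 0 := sub_ne_zero.2 he.symm
  -- With `P = D_y (u_y / v)` and `Q = D_x (v_x / u)` the system says that `(η₁ - η₂) P` and `(η₂ -
  -- η₁) Q` equal the same expression; in particular `P + Q = 0`.
  have hPval : P * (e₁ - e₂)
      = ju 0 1 p / v * (deriv η₂ (jy p) / 2) + jv 1 0 p / u * (deriv η₁ (jx p) / 2) + u * v := by
    rw [hPdef, hU]
    field_simp
    ring
  have hQval : Q * (e₂ - e₁)
      = ju 0 1 p / v * (deriv η₂ (jy p) / 2) + jv 1 0 p / u * (deriv η₁ (jx p) / 2) + u * v := by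
    rw [hQdef, hV]
    field_simp
    ring
  have hPQ : P + Q = 0 := by
    have : (P + Q) * (e₁ - e₂) = 0 := by linear_combination hPval - hQval
    exact (mul_eq_zero.1 this).resolve_right he1
  have huC : (u : ℂ) ≠ 0 := by exact_mod_cast hu
  have hvC : (v : ℂ) ≠ 0 := by exact_mod_cast hv
  have hI := Complex.I_mul_I
  -- Once the factor `α¹ α²` is extracted, the linear component is a polynomial in `μ²` of degree
  -- one; `c0` and `c1` are the vanishing of its two coefficients.
  have c0 : (C (Complex.I * (P : ℂ)) : ℂ⟦X⟧) = -C (Complex.I * (Q : ℂ)) := by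
    rw [← map_neg, eq_neg_of_add_eq_zero_left hPQ]; push_cast; ring_nf
  have c1 : (C (Complex.I * (P : ℂ)) * C (e₂ : ℂ) + C (Complex.I * (Q : ℂ)) * C (e₁ : ℂ)
      + C (Complex.I * (ju 0 1 p : ℂ) / (v : ℂ)) * C (((deriv η₂ (jy p) : ℝ) : ℂ) / 2)
      + C (Complex.I * (jv 1 0 p : ℂ) / (u : ℂ)) * C (((deriv η₁ (jx p) : ℝ) : ℂ) / 2)
      + C (u : ℂ) * C (Complex.I * (v : ℂ)) : ℂ⟦X⟧) = 0 := by
    have h : ((P : ℂ) * e₂ + Q * e₁ + (ju 0 1 p : ℂ) / v * (((deriv η₂ (jy p) : ℝ) : ℂ) / 2)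
        + (jv 1 0 p : ℂ) / u * (((deriv η₁ (jx p) : ℝ) : ℂ) / 2) + u * v) = 0 := by
      have : P * e₂ + Q * e₁ + ju 0 1 p / v * (deriv η₂ (jy p) / 2)
          + jv 1 0 p / u * (deriv η₁ (jx p) / 2) + u * v = 0 := by
        linear_combination -hPval + e₁ * hPQ
      exact_mod_cast this
    simp only [← map_mul, ← map_add]
    rw [← map_zero C]
    congr 1
    linear_combination Complex.I * h
  have c2 : (C (u : ℂ) * C (Complex.I * (jv 1 0 p : ℂ) / (u : ℂ)) : ℂ⟦X⟧)
      = C (Complex.I * (jv 1 0 p : ℂ)) := by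
    rw [← map_mul]; congr 1; field_simp
  have c3 : (C (Complex.I * (v : ℂ)) * C (Complex.I * (ju 0 1 p : ℂ) / (v : ℂ)) : ℂ⟦X⟧)
      = -C (ju 0 1 p : ℂ) := by
    rw [← map_mul, ← map_neg]; congr 1; field_simp; linear_combination (ju 0 1 p : ℂ) * hI
  have a1 := powSeries_half_mul_neg_half e₁
  have a2 := powSeries_half_mul_neg_half e₂
  have b1 := one_add_mul_powSeries_neg_half e₁
  have b2 := one_add_mul_powSeries_neg_half e₂
  have hh : (2 * C (1 / 2) : ℂ⟦X⟧) = 1 := by rw [two_mul, ← map_add]; norm_num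
  -- The quadratic and constant components cancel identically; only the linear one uses the
  -- equations of the system.
  refine Prod.ext ?_ (Prod.ext ?_ ?_)
  · simp only [riccatiXY, riccatiYX, riccatiX, riccatiY, riccatiBracket, alphaSeries,
      alphaRatioSeries, Prod.fst_add, Prod.fst_sub, Prod.fst_zero, map_neg]
    linear_combination (-C (1 / 2) * X * powSeries (-1 / 2) e₂ * powSeries (-1 / 2) e₁
        * powSeries (1 / 2) e₁) * c2
      + (C (1 / 2) * X * powSeries (-1 / 2) e₁ * powSeries (-1 / 2) e₂
        * powSeries (1 / 2) e₂) * c3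
      - (C (1 / 2) * X * powSeries (-1 / 2) e₂ * C (Complex.I * (jv 1 0 p : ℂ))) * a1
      - (C (1 / 2) * X * powSeries (-1 / 2) e₁ * C (ju 0 1 p : ℂ)) * a2
  · simp only [riccatiXY, riccatiYX, riccatiX, riccatiY, riccatiBracket, alphaSeries,
      alphaRatioSeries, Prod.fst_add, Prod.snd_add, Prod.fst_sub, Prod.snd_sub, Prod.fst_zero,
      Prod.snd_zero, map_neg]
    linear_combination (powSeries (-1 / 2) e₁ * powSeries (-1 / 2) e₂) * c0
      + (X ^ 2 * powSeries (-1 / 2) e₁ * powSeries (-1 / 2) e₂) * c1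
      + (C (u : ℂ) * C (Complex.I * (v : ℂ)) * X ^ 2 * powSeries (-1 / 2) e₁
        * powSeries (-1 / 2) e₂ * (2 * C (1 / 2) + 1)) * hh
      - (C (Complex.I * (P : ℂ)) * powSeries (-1 / 2) e₁) * b2
      - (C (Complex.I * (Q : ℂ)) * powSeries (-1 / 2) e₂) * b1
  · simp only [riccatiXY, riccatiYX, riccatiX, riccatiY, riccatiBracket, alphaSeries,
      alphaRatioSeries, Prod.snd_add, Prod.snd_sub, Prod.snd_zero, map_neg]
    linear_combination (C (1 / 2) * X * powSeries (-1 / 2) e₂ * powSeries (-1 / 2) e₁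
        * powSeries (1 / 2) e₁) * c2
      + (C (1 / 2) * X * powSeries (-1 / 2) e₁ * powSeries (-1 / 2) e₂
        * powSeries (1 / 2) e₂) * c3
      + (C (1 / 2) * X * powSeries (-1 / 2) e₂ * C (Complex.I * (jv 1 0 p : ℂ))) * a1
      - (C (1 / 2) * X * powSeries (-1 / 2) e₁ * C (ju 0 1 p : ℂ)) * a2

lemma hasDerivAt_affine_smul {E : Type} [NormedAddCommGroup E] [NormedSpace ℝ E] (a b : E) :
    HasDerivAt (fun t : ℝ => a + t • b) b 0 := by
  simpa using ((hasDerivAt_id (0 : ℝ)).smul_const b).const_add a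

variable (hd : SmoothData η₁ η₂ I J)
include hd

/-- Chain rule: `D_y` differentiates the Riccati coefficients, which gives `riccatiXY`, and moves
the nonlocal variables along the `y`-field, which gives `flowDeriv`. As `u_yy` is left unreduced,
this holds off the equation too. -/
lemma covDy_omegaX {n : ℕ} (s : ℕ) {p : Cov n} (hp : p ∈ covDomain η₁ η₂ I J n) :
    covDy η₁ η₂ (omegaX η₁ η₂ s) p = coeff s (flow (riccatiXY η₁ η₂ p.1) p.2
      + flowDeriv (riccatiX η₁ η₂ p.1) p.2 (flowField n (riccatiY η₁ η₂ p.1) p.2)) := by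
  obtain ⟨-, hy, -, -, hv⟩ := hp
  have hline := hasVelocity_line 2 p.1 (jetFieldY p.1)
  have hu := (hline.2.2 0 0 (by omega)).1
  have hv' := (hline.2.2 0 0 (by omega)).2
  have huy := (hline.2.2 0 1 (by omega)).1
  have hx : ∀ t : ℝ, jx (p.1 + t • jetFieldY p.1) = jx p.1 := fun t => by
    simp [jx, jetFieldY]
  have he : HasDerivAt (fun t : ℝ => η₂ (jy (p.1 + t • jetFieldY p.1))) (deriv η₂ (jy p.1)) 0 := by
    have h1 := ((hd.contDiffAt_right hy).differentiableAt (by simp)).hasDerivAt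
    have h2 : HasDerivAt (fun t : ℝ => η₂ (jy (p.1 + t • jetFieldY p.1)))
        (deriv η₂ (jy p.1) * jy (jetFieldY p.1)) 0 :=
      HasDerivAt.comp_of_eq (0 : ℝ) h1 hline.2.1 (by simp)
    exact h2.congr_deriv (by simp [jetFieldY, jy])
  have hθ := hasDerivAt_affine_smul p.2 (fun k : Fin n => omegaY η₁ η₂ k p)
  have hA := (hasSeriesDeriv_C hu.ofReal_comp).mul
    (hasSeriesDeriv_const (t := 0) (C (1 / 2) * X * alphaSeries (η₁ (jx p.1))))
  have hq := ((huy.div hv' (by simpa using hv)).ofReal_comp.const_mul Complex.I)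
  have hB := (hasSeriesDeriv_C hq).mul
    (hasSeriesDeriv_alphaRatio_left he (g := fun t => η₁ (jx (p.1 + t • jetFieldY p.1)))
      fun s => by simp only [hx])
  have key := hasSeriesDeriv_flow
    (R := fun t : ℝ => riccatiX η₁ η₂ (p.1 + t • jetFieldY p.1)) (R' := riccatiXY η₁ η₂ p.1)
    (θ := fun t : ℝ => p.2 + t • fun k : Fin n => omegaY η₁ η₂ k p) (t := 0)
    (by
      simp only [riccatiX, hx]
      refine hA.congr_deriv ?_
      simp [riccatiXY, jetFieldY, ju])
    (by
      have e : (fun t : ℝ => (riccatiX η₁ η₂ (p.1 + t • jetFieldY p.1)).2.1) = fun t : ℝ =>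
          C (Complex.I * ((ju 0 1 (p.1 + t • jetFieldY p.1) / jv 0 0 (p.1 + t • jetFieldY p.1) : ℝ)
            : ℂ)) * alphaRatioSeries (η₂ (jy (p.1 + t • jetFieldY p.1)))
            (η₁ (jx (p.1 + t • jetFieldY p.1))) := by
        funext t
        simp only [riccatiX]; push_cast; rw [mul_div_assoc]
      rw [e]
      refine hB.congr_deriv ?_
      simp [riccatiXY, jetFieldY, ju, jv, mul_div_assoc])
    (by
      simp only [riccatiX, hx]
      refine hA.congr_deriv ?_
      simp [riccatiXY, jetFieldY, ju]) hθ s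
  have e1 : (fun k : Fin n => omegaY η₁ η₂ k p) = flowField n (riccatiY η₁ η₂ p.1) p.2 := by
    funext k; rw [omegaY_eq]; rfl
  have e2 : covDy η₁ η₂ (omegaX η₁ η₂ s) p = _ := HasDerivAt.deriv (f := fun t : ℝ =>
    omegaX η₁ η₂ s (p + t • ((jetFieldY p.1, fun k : Fin n => omegaY η₁ η₂ k p) : Cov n)))
    (by simp only [omegaX_eq]; exact key)
  rw [e2, e1]
  simp

lemma covDx_omegaY {n : ℕ} (s : ℕ) {p : Cov n} (hp : p ∈ covDomain η₁ η₂ I J n) :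
    covDx η₁ η₂ (omegaY η₁ η₂ s) p = coeff s (flow (riccatiYX η₁ η₂ p.1) p.2
      + flowDeriv (riccatiY η₁ η₂ p.1) p.2 (flowField n (riccatiX η₁ η₂ p.1) p.2)) := by
  obtain ⟨hx', -, -, hu, -⟩ := hp
  have hline := hasVelocity_line 2 p.1 (jetFieldX p.1)
  have hu' := (hline.2.2 0 0 (by omega)).1
  have hv := (hline.2.2 0 0 (by omega)).2
  have hvx := (hline.2.2 1 0 (by omega)).2
  have hy : ∀ t : ℝ, jy (p.1 + t • jetFieldX p.1) = jy p.1 := fun t => by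
    simp [jy, jetFieldX]
  have he : HasDerivAt (fun t : ℝ => η₁ (jx (p.1 + t • jetFieldX p.1))) (deriv η₁ (jx p.1)) 0 := by
    have h1 := ((hd.contDiffAt_left hx').differentiableAt (by simp)).hasDerivAt
    have h2 : HasDerivAt (fun t : ℝ => η₁ (jx (p.1 + t • jetFieldX p.1)))
        (deriv η₁ (jx p.1) * jx (jetFieldX p.1)) 0 :=
      HasDerivAt.comp_of_eq (0 : ℝ) h1 hline.1 (by simp)
    exact h2.congr_deriv (by simp [jetFieldX, jx])
  have hθ := hasDerivAt_affine_smul p.2 (fun k : Fin n => omegaX η₁ η₂ k p)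
  have hA := (hasSeriesDeriv_C (hv.ofReal_comp.const_mul Complex.I)).mul
    (hasSeriesDeriv_const (t := 0) (C (1 / 2) * X * alphaSeries (η₂ (jy p.1))))
  have hA' := (hasSeriesDeriv_C (hv.ofReal_comp.const_mul Complex.I).fun_neg).mul
    (hasSeriesDeriv_const (t := 0) (C (1 / 2) * X * alphaSeries (η₂ (jy p.1))))
  have hq := ((hvx.div hu' (by simpa using hu)).ofReal_comp.const_mul Complex.I).fun_neg
  have hB := (hasSeriesDeriv_C hq).mul
    (hasSeriesDeriv_alphaRatio_left he (g := fun t => η₂ (jy (p.1 + t • jetFieldX p.1)))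
      fun s => by simp only [hy])
  have key := hasSeriesDeriv_flow
    (R := fun t : ℝ => riccatiY η₁ η₂ (p.1 + t • jetFieldX p.1)) (R' := riccatiYX η₁ η₂ p.1)
    (θ := fun t : ℝ => p.2 + t • fun k : Fin n => omegaX η₁ η₂ k p) (t := 0)
    (by
      simp only [riccatiY, hy]
      refine hA'.congr_deriv ?_
      simp [riccatiYX, jetFieldX, jv])
    (by
      have e : (fun t : ℝ => (riccatiY η₁ η₂ (p.1 + t • jetFieldX p.1)).2.1) = fun t : ℝ =>
          C (-(Complex.I * ((jv 1 0 (p.1 + t • jetFieldX p.1) / ju 0 0 (p.1 + t • jetFieldX p.1)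
            : ℝ) : ℂ))) * alphaRatioSeries (η₁ (jx (p.1 + t • jetFieldX p.1)))
            (η₂ (jy (p.1 + t • jetFieldX p.1))) := by
        funext t
        simp only [riccatiY]; push_cast; rw [mul_div_assoc]
      rw [e]
      refine hB.congr_deriv ?_
      simp [riccatiYX, jetFieldX, ju, jv, mul_div_assoc])
    (by
      simp only [riccatiY, hy]
      refine hA.congr_deriv ?_
      simp [riccatiYX, jetFieldX, jv]) hθ s
  have e1 : (fun k : Fin n => omegaX η₁ η₂ k p) = flowField n (riccatiX η₁ η₂ p.1) p.2 := by
    funext k; rw [omegaX_eq]; rfl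
  have e2 : covDx η₁ η₂ (omegaY η₁ η₂ s) p = _ := HasDerivAt.deriv (f := fun t : ℝ =>
    omegaY η₁ η₂ s (p + t • ((jetFieldX p.1, fun k : Fin n => omegaX η₁ η₂ k p) : Cov n)))
    (by simp only [omegaY_eq]; exact key)
  rw [e2, e1]
  simp

/-- The difference of the two sides is the coefficient at `μ^s` of the flow of the zero curvature
expression. Only `θ_0, …, θ_{s-1}` are available, so the extra degree in `coeff_flowDeriv_sub` is
essential. -/
lemma covDy_omegaX_eq_covDx_omegaY (s : ℕ) {p : Cov s} (hp : p ∈ covEquation η₁ η₂ I J s) :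
    covDy η₁ η₂ (omegaX η₁ η₂ s) p = covDx η₁ η₂ (omegaY η₁ η₂ s) p := by
  have hp' : p ∈ equationManifold η₁ η₂ I J ×ˢ (Set.univ : Set (Fin s → ℂ)) := ⟨hp, trivial⟩
  have hdom : p ∈ covDomain η₁ η₂ I J s := hp'.1.1
  rw [covDy_omegaX hd s hdom, covDx_omegaY hd s hdom, map_add, map_add, ← sub_eq_zero]
  have h1 := coeff_flowDeriv_sub (small_riccatiY η₁ η₂ p.1) (small_riccatiX η₁ η₂ p.1) p.2
    (le_refl s)
  have h2 := congrArg (fun R => coeff s (flow R p.2)) (riccati_flat hp'.1)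
  simp only [flow_add, flow_sub, map_add, map_sub, ← h1] at h2
  have h3 : coeff s (flow (0 : Riccati) p.2) = 0 := by simp [flow]
  rw [h3] at h2
  linear_combination h2

end Conservation

end SDeform

end

/-! ### Smooth functions and potentials on the covering -/

noncomputable section

namespace SDeform

open Filter Topology

/-- A map into the covering space all of whose coordinates are smooth at `e`. -/
def CovPlot {E : Type} [NormedAddCommGroup E] [NormedSpace ℝ E] {n : ℕ} (γ : E → Cov n) (e : E) :
    Prop :=
  JetPlot (fun z => (γ z).1) e ∧ ContDiffAt ℝ ∞ (fun z => (γ z).2) e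

/-- Smoothness on `D` of a function on the covering space, tested on smooth maps. -/
def CovSmoothOn {n : ℕ} (D : Set (Cov n)) (h : Cov n → ℂ) : Prop :=
  ∀ (E : Type) [NormedAddCommGroup E] [NormedSpace ℝ E] (γ : E → Cov n) (e : E),
    CovPlot γ e → γ e ∈ D → ContDiffAt ℝ ∞ (fun z => h (γ z)) e

/-- A set that is a neighbourhood of each of its points along smooth maps. -/
def CovOpen {n : ℕ} (D : Set (Cov n)) : Prop :=
  ∀ (E : Type) [NormedAddCommGroup E] [NormedSpace ℝ E] (γ : E → Cov n) (e : E),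
    CovPlot γ e → γ e ∈ D → ∀ᶠ z in 𝓝 e, γ z ∈ D

section Plots

variable {E F : Type} [NormedAddCommGroup E] [NormedSpace ℝ E] [NormedAddCommGroup F]
  [NormedSpace ℝ F] {n : ℕ} {γ δ : E → Cov n} {e : E}

lemma covPlot_const (p : Cov n) : CovPlot (fun _ : E => p) e :=
  ⟨jetPlot_const _, contDiffAt_const⟩

lemma CovPlot.add (hγ : CovPlot γ e) (hδ : CovPlot δ e) : CovPlot (fun z => γ z + δ z) e :=
  ⟨hγ.1.add hδ.1, hγ.2.add hδ.2⟩

lemma CovPlot.smul {c : E → ℝ} (hc : ContDiffAt ℝ ∞ c e) (hγ : CovPlot γ e) :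
    CovPlot (fun z => c z • γ z) e :=
  ⟨hγ.1.smul hc, hc.smul hγ.2⟩

lemma covPlot_line (p v : Cov n) (t : ℝ) : CovPlot (fun t : ℝ => p + t • v) t :=
  (covPlot_const p).add ((covPlot_const v).smul contDiffAt_id)

end Plots

section LineDeriv

variable {n : ℕ} {D : Set (Cov n)} {h : Cov n → ℂ} {p v w : Cov n}

lemma CovSmoothOn.differentiableAt_line (hh : CovSmoothOn D h) (hp : p ∈ D) (v : Cov n) :
    DifferentiableAt ℝ (fun t : ℝ => h (p + t • v)) 0 :=
  (hh ℝ _ 0 (covPlot_line p v 0) (by simpa using hp)).differentiableAt (by simp)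

/-- Line derivatives need not be additive in the direction; here they are, because the restriction
of `h` to the plane through `p` spanned by `v` and `w` is differentiable at `p`. -/
lemma CovSmoothOn.lineDeriv_add (hh : CovSmoothOn D h) (hp : p ∈ D) (v w : Cov n) :
    lineDeriv ℝ h p (v + w) = lineDeriv ℝ h p v + lineDeriv ℝ h p w := by
  have hpl : CovPlot (fun z : ℝ × ℝ => p + z.1 • v + z.2 • w) (0, 0) :=
    ((covPlot_const p).add ((covPlot_const v).smul contDiffAt_fst)).add
      ((covPlot_const w).smul contDiffAt_snd)
  have hf := ((hh _ _ _ hpl (by simpa using hp)).differentiableAt (by simp)).hasFDerivAt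
  have key : ∀ a b : ℝ, lineDeriv ℝ h p (a • v + b • w)
      = fderiv ℝ (fun z : ℝ × ℝ => h (p + z.1 • v + z.2 • w)) (0, 0) (a, b) := by
    intro a b
    have h1 : HasDerivAt (fun t : ℝ => (t * a, t * b)) (a, b) 0 := by
      simpa using ((hasDerivAt_id (0 : ℝ)).mul_const a).prodMk
        ((hasDerivAt_id (0 : ℝ)).mul_const b)
    have h2 := HasFDerivAt.comp_hasDerivAt_of_eq (0 : ℝ) hf h1 (by simp)
    have h3 : (fun t : ℝ => h (p + t • (a • v + b • w)))
        = (fun z : ℝ × ℝ => h (p + z.1 • v + z.2 • w)) ∘ fun t : ℝ => (t * a, t * b) := by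
      funext t
      simp only [Function.comp, smul_add, smul_smul, add_assoc]
    rw [lineDeriv, h3]
    exact h2.deriv
  have h1 := key 1 1
  have h2 := key 1 0
  have h3 := key 0 1
  simp only [one_smul, zero_smul, add_zero, zero_add] at h1 h2 h3
  rw [h1, h2, h3, ← map_add]
  simp

lemma CovSmoothOn.lineDeriv_sub (hh : CovSmoothOn D h) (hp : p ∈ D) (v w : Cov n) :
    lineDeriv ℝ h p (v - w) = lineDeriv ℝ h p v - lineDeriv ℝ h p w := by
  rw [eq_sub_iff_add_eq, ← hh.lineDeriv_add hp, sub_add_cancel]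

lemma CovSmoothOn.eq_of_lineDeriv_eq_zero (hh : CovSmoothOn D h) (v : Cov n)
    (hD : ∀ t ∈ Set.Icc (0 : ℝ) 1, p + t • v ∈ D)
    (hz : ∀ t ∈ Set.Icc (0 : ℝ) 1, lineDeriv ℝ h (p + t • v) v = 0) : h (p + v) = h p := by
  have hder : ∀ t ∈ Set.Icc (0 : ℝ) 1, HasDerivAt (fun s : ℝ => h (p + s • v)) 0 t := by
    intro t ht
    have h1 := (hh.differentiableAt_line (hD t ht) v).hasDerivAt
    have h2 : HasDerivAt (fun s : ℝ => h (p + t • v + s • v)) 0 0 := hz t ht ▸ h1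
    have h3 : HasDerivAt (fun s : ℝ => s - t) 1 t := (hasDerivAt_id t).sub_const t
    have h4 := HasDerivAt.scomp_of_eq t h2 h3 (by simp)
    simp only [smul_zero] at h4
    refine h4.congr_of_eventuallyEq (Eventually.of_forall fun s => ?_)
    simp only [Function.comp, add_assoc, ← add_smul]
    congr 3; ring
  have := constant_of_has_deriv_right_zero (f := fun s : ℝ => h (p + s • v)) (a := 0) (b := 1)
    (fun t ht => (hder t ht).continuousAt.continuousWithinAt)
    (fun t ht => (hder t ⟨ht.1, ht.2.le⟩).hasDerivWithinAt) 1 (by simp)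
  simpa using this

end LineDeriv

/-- The total derivative field `D_x` on the covering. -/
def covFieldX (η₁ η₂ : ℝ → ℝ) {n : ℕ} (p : Cov n) : Cov n :=
  (jetFieldX p.1, fun k : Fin n => omegaX η₁ η₂ k p)

/-- The total derivative field `D_y` on the covering. -/
def covFieldY (η₁ η₂ : ℝ → ℝ) {n : ℕ} (p : Cov n) : Cov n :=
  (jetFieldY p.1, fun k : Fin n => omegaY η₁ η₂ k p)

section System

variable {η₁ η₂ : ℝ → ℝ} {I J : Set ℝ}

lemma omegaX_congr {n : ℕ} {p q : Cov n} (hx : jx p.1 = jx q.1) (hy : jy p.1 = jy q.1)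
    (hu : ju 0 0 p.1 = ju 0 0 q.1) (huy : ju 0 1 p.1 = ju 0 1 q.1) (hv : jv 0 0 p.1 = jv 0 0 q.1)
    (hθ : p.2 = q.2) (s : ℕ) : omegaX η₁ η₂ s p = omegaX η₁ η₂ s q := by
  rw [omegaX_eq, omegaX_eq, riccatiX, riccatiX, hx, hy, hu, huy, hv, hθ]

lemma omegaY_congr {n : ℕ} {p q : Cov n} (hx : jx p.1 = jx q.1) (hy : jy p.1 = jy q.1)
    (hu : ju 0 0 p.1 = ju 0 0 q.1) (hvx : jv 1 0 p.1 = jv 1 0 q.1) (hv : jv 0 0 p.1 = jv 0 0 q.1)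
    (hθ : p.2 = q.2) (s : ℕ) : omegaY η₁ η₂ s p = omegaY η₁ η₂ s q := by
  rw [omegaY_eq, omegaY_eq, riccatiY, riccatiY, hx, hy, hu, hvx, hv, hθ]

/-- The point with the given coordinates, all other coordinates being zero. -/
def covExt {k n : ℕ} (z : ℝ × ℝ × (Fin k → Fin k → ℝ) × (Fin k → Fin k → ℝ) × (Fin n → ℂ)) :
    Cov n :=
  ((z.1, z.2.1, extendZero z.2.2.1, extendZero z.2.2.2.1), z.2.2.2.2)

lemma covPlot_covExt {k n : ℕ}
    (z : ℝ × ℝ × (Fin k → Fin k → ℝ) × (Fin k → Fin k → ℝ) × (Fin n → ℂ)) :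
    CovPlot (covExt : _ → Cov n) z := by
  have h2 : ContDiff ℝ ∞ fun z : ℝ × ℝ × (Fin k → Fin k → ℝ) × (Fin k → Fin k → ℝ)
      × (Fin n → ℂ) => z.2.2 := contDiff_snd.comp contDiff_snd
  refine ⟨⟨contDiffAt_fst, (contDiff_fst.comp contDiff_snd).contDiffAt, fun i j => ?_,
    fun i j => ?_⟩, (contDiff_snd.comp (contDiff_snd.comp h2)).contDiffAt⟩
  · exact ((contDiff_extendZero i j).comp (contDiff_fst.comp h2)).contDiffAt
  · exact ((contDiff_extendZero i j).comp
      (contDiff_fst.comp (contDiff_snd.comp h2))).contDiffAt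

lemma truncate_add_covExt {k n : ℕ} (p : Cov n)
    (z : ℝ × ℝ × (Fin k → Fin k → ℝ) × (Fin k → Fin k → ℝ) × (Fin n → ℂ)) :
    truncate k n (p + covExt (z - truncate k n p)) = z := by
  refine Prod.ext ?_ (Prod.ext ?_ (Prod.ext ?_ (Prod.ext ?_ ?_)))
  · simp [truncate, covExt, jx]
  · simp [truncate, covExt, jy]
  · funext i j; simp [truncate, covExt, ju, extendZero]
  · funext i j; simp [truncate, covExt, jv, extendZero]
  · simp [truncate, covExt]

variable (hd : SmoothData η₁ η₂ I J)
include hd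

lemma covOpen_covDomain (n : ℕ) : CovOpen (covDomain η₁ η₂ I J n) := fun E _ _ _ e hγ he =>
  jetOpen_jetDomain hd E _ e hγ.1 he

lemma covSmoothOn_omegaX (s n : ℕ) :
    CovSmoothOn (covDomain η₁ η₂ I J n) (fun p : Cov n => omegaX η₁ η₂ s p) := by
  intro E _ _ γ e hγ he
  obtain ⟨hx, hy, -, -, hv⟩ := he
  have e1 : ContDiffAt ℝ ∞ (fun z => η₁ (jx (γ z).1)) e :=
    (hd.contDiffAt_left hx).comp e hγ.1.1
  have e2 : ContDiffAt ℝ ∞ (fun z => η₂ (jy (γ z).1)) e :=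
    (hd.contDiffAt_right hy).comp e hγ.1.2.1
  have ofReal : ∀ {g : E → ℝ}, ContDiffAt ℝ ∞ g e → ContDiffAt ℝ ∞ (fun z => (g z : ℂ)) e :=
    fun hg => Complex.ofRealCLM.contDiff.contDiffAt.comp e hg
  have ha : SeriesSmoothAt (fun z => (riccatiX η₁ η₂ (γ z).1).1) e :=
    (seriesSmoothAt_C (ofReal (hγ.1.2.2.1 0 0))).mul
      ((seriesSmoothAt_const _).mul (seriesSmoothAt_powSeries e1 _))
  have hq : ContDiffAt ℝ ∞
      (fun z => Complex.I * (ju 0 1 (γ z).1 : ℂ) / (jv 0 0 (γ z).1 : ℂ)) e := by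
    simp only [mul_div_assoc, ← Complex.ofReal_div]
    exact contDiffAt_const.mul (ofReal ((hγ.1.2.2.1 0 1).div (hγ.1.2.2.2 0 0) hv))
  have hb : SeriesSmoothAt (fun z => (riccatiX η₁ η₂ (γ z).1).2.1) e :=
    (seriesSmoothAt_C hq).mul
      ((seriesSmoothAt_powSeries e2 _).mul (seriesSmoothAt_powSeries e1 _))
  have := seriesSmoothAt_flow (R := fun z => riccatiX η₁ η₂ (γ z).1) ha hb ha hγ.2 s
  simpa only [omegaX_eq] using this

lemma covSmoothOn_omegaY (s n : ℕ) :
    CovSmoothOn (covDomain η₁ η₂ I J n) (fun p : Cov n => omegaY η₁ η₂ s p) := by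
  intro E _ _ γ e hγ he
  obtain ⟨hx, hy, -, hu, -⟩ := he
  have e1 : ContDiffAt ℝ ∞ (fun z => η₁ (jx (γ z).1)) e :=
    (hd.contDiffAt_left hx).comp e hγ.1.1
  have e2 : ContDiffAt ℝ ∞ (fun z => η₂ (jy (γ z).1)) e :=
    (hd.contDiffAt_right hy).comp e hγ.1.2.1
  have ofReal : ∀ {g : E → ℝ}, ContDiffAt ℝ ∞ g e → ContDiffAt ℝ ∞ (fun z => (g z : ℂ)) e :=
    fun hg => Complex.ofRealCLM.contDiff.contDiffAt.comp e hg
  have hm : ContDiffAt ℝ ∞ (fun z => Complex.I * (jv 0 0 (γ z).1 : ℂ)) e :=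
    contDiffAt_const.mul (ofReal (hγ.1.2.2.2 0 0))
  have hs : SeriesSmoothAt (fun z => PowerSeries.C (1 / 2) * PowerSeries.X
      * alphaSeries (η₂ (jy (γ z).1))) e :=
    (seriesSmoothAt_const _).mul (seriesSmoothAt_powSeries e2 _)
  have hq : ContDiffAt ℝ ∞
      (fun z => Complex.I * (jv 1 0 (γ z).1 : ℂ) / (ju 0 0 (γ z).1 : ℂ)) e := by
    simp only [mul_div_assoc, ← Complex.ofReal_div]
    exact contDiffAt_const.mul (ofReal ((hγ.1.2.2.2 1 0).div (hγ.1.2.2.1 0 0) hu))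
  have hb : SeriesSmoothAt (fun z => (riccatiY η₁ η₂ (γ z).1).2.1) e :=
    (seriesSmoothAt_C hq.neg).mul
      ((seriesSmoothAt_powSeries e1 _).mul (seriesSmoothAt_powSeries e2 _))
  have := seriesSmoothAt_flow (R := fun z => riccatiY η₁ η₂ (γ z).1)
    ((seriesSmoothAt_C hm.neg).mul hs) hb ((seriesSmoothAt_C hm).mul hs) hγ.2 s
  simpa only [omegaY_eq] using this

omit hd in
lemma isSmooth_of_covSmoothOn {n : ℕ} {h : Cov n → ℂ}
    (hh : CovSmoothOn (covDomain η₁ η₂ I J n) h)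
    (hk : ∀ p : Cov n, h p = h (covExt (truncate 2 n p))) :
    IsSmooth (covDomain η₁ η₂ I J n) h := by
  -- `k = 2` keeps the indices `0` and `1`, enough for the `u`, `v`, `u_y`, `v_x` in `ω_s`. Since
  -- `u` and `v` are retained, extension by zero stays in the domain.
  refine ⟨2, fun z => h (covExt z), ?_, fun p _ => hk p⟩
  rintro _ ⟨p, hp, rfl⟩
  refine (hh _ _ _ (covPlot_covExt _) ?_).contDiffWithinAt
  have : AgreeParam 0 p.1 (covExt (truncate 2 n p)).1 := by
    refine ⟨rfl, rfl, fun i j hij => ?_⟩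
    obtain ⟨rfl, rfl⟩ : i = 0 ∧ j = 0 := by omega
    exact ⟨fun _ => rfl, fun _ => rfl⟩
  exact mem_jetDomain_of_agreeParam this hp

lemma isConservationLaw_omega (s : ℕ) :
    IsConservationLaw η₁ η₂ I J (n := s) (omegaX η₁ η₂ s) (omegaY η₁ η₂ s) :=
  ⟨isSmooth_of_covSmoothOn (covSmoothOn_omegaX hd s s)
    fun _ => omegaX_congr rfl rfl rfl rfl rfl rfl s,
    isSmooth_of_covSmoothOn (covSmoothOn_omegaY hd s s)
    fun _ => omegaY_congr rfl rfl rfl rfl rfl rfl s,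
    fun _ hp => covDy_omegaX_eq_covDx_omegaY hd s hp⟩

section Smooth

variable {n k : ℕ} {f : Cov n → ℂ}
  {F : ℝ × ℝ × (Fin k → Fin k → ℝ) × (Fin k → Fin k → ℝ) × (Fin n → ℂ) → ℂ}

/-- The truncated domain is a neighbourhood of each of its points, because `p` can be perturbed in
the retained coordinates alone. Hence smoothness within the image is genuine smoothness. -/
lemma contDiffAt_of_contDiffOn_image
    (hF : ContDiffOn ℝ ∞ F (truncate k n '' covDomain η₁ η₂ I J n)) {p : Cov n}
    (hp : p ∈ covDomain η₁ η₂ I J n) : ContDiffAt ℝ ∞ F (truncate k n p) := by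
  refine hF.contDiffAt ?_
  have hz : p + covExt (truncate k n p - truncate k n p) = p := by
    rw [sub_self]; ext <;> simp [covExt, extendZero]
  have hpl : CovPlot (fun z => p + covExt (z - truncate k n p)) (truncate k n p) := by
    refine (covPlot_const p).add ?_
    have h1 := covPlot_covExt (truncate k n p - truncate k n p)
    have h2 : ContDiffAt ℝ ∞ (fun z => z - truncate k n p) (truncate k n p) :=
      contDiffAt_id.sub contDiffAt_const
    exact ⟨h1.1.comp h2 rfl, ContDiffAt.comp (g := fun z => (covExt z).2) _ h1.2 h2⟩
  filter_upwards [covOpen_covDomain hd n _ _ _ hpl (hz.symm ▸ hp)] with z hz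
  exact ⟨_, hz, truncate_add_covExt p z⟩

omit hd in
lemma contDiffAt_truncate {E : Type} [NormedAddCommGroup E] [NormedSpace ℝ E] {γ : E → Cov n}
    {e : E} (hγ : CovPlot γ e) : ContDiffAt ℝ ∞ (fun z => truncate k n (γ z)) e :=
  hγ.1.1.prodMk (hγ.1.2.1.prodMk (ContDiffAt.prodMk
    (contDiffAt_pi.2 fun i => contDiffAt_pi.2 fun j => hγ.1.2.2.1 i j)
    (ContDiffAt.prodMk (contDiffAt_pi.2 fun i => contDiffAt_pi.2 fun j => hγ.1.2.2.2 i j) hγ.2)))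

lemma covSmoothOn_of_contDiffOn
    (hF : ContDiffOn ℝ ∞ F (truncate k n '' covDomain η₁ η₂ I J n))
    (hf : ∀ p ∈ covDomain η₁ η₂ I J n, f p = F (truncate k n p)) :
    CovSmoothOn (covDomain η₁ η₂ I J n) f := by
  intro E _ _ γ e hγ he
  have h1 := (contDiffAt_of_contDiffOn_image hd hF he).comp e (contDiffAt_truncate hγ)
  refine h1.congr_of_eventuallyEq ?_
  filter_upwards [covOpen_covDomain hd n E γ e hγ he] with z hz
  exact hf _ hz

lemma hasDerivAt_of_contDiffOn
    (hF : ContDiffOn ℝ ∞ F (truncate k n '' covDomain η₁ η₂ I J n))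
    (hf : ∀ p ∈ covDomain η₁ η₂ I J n, f p = F (truncate k n p)) {γ : ℝ → Cov n} {v : Cov n}
    (hγ : CovPlot γ 0) (h0 : γ 0 ∈ covDomain η₁ η₂ I J n)
    (hv : HasVelocity (2 * k) (fun t => (γ t).1) v.1)
    (hθ : HasDerivAt (fun t => (γ t).2) v.2 0) :
    HasDerivAt (fun t => f (γ t)) (fderiv ℝ F (truncate k n (γ 0)) (truncate k n v)) 0 := by
  have h1 : HasDerivAt (fun t => truncate k n (γ t)) (truncate k n v) 0 := by
    refine hv.1.prodMk (hv.2.1.prodMk (HasDerivAt.prodMk ?_ (HasDerivAt.prodMk ?_ hθ)))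
    · exact hasDerivAt_pi.2 fun i => hasDerivAt_pi.2 fun j => (hv.2.2 i j (by omega)).1
    · exact hasDerivAt_pi.2 fun i => hasDerivAt_pi.2 fun j => (hv.2.2 i j (by omega)).2
  have h2 := (((contDiffAt_of_contDiffOn_image hd hF h0).differentiableAt
    (by simp)).hasFDerivAt).comp_hasDerivAt (0 : ℝ) h1
  refine h2.congr_of_eventuallyEq ?_
  filter_upwards [covOpen_covDomain hd n ℝ γ 0 hγ h0] with z hz
  exact hf _ hz

end Smooth

/-- The point of the covering equation with the same parametric coordinates. -/
def covNormal (η₁ η₂ : ℝ → ℝ) {n : ℕ} (p : Cov n) : Cov n := (jetNormal η₁ η₂ p.1, p.2)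

lemma covNormal_mem {n : ℕ} {p : Cov n} (hp : p ∈ covDomain η₁ η₂ I J n) :
    covNormal η₁ η₂ p ∈ covEquation η₁ η₂ I J n := jetNormal_mem_equationManifold hd hp

/-- A function on the covering with prescribed total derivatives on the equation. -/
structure IsPotential (η₁ η₂ : ℝ → ℝ) (I J : Set ℝ) {n : ℕ} (h : Cov n → ℂ) : Prop where
  smooth : CovSmoothOn (covDomain η₁ η₂ I J n) h
  lineDeriv_x : ∀ p ∈ covEquation η₁ η₂ I J n,
    lineDeriv ℝ h p (covFieldX η₁ η₂ p) = omegaX η₁ η₂ n p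
  lineDeriv_y : ∀ p ∈ covEquation η₁ η₂ I J n,
    lineDeriv ℝ h p (covFieldY η₁ η₂ p) = omegaY η₁ η₂ n p

/-- On `D`, the values of `h` depend only on the classes of the relation `r`. -/
def Respects {n : ℕ} (D : Set (Cov n)) (r : Cov n → Cov n → Prop) (h : Cov n → ℂ) : Prop :=
  ∀ p ∈ D, ∀ q ∈ D, r p q → h p = h q

/-- Agreement of the parametric coordinates of order at most `m` and of the nonlocal variables. -/
def CovAgree {n : ℕ} (m : ℕ) (p q : Cov n) : Prop := AgreeParam m p.1 q.1 ∧ p.2 = q.2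

/-- Composing `f` with the retraction `covNormal` gives a function of the parametric coordinates. On
the equation its total derivatives are those of `f`: the total derivative fields are tangent, so the
retracted line has the same velocity as the line. -/
lemma exists_isPotential {n : ℕ}
    (ht : IsTrivialForm η₁ η₂ I J (n := n) (omegaX η₁ η₂ n) (omegaY η₁ η₂ n)) :
    ∃ (h : Cov n → ℂ) (m : ℕ), IsPotential η₁ η₂ I J h ∧
      Respects (covDomain η₁ η₂ I J n) (CovAgree m) h := by
  obtain ⟨f, ⟨k, F, hF, hf⟩, hform⟩ := ht
  have hplot : ∀ (E : Type) [NormedAddCommGroup E] [NormedSpace ℝ E] (γ : E → Cov n) (e : E),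
      CovPlot γ e → γ e ∈ covDomain η₁ η₂ I J n → CovPlot (fun z => covNormal η₁ η₂ (γ z)) e :=
    fun E _ _ γ e hγ he => ⟨hγ.1.jetNormal hd he, hγ.2⟩
  have hsub : covEquation η₁ η₂ I J n ⊆ covDomain η₁ η₂ I J n := fun p hp => hp.1
  have hchain : ∀ p ∈ covEquation η₁ η₂ I J n, ∀ v : Cov n,
      HasVelocity (2 * k) (fun t => jetNormal η₁ η₂ (p.1 + t • v.1)) v.1 →
      lineDeriv ℝ (fun q => f (covNormal η₁ η₂ q)) p v = lineDeriv ℝ f p v := by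
    intro p hp v hv
    have hp0 : p + (0 : ℝ) • v = p := by simp
    have hN : covNormal η₁ η₂ (p + (0 : ℝ) • v) = p := by
      rw [hp0]; exact Prod.ext (jetNormal_eq_self hd hp) rfl
    have hθ : HasDerivAt (fun t : ℝ => p.2 + t • v.2) v.2 0 := hasDerivAt_affine_smul _ _
    have d1 := hasDerivAt_of_contDiffOn hd hF hf (v := v) (covPlot_line p v 0)
      (hp0.symm ▸ hsub hp) (hasVelocity_line _ p.1 v.1) hθ
    have d2 := hasDerivAt_of_contDiffOn hd hF hf (v := v)
      (hplot ℝ _ 0 (covPlot_line p v 0) (hp0.symm ▸ hsub hp)) (hN.symm ▸ hsub hp) hv hθ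
    rw [hN] at d2
    rw [hp0] at d1
    exact d2.deriv.trans d1.deriv.symm
  -- Coordinates with both indices below `k` have order less than `2 k`.
  refine ⟨fun q => f (covNormal η₁ η₂ q), 2 * k, ⟨?_, fun p hp => ?_, fun p hp => ?_⟩, ?_⟩
  · exact fun E _ _ γ e hγ he => covSmoothOn_of_contDiffOn hd hF hf E _ e (hplot E γ e hγ he)
      (hsub (covNormal_mem hd he))
  · exact (hchain p hp _ (hasVelocity_jetFieldX hd hp _)).trans (hform p hp).1
  · exact (hchain p hp _ (hasVelocity_jetFieldY hd hp _)).trans (hform p hp).2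
  · intro p hp q hq hpq
    have hag := agreeTo_jetNormal hd hp hq hpq.1
    have ht : truncate k n (covNormal η₁ η₂ p) = truncate k n (covNormal η₁ η₂ q) := by
      refine Prod.ext hag.1 (Prod.ext hag.2.1 (Prod.ext ?_ (Prod.ext ?_ hpq.2)))
      · funext i j; exact (hag.2.2 i j (by omega)).1
      · funext i j; exact (hag.2.2 i j (by omega)).2
    show f _ = f _
    rw [hf _ (hsub (covNormal_mem hd hp)), hf _ (hsub (covNormal_mem hd hq)), ht]

end System

end SDeform

end

/-! ### Eliminating the jet variables from a potential, and the contradiction -/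

noncomputable section

namespace SDeform

open Filter Topology

/-- A relation compatible with the vector space operations along lines. -/
structure IsLinearRel {n : ℕ} (r : Cov n → Cov n → Prop) : Prop where
  refl : ∀ p, r p p
  add_smul : ∀ p q v w, r p q → r v w → ∀ t : ℝ, r (p + t • v) (q + t • w)

lemma isLinearRel_covAgree {n : ℕ} (m : ℕ) : IsLinearRel (CovAgree m : Cov n → Cov n → Prop) where
  refl p := ⟨AgreeParam.refl m p.1, rfl⟩
  add_smul _ _ _ _ h k t := ⟨h.1.add_smul k.1 t, congrArg₂ (fun a b => a + t • b) h.2 k.2⟩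

/-- Agreement of `x`, `y` and the nonlocal variables. -/
def BaseAgree {n : ℕ} (p q : Cov n) : Prop := jx p.1 = jx q.1 ∧ jy p.1 = jy q.1 ∧ p.2 = q.2

lemma isLinearRel_baseAgree {n : ℕ} : IsLinearRel (BaseAgree : Cov n → Cov n → Prop) where
  refl _ := ⟨rfl, rfl, rfl⟩
  add_smul _ _ _ _ h k t := ⟨congrArg₂ (fun a b => a + t * b) h.1 k.1,
    congrArg₂ (fun a b => a + t * b) h.2.1 k.2.1, congrArg₂ (fun a b => a + t • b) h.2.2 k.2.2⟩

lemma Respects.lineDeriv_eq {n : ℕ} {D : Set (Cov n)} {r : Cov n → Cov n → Prop} {h : Cov n → ℂ}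
    (hD : CovOpen D) (hr : IsLinearRel r) (hh : Respects D r h) {p q v w : Cov n} (hp : p ∈ D)
    (hq : q ∈ D) (hpq : r p q) (hvw : r v w) : lineDeriv ℝ h p v = lineDeriv ℝ h q w := by
  have h1 := hD ℝ _ 0 (covPlot_line p v 0) (by simpa using hp)
  have h2 := hD ℝ _ 0 (covPlot_line q w 0) (by simpa using hq)
  refine Filter.EventuallyEq.deriv_eq ?_
  filter_upwards [h1, h2] with t ht1 ht2
  exact hh _ ht1 _ ht2 (hr.add_smul p q v w hpq hvw t)

/-- The jets with vanishing `x`, `y` and the given derivatives of `u` and `v`. -/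
def jetOf (a b : ℕ → ℕ → ℝ) : Jet := (0, 0, a, b)

/-- The part of the covering where `u` and `v` are positive. -/
def posDomain (η₁ η₂ : ℝ → ℝ) (I J : Set ℝ) (n : ℕ) : Set (Cov n) :=
  {p | p ∈ covDomain η₁ η₂ I J n ∧ 0 < ju 0 0 p.1 ∧ 0 < jv 0 0 p.1}

section System

variable {η₁ η₂ : ℝ → ℝ} {I J : Set ℝ} {n : ℕ} {h : Cov n → ℂ}

lemma covEquation_subset : covEquation η₁ η₂ I J n ⊆ covDomain η₁ η₂ I J n := fun _ hp => hp.1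

lemma posDomain_subset : posDomain η₁ η₂ I J n ⊆ covDomain η₁ η₂ I J n := fun _ hp => hp.1

lemma covNormal_agree (m : ℕ) (p : Cov n) : CovAgree m (covNormal η₁ η₂ p) p :=
  ⟨agreeParam_jetNormal η₁ η₂ m p.1, rfl⟩

/-- Related points are indistinguishable for `h` and its line derivatives, so `D_x h` at `q` may be
computed at `p` with the field of `q`. Subtracting `D_x h` at `p` leaves the difference of the
prescribed values. -/
lemma IsPotential.lineDeriv_eq_omegaX_sub (hpot : IsPotential η₁ η₂ I J h) {D : Set (Cov n)}
    (hD : CovOpen D) (hDs : D ⊆ covDomain η₁ η₂ I J n) {r : Cov n → Cov n → Prop}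
    (hr : IsLinearRel r) (hh : Respects D r h) {p q w : Cov n} (hp : p ∈ D) (hq : q ∈ D)
    (hpE : p ∈ covEquation η₁ η₂ I J n) (hqE : q ∈ covEquation η₁ η₂ I J n) (hpq : r p q)
    (hw : r w (covFieldX η₁ η₂ q - covFieldX η₁ η₂ p)) :
    lineDeriv ℝ h p w = omegaX η₁ η₂ n q - omegaX η₁ η₂ n p := by
  rw [hh.lineDeriv_eq hD hr hp hp (hr.refl p) hw, hpot.smooth.lineDeriv_sub (hDs hp),
    hpot.lineDeriv_x p hpE, hh.lineDeriv_eq hD hr hp hq hpq (hr.refl _), hpot.lineDeriv_x q hqE]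

lemma IsPotential.lineDeriv_eq_omegaY_sub (hpot : IsPotential η₁ η₂ I J h) {D : Set (Cov n)}
    (hD : CovOpen D) (hDs : D ⊆ covDomain η₁ η₂ I J n) {r : Cov n → Cov n → Prop}
    (hr : IsLinearRel r) (hh : Respects D r h) {p q w : Cov n} (hp : p ∈ D) (hq : q ∈ D)
    (hpE : p ∈ covEquation η₁ η₂ I J n) (hqE : q ∈ covEquation η₁ η₂ I J n) (hpq : r p q)
    (hw : r w (covFieldY η₁ η₂ q - covFieldY η₁ η₂ p)) :
    lineDeriv ℝ h p w = omegaY η₁ η₂ n q - omegaY η₁ η₂ n p := by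
  rw [hh.lineDeriv_eq hD hr hp hp (hr.refl p) hw, hpot.smooth.lineDeriv_sub (hDs hp),
    hpot.lineDeriv_y p hpE, hh.lineDeriv_eq hD hr hp hq hpq (hr.refl _), hpot.lineDeriv_y q hqE]

variable (hd : SmoothData η₁ η₂ I J)
include hd

lemma covOpen_posDomain : CovOpen (posDomain η₁ η₂ I J n) := by
  intro E _ _ γ e hγ he
  filter_upwards [covOpen_covDomain hd n E γ e hγ he.1,
    (hγ.1.2.2.1 0 0).continuousAt.eventually_const_lt he.2.1,
    (hγ.1.2.2.2 0 0).continuousAt.eventually_const_lt he.2.2] with z h1 h2 h3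
  exact ⟨h1, h2, h3⟩

/-- If `h` depends on parametric coordinates of order at most `m`, its derivatives with respect to
those of the coordinates `u_{i+1,j}` of order `m` vanish. -/
lemma IsPotential.lineDeriv_u_eq_zero (hpot : IsPotential η₁ η₂ I J h) {m : ℕ}
    (hm : Respects (covDomain η₁ η₂ I J n) (CovAgree m) h) {τ : ℕ → ℕ → ℝ}
    (hτ : ∀ i j, i + j ≤ m → τ i j = 0) (h01 : τ 0 1 = 0) {p : Cov n}
    (hp : p ∈ covDomain η₁ η₂ I J n) :
    lineDeriv ℝ h p (jetOf (fun i j => τ (i + 1) j) 0, 0) = 0 := by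
  -- The shift affects only coordinates of order above `m`, which `h` does not see, but `D_x` brings
  -- it down to order `m`.
  set q : Cov n := (p.1 + jetOf τ 0, p.2) with hqdef
  have hag : AgreeParam m p.1 q.1 :=
    ⟨by simp [hqdef, jetOf, jx], by simp [hqdef, jetOf, jy], fun i j hij =>
      ⟨fun _ => by simp [hqdef, jetOf, ju, hτ i j hij], fun _ => by simp [hqdef, jetOf, jv]⟩⟩
  have hq : q ∈ covDomain η₁ η₂ I J n := mem_jetDomain_of_agreeParam hag hp
  set P := covNormal η₁ η₂ p with hP
  set Q := covNormal η₁ η₂ q with hQ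
  have hPE : P ∈ covEquation η₁ η₂ I J n := covNormal_mem hd hp
  have hQE : Q ∈ covEquation η₁ η₂ I J n := covNormal_mem hd hq
  have hPQ : CovAgree m P Q :=
    ⟨((covNormal_agree m p).1.trans hag).trans (covNormal_agree m q).1.symm, rfl⟩
  have hu : ∀ i j, j < 2 → ju i j Q.1 = ju i j P.1 + τ i j := fun i j hj => by
    change ju i j (jetNormal η₁ η₂ q.1) = ju i j (jetNormal η₁ η₂ p.1) + τ i j
    rw [((agreeParam_jetNormal η₁ η₂ (i + j) q.1).2.2 i j le_rfl).1 hj,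
      ((agreeParam_jetNormal η₁ η₂ (i + j) p.1).2.2 i j le_rfl).1 hj]
    rfl
  have hv : ∀ i j, i < 2 → jv i j Q.1 = jv i j P.1 := fun i j hi => by
    change jv i j (jetNormal η₁ η₂ q.1) = jv i j (jetNormal η₁ η₂ p.1)
    rw [((agreeParam_jetNormal η₁ η₂ (i + j) q.1).2.2 i j le_rfl).2 hi,
      ((agreeParam_jetNormal η₁ η₂ (i + j) p.1).2.2 i j le_rfl).2 hi]
    simp [hqdef, jetOf, jv]
  -- Only `u_y` could change here, and only for `m = 0`; `h01` excludes this.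
  have hω : ∀ s, omegaX η₁ η₂ s Q = omegaX η₁ η₂ s P := fun s =>
    omegaX_congr hPQ.1.1.symm hPQ.1.2.1.symm (by rw [hu 0 0 (by omega), hτ 0 0 (by omega), add_zero])
      (by rw [hu 0 1 (by omega), h01, add_zero]) (hv 0 0 (by omega)) rfl s
  -- For `i = 1` the coordinate `v_{i+1,j}` is principal of order at most `m + 1`, hence determined
  -- by parametric coordinates of order at most `m`. So the difference of the fields has no visible
  -- `v`-part.
  have hprinc := (agreeTo_of_agreeParam hd hPE hQE hPQ.1).2
  have hw : CovAgree m ((jetOf (fun i j => τ (i + 1) j) 0, 0) : Cov n)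
      (covFieldX η₁ η₂ Q - covFieldX η₁ η₂ P) := by
    refine ⟨⟨by simp [jetOf, jx, covFieldX, jetFieldX], by simp [jetOf, jy, covFieldX, jetFieldX],
      fun i j hij => ⟨fun hj => ?_, fun hi => ?_⟩⟩, ?_⟩
    · show τ (i + 1) j = ju (i + 1) j Q.1 - ju (i + 1) j P.1
      rw [hu _ _ hj]; ring
    · show (0 : ℝ) = jv (i + 1) j Q.1 - jv (i + 1) j P.1
      by_cases hi0 : i + 1 < 2
      · rw [hv _ _ hi0, sub_self]
      · rw [(hprinc (i + 1) j (by omega)).2 (by omega), sub_self]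
    · funext k
      show (0 : ℂ) = omegaX η₁ η₂ k Q - omegaX η₁ η₂ k P
      rw [hω, sub_self]
  have key := hpot.lineDeriv_eq_omegaX_sub (covOpen_covDomain hd n) subset_rfl
    (isLinearRel_covAgree m) hm (covEquation_subset hPE) (covEquation_subset hQE) hPE hQE hPQ hw
  rw [hω, sub_self] at key
  rw [← key]
  exact hm.lineDeriv_eq (covOpen_covDomain hd n) (isLinearRel_covAgree m) hp
    (covEquation_subset hPE) ⟨(covNormal_agree m p).1.symm, rfl⟩ ((isLinearRel_covAgree m).refl _)

/-- The counterpart of `IsPotential.lineDeriv_u_eq_zero` for the coordinates `v_{i,j+1}`. -/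
lemma IsPotential.lineDeriv_v_eq_zero (hpot : IsPotential η₁ η₂ I J h) {m : ℕ}
    (hm : Respects (covDomain η₁ η₂ I J n) (CovAgree m) h) {τ : ℕ → ℕ → ℝ}
    (hτ : ∀ i j, i + j ≤ m → τ i j = 0) (h10 : τ 1 0 = 0) {p : Cov n}
    (hp : p ∈ covDomain η₁ η₂ I J n) :
    lineDeriv ℝ h p (jetOf 0 (fun i j => τ i (j + 1)), 0) = 0 := by
  set q : Cov n := (p.1 + jetOf 0 τ, p.2) with hqdef
  have hag : AgreeParam m p.1 q.1 :=
    ⟨by simp [hqdef, jetOf, jx], by simp [hqdef, jetOf, jy], fun i j hij =>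
      ⟨fun _ => by simp [hqdef, jetOf, ju], fun _ => by simp [hqdef, jetOf, jv, hτ i j hij]⟩⟩
  have hq : q ∈ covDomain η₁ η₂ I J n := mem_jetDomain_of_agreeParam hag hp
  set P := covNormal η₁ η₂ p with hP
  set Q := covNormal η₁ η₂ q with hQ
  have hPE : P ∈ covEquation η₁ η₂ I J n := covNormal_mem hd hp
  have hQE : Q ∈ covEquation η₁ η₂ I J n := covNormal_mem hd hq
  have hPQ : CovAgree m P Q :=
    ⟨((covNormal_agree m p).1.trans hag).trans (covNormal_agree m q).1.symm, rfl⟩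
  have hv : ∀ i j, i < 2 → jv i j Q.1 = jv i j P.1 + τ i j := fun i j hi => by
    change jv i j (jetNormal η₁ η₂ q.1) = jv i j (jetNormal η₁ η₂ p.1) + τ i j
    rw [((agreeParam_jetNormal η₁ η₂ (i + j) q.1).2.2 i j le_rfl).2 hi,
      ((agreeParam_jetNormal η₁ η₂ (i + j) p.1).2.2 i j le_rfl).2 hi]
    rfl
  have hu : ∀ i j, j < 2 → ju i j Q.1 = ju i j P.1 := fun i j hj => by
    change ju i j (jetNormal η₁ η₂ q.1) = ju i j (jetNormal η₁ η₂ p.1)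
    rw [((agreeParam_jetNormal η₁ η₂ (i + j) q.1).2.2 i j le_rfl).1 hj,
      ((agreeParam_jetNormal η₁ η₂ (i + j) p.1).2.2 i j le_rfl).1 hj]
    simp [hqdef, jetOf, ju]
  have hω : ∀ s, omegaY η₁ η₂ s Q = omegaY η₁ η₂ s P := fun s =>
    omegaY_congr hPQ.1.1.symm hPQ.1.2.1.symm (hu 0 0 (by omega))
      (by rw [hv 1 0 (by omega), h10, add_zero])
      (by rw [hv 0 0 (by omega), hτ 0 0 (by omega), add_zero]) rfl s
  have hprinc := (agreeTo_of_agreeParam hd hPE hQE hPQ.1).2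
  have hw : CovAgree m ((jetOf 0 (fun i j => τ i (j + 1)), 0) : Cov n)
      (covFieldY η₁ η₂ Q - covFieldY η₁ η₂ P) := by
    refine ⟨⟨by simp [jetOf, jx, covFieldY, jetFieldY], by simp [jetOf, jy, covFieldY, jetFieldY],
      fun i j hij => ⟨fun hj => ?_, fun hi => ?_⟩⟩, ?_⟩
    · show (0 : ℝ) = ju i (j + 1) Q.1 - ju i (j + 1) P.1
      by_cases hj0 : j + 1 < 2
      · rw [hu _ _ hj0, sub_self]
      · rw [(hprinc i (j + 1) (by omega)).1 (by omega), sub_self]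
    · show τ i (j + 1) = jv i (j + 1) Q.1 - jv i (j + 1) P.1
      rw [hv _ _ hi]; ring
    · funext k
      show (0 : ℂ) = omegaY η₁ η₂ k Q - omegaY η₁ η₂ k P
      rw [hω, sub_self]
  have key := hpot.lineDeriv_eq_omegaY_sub (covOpen_covDomain hd n) subset_rfl
    (isLinearRel_covAgree m) hm (covEquation_subset hPE) (covEquation_subset hQE) hPE hQE hPQ hw
  rw [hω, sub_self] at key
  rw [← key]
  exact hm.lineDeriv_eq (covOpen_covDomain hd n) (isLinearRel_covAgree m) hp
    (covEquation_subset hPE) ⟨(covNormal_agree m p).1.symm, rfl⟩ ((isLinearRel_covAgree m).refl _)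

/-- One step of the descent: `p` is joined to a point agreeing with `q` in order `m + 1` by two
segments, one in the `u`- and one in the `v`-coordinates, along which `h` is constant. -/
lemma IsPotential.respects_of_succ (hpot : IsPotential η₁ η₂ I J h) {m : ℕ}
    (hm : Respects (covDomain η₁ η₂ I J n) (CovAgree (m + 1)) h) :
    Respects (covDomain η₁ η₂ I J n) (CovAgree m) h := by
  intro p hp q hq hpq
  -- To move `u_{i-1,j}` the shift is placed at `(i, j)`. From `j < 2` and `i + j = m + 2` it
  -- follows that `i ≥ 1`, so the subtraction is not truncated; similarly for `σ`.
  let τ : ℕ → ℕ → ℝ := fun i j =>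
    if i + j = m + 2 ∧ j < 2 then ju (i - 1) j q.1 - ju (i - 1) j p.1 else 0
  let σ : ℕ → ℕ → ℝ := fun i j =>
    if i + j = m + 2 ∧ i < 2 then jv i (j - 1) q.1 - jv i (j - 1) p.1 else 0
  let w : Cov n := (jetOf (fun i j => τ (i + 1) j) 0, 0)
  let z : Cov n := (jetOf 0 (fun i j => σ i (j + 1)), 0)
  have hτ : ∀ i j, i + j ≤ m + 1 → τ i j = 0 := fun i j hij => if_neg (by omega)
  have hσ : ∀ i j, i + j ≤ m + 1 → σ i j = 0 := fun i j hij => if_neg (by omega)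
  have hw : ∀ a : Cov n, a ∈ covDomain η₁ η₂ I J n → ∀ t : ℝ, a + t • w ∈ covDomain η₁ η₂ I J n := by
    intro a ha t
    refine mem_jetDomain_of_agreeParam (n := 0) ⟨?_, ?_, fun i j hij => ⟨fun _ => ?_, fun _ => ?_⟩⟩ ha
    · simp [w, jetOf, jx]
    · simp [w, jetOf, jy]
    · simp [w, jetOf, ju, hτ (i + 1) j (by omega)]
    · simp [w, jetOf, jv]
  have hz : ∀ a : Cov n, a ∈ covDomain η₁ η₂ I J n → ∀ t : ℝ, a + t • z ∈ covDomain η₁ η₂ I J n := by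
    intro a ha t
    refine mem_jetDomain_of_agreeParam (n := 0) ⟨?_, ?_, fun i j hij => ⟨fun _ => ?_, fun _ => ?_⟩⟩ ha
    · simp [z, jetOf, jx]
    · simp [z, jetOf, jy]
    · simp [z, jetOf, ju]
    · simp [z, jetOf, jv, hσ i (j + 1) (by omega)]
  have h1 : h (p + w) = h p := hpot.smooth.eq_of_lineDeriv_eq_zero w (fun t _ => hw p hp t)
    fun t _ => hpot.lineDeriv_u_eq_zero hd hm hτ (hτ 0 1 (by omega)) (hw p hp t)
  have hpw : p + w ∈ covDomain η₁ η₂ I J n := by simpa using hw p hp 1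
  have h2 : h (p + w + z) = h (p + w) :=
    hpot.smooth.eq_of_lineDeriv_eq_zero z (fun t _ => hz _ hpw t)
      fun t _ => hpot.lineDeriv_v_eq_zero hd hm hσ (hσ 1 0 (by omega)) (hz _ hpw t)
  have hpz : p + w + z ∈ covDomain η₁ η₂ I J n := by simpa using hz _ hpw 1
  rw [← h1, ← h2]
  refine hm _ hpz _ hq ⟨⟨?_, ?_, fun i j hij => ⟨fun hj => ?_, fun hi => ?_⟩⟩, ?_⟩
  · simpa [w, z, jetOf, jx] using hpq.1.1
  · simpa [w, z, jetOf, jy] using hpq.1.2.1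
  · have e : ju i j (p + w + z).1 = ju i j p.1 + τ (i + 1) j := by simp [w, z, jetOf, ju]
    rw [e]
    by_cases hm' : i + j = m + 1
    · rw [show τ (i + 1) j = ju i j q.1 - ju i j p.1 from if_pos ⟨by omega, hj⟩]; ring
    · rw [hτ _ _ (by omega), add_zero]
      exact (hpq.1.2.2 i j (by omega)).1 hj
  · have e : jv i j (p + w + z).1 = jv i j p.1 + σ i (j + 1) := by simp [w, z, jetOf, jv]
    rw [e]
    by_cases hm' : i + j = m + 1
    · rw [show σ i (j + 1) = jv i j q.1 - jv i j p.1 from if_pos ⟨by omega, hi⟩]; ring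
    · rw [hσ _ _ (by omega), add_zero]
      exact (hpq.1.2.2 i j (by omega)).2 hi
  · simpa [w, z] using hpq.2

/-- The last step removes `u` and `v` themselves, through `u_x` in `D_x` and `v_y` in `D_y`, neither
of which occurs in the corresponding component of the form. The segments must avoid `u = 0` and `v =
0`, hence the restriction to one quadrant. -/
lemma IsPotential.respects_baseAgree (hpot : IsPotential η₁ η₂ I J h) {m : ℕ}
    (hm : Respects (covDomain η₁ η₂ I J n) (CovAgree m) h) :
    Respects (posDomain η₁ η₂ I J n) BaseAgree h := by
  have h0 : Respects (covDomain η₁ η₂ I J n) (CovAgree 0) h := by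
    induction m with
    | zero => exact hm
    | succ m ih => exact ih (hpot.respects_of_succ hd hm)
  intro p hp q hq hpq
  let τ : ℕ → ℕ → ℝ := fun i j => if i = 1 ∧ j = 0 then ju 0 0 q.1 - ju 0 0 p.1 else 0
  let σ : ℕ → ℕ → ℝ := fun i j => if i = 0 ∧ j = 1 then jv 0 0 q.1 - jv 0 0 p.1 else 0
  let w : Cov n := (jetOf (fun i j => τ (i + 1) j) 0, 0)
  let z : Cov n := (jetOf 0 (fun i j => σ i (j + 1)), 0)
  have hτ : ∀ i j, i + j ≤ 0 → τ i j = 0 := fun i j hij => if_neg (by omega)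
  have hσ : ∀ i j, i + j ≤ 0 → σ i j = 0 := fun i j hij => if_neg (by omega)
  have hconv : ∀ a b t : ℝ, 0 < a → 0 < b → 0 ≤ t → t ≤ 1 → 0 < a + t * (b - a) := by
    intro a b t ha hb ht ht'
    rcases eq_or_lt_of_le ht with rfl | ht0
    · simpa using ha
    · nlinarith [mul_pos ht0 hb, mul_nonneg (sub_nonneg.2 ht') ha.le]
  have hw : ∀ t ∈ Set.Icc (0 : ℝ) 1, p + t • w ∈ posDomain η₁ η₂ I J n := by
    intro t ht
    have hu : 0 < ju 0 0 (p + t • w).1 := by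
      simpa [w, jetOf, ju, τ] using hconv _ _ t hp.2.1 hq.2.1 ht.1 ht.2
    have hv : jv 0 0 (p + t • w).1 = jv 0 0 p.1 := by simp [w, jetOf, jv]
    have hx : jx (p + t • w).1 = jx p.1 := by simp [w, jetOf, jx]
    have hy : jy (p + t • w).1 = jy p.1 := by simp [w, jetOf, jy]
    obtain ⟨⟨a1, a2, a3, -, a5⟩, -, a7⟩ := hp
    exact ⟨⟨hx ▸ a1, hy ▸ a2, hx ▸ hy ▸ a3, hu.ne', hv ▸ a5⟩, hu, hv ▸ a7⟩
  have hpw : p + w ∈ posDomain η₁ η₂ I J n := by simpa using hw 1 (by simp)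
  have hz : ∀ t ∈ Set.Icc (0 : ℝ) 1, p + w + t • z ∈ posDomain η₁ η₂ I J n := by
    intro t ht
    have hv : 0 < jv 0 0 (p + w + t • z).1 := by
      simpa [w, z, jetOf, jv, σ] using hconv _ _ t hp.2.2 hq.2.2 ht.1 ht.2
    have hu : ju 0 0 (p + w + t • z).1 = ju 0 0 (p + w).1 := by simp [z, jetOf, ju]
    have hx : jx (p + w + t • z).1 = jx (p + w).1 := by simp [z, jetOf, jx]
    have hy : jy (p + w + t • z).1 = jy (p + w).1 := by simp [z, jetOf, jy]
    obtain ⟨⟨a1, a2, a3, a4, -⟩, a6, -⟩ := hpw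
    exact ⟨⟨hx ▸ a1, hy ▸ a2, hx ▸ hy ▸ a3, hu ▸ a4, hv.ne'⟩, hu ▸ a6, hv⟩
  have h1 : h (p + w) = h p := hpot.smooth.eq_of_lineDeriv_eq_zero w (fun t ht => (hw t ht).1)
    fun t ht => hpot.lineDeriv_u_eq_zero hd h0 hτ (if_neg (by omega)) (hw t ht).1
  have h2 : h (p + w + z) = h (p + w) :=
    hpot.smooth.eq_of_lineDeriv_eq_zero z (fun t ht => (hz t ht).1)
      fun t ht => hpot.lineDeriv_v_eq_zero hd h0 hσ (if_neg (by omega)) (hz t ht).1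
  have hpz : p + w + z ∈ posDomain η₁ η₂ I J n := by simpa using hz 1 (by simp)
  rw [← h1, ← h2]
  refine h0 _ hpz.1 _ hq.1 ⟨⟨?_, ?_, fun i j hij => ?_⟩, ?_⟩
  · simpa [w, z, jetOf, jx] using hpq.1
  · simpa [w, z, jetOf, jy] using hpq.2.1
  · obtain ⟨rfl, rfl⟩ : i = 0 ∧ j = 0 := by omega
    exact ⟨fun _ => by simp [w, z, jetOf, ju, τ], fun _ => by simp [w, z, jetOf, jv, σ]⟩
  · simpa [w, z] using hpq.2.2

/-- A change of the Riccati equation of the `x`-part at fixed `(x, y)` lifts through the potential. -/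
lemma IsPotential.lifts_sub (hpot : IsPotential η₁ η₂ I J h)
    (hb : Respects (posDomain η₁ η₂ I J n) BaseAgree h) {a b c : Jet}
    (ha : a ∈ equationManifold η₁ η₂ I J) (hb' : b ∈ equationManifold η₁ η₂ I J)
    (hc : c ∈ equationManifold η₁ η₂ I J)
    (hapos : 0 < ju 0 0 a ∧ 0 < jv 0 0 a) (hbpos : 0 < ju 0 0 b ∧ 0 < jv 0 0 b)
    (hcpos : 0 < ju 0 0 c ∧ 0 < jv 0 0 c) (hca : jx c = jx a ∧ jy c = jy a)
    (hab : jx a = jx b ∧ jy a = jy b) :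
    Lifts (fun θ : Fin n → ℂ => h (c, θ)) (riccatiX η₁ η₂ b - riccatiX η₁ η₂ a) := by
  refine ⟨⟨?_, ?_⟩, fun θ => ?_⟩
  · simp [(small_riccatiX η₁ η₂ a).1, (small_riccatiX η₁ η₂ b).1]
  · simp [(small_riccatiX η₁ η₂ a).2, (small_riccatiX η₁ η₂ b).2]
  have hpl : CovPlot (fun θ : Fin n → ℂ => ((c, θ) : Cov n)) θ := ⟨jetPlot_const c, contDiffAt_id⟩
  have hdiff := ((hpot.smooth _ _ _ hpl hc.1).differentiableAt (by simp)).hasFDerivAt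
  set V := flowField n (riccatiX η₁ η₂ b - riccatiX η₁ η₂ a) θ with hV
  have h1 : fderiv ℝ (fun θ : Fin n → ℂ => h (c, θ)) θ V
      = lineDeriv ℝ h ((c, θ) : Cov n) ((0, V) : Cov n) := by
    have h2 := HasFDerivAt.comp_hasDerivAt_of_eq (0 : ℝ) hdiff (hasDerivAt_affine_smul θ V)
      (by simp)
    refine (h2.deriv.symm.trans ?_)
    rw [lineDeriv]
    congr 1
    funext t
    simp
  -- The difference of the two fields over the same `(x, y)` has no `x`- or `y`-component, and its
  -- jet part is invisible to `h`; only the nonlocal component `V` matters.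
  have hw : BaseAgree ((0, V) : Cov n)
      (covFieldX η₁ η₂ ((b, θ) : Cov n) - covFieldX η₁ η₂ ((a, θ) : Cov n)) := by
    refine ⟨by simp [jx, covFieldX, jetFieldX], by simp [jy, covFieldX, jetFieldX], ?_⟩
    funext k
    show V k = omegaX η₁ η₂ k ((b, θ) : Cov n) - omegaX η₁ η₂ k ((a, θ) : Cov n)
    rw [omegaX_eq, omegaX_eq, hV, flowField, flow_sub, map_sub]
  have hr := isLinearRel_baseAgree (n := n)
  have hpa : ((a, θ) : Cov n) ∈ posDomain η₁ η₂ I J n := ⟨ha.1, hapos⟩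
  have hpb : ((b, θ) : Cov n) ∈ posDomain η₁ η₂ I J n := ⟨hb'.1, hbpos⟩
  have hpc : ((c, θ) : Cov n) ∈ posDomain η₁ η₂ I J n := ⟨hc.1, hcpos⟩
  rw [h1, hb.lineDeriv_eq (covOpen_posDomain hd) hr hpc hpa ⟨hca.1, hca.2, rfl⟩ (hr.refl _),
    hpot.lineDeriv_eq_omegaX_sub (covOpen_posDomain hd) posDomain_subset hr hb hpa hpb ha hb'
      ⟨hab.1, hab.2, rfl⟩ hw, omegaX_eq, omegaX_eq, flow_sub, map_sub]

lemma not_isTrivialForm_omega (hne : ∃ x ∈ I, ∃ y ∈ J, η₁ x ≠ η₂ y) :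
    ¬ IsTrivialForm η₁ η₂ I J (n := n) (omegaX η₁ η₂ n) (omegaY η₁ η₂ n) := by
  intro ht
  obtain ⟨h, m, hpot, hm⟩ := exists_isPotential hd ht
  have hb := hpot.respects_baseAgree hd hm
  obtain ⟨x, hx, y, hy, hxy⟩ := hne
  -- Jets over `(x, y)` with `v = 1` and free `u` and `u_y = b`; `jetNormal` supplies the principal
  -- coordinates.
  let raw : ℝ → ℝ → Jet := fun u b => (x, y,
    fun i j => if i = 0 ∧ j = 0 then u else if i = 0 ∧ j = 1 then b else 0,
    fun i j => if i = 0 ∧ j = 0 then 1 else 0)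
  have hraw : ∀ u b, 0 < u → raw u b ∈ jetDomain η₁ η₂ I J := fun u b hu =>
    ⟨hx, hy, hxy, by simpa [raw, ju] using hu.ne', by simp [raw, jv]⟩
  let pt : ℝ → ℝ → Jet := fun u b => jetNormal η₁ η₂ (raw u b)
  have hE : ∀ u b, 0 < u → pt u b ∈ equationManifold η₁ η₂ I J := fun u b hu =>
    jetNormal_mem_equationManifold hd (hraw u b hu)
  have hu : ∀ u b, ju 0 0 (pt u b) = u := fun u b =>
    (((agreeParam_jetNormal η₁ η₂ 0 (raw u b)).2.2 0 0 le_rfl).1 (by omega)).trans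
      (by simp [raw, ju])
  have hv : ∀ u b, jv 0 0 (pt u b) = 1 := fun u b =>
    (((agreeParam_jetNormal η₁ η₂ 0 (raw u b)).2.2 0 0 le_rfl).2 (by omega)).trans
      (by simp [raw, jv])
  have huy : ∀ u b, ju 0 1 (pt u b) = b := fun u b =>
    (((agreeParam_jetNormal η₁ η₂ 1 (raw u b)).2.2 0 1 le_rfl).1 (by omega)).trans
      (by simp [raw, ju])
  have hpos : ∀ u b, 0 < u → 0 < ju 0 0 (pt u b) ∧ 0 < jv 0 0 (pt u b) := fun u b h => by
    rw [hu, hv]; exact ⟨h, one_pos⟩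
  have hric : ∀ u b, riccatiX η₁ η₂ (pt u b)
      = (PowerSeries.C (u : ℂ) * (PowerSeries.C (1 / 2) * PowerSeries.X * alphaSeries (η₁ x)),
        PowerSeries.C (Complex.I * b) * alphaRatioSeries (η₂ y) (η₁ x),
        PowerSeries.C (u : ℂ) * (PowerSeries.C (1 / 2) * PowerSeries.X * alphaSeries (η₁ x))) := by
    intro u b
    rw [riccatiX, hu, hv, huy]
    simp only [Complex.ofReal_one, div_one]
    rfl
  -- Raising `u_y` from `0` to `1` changes only the linear coefficient, by `iρ`. Raising `u` from
  -- `1` to `2` changes only the quadratic and constant ones, each by `μα/2`.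
  have l1 := hpot.lifts_sub hd hb (hE 1 0 one_pos) (hE 1 1 one_pos) (hE 1 0 one_pos)
    (hpos 1 0 one_pos) (hpos 1 1 one_pos) (hpos 1 0 one_pos) ⟨rfl, rfl⟩ ⟨rfl, rfl⟩
  have l2 := hpot.lifts_sub hd hb (hE 1 0 one_pos) (hE 2 0 two_pos) (hE 1 0 one_pos)
    (hpos 1 0 one_pos) (hpos 2 0 two_pos) (hpos 1 0 one_pos) ⟨rfl, rfl⟩ ⟨rfl, rfl⟩
  have hg : ContDiff ℝ ∞ fun θ : Fin n → ℂ => h (pt 1 0, θ) :=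
    contDiff_iff_contDiffAt.2 fun θ => hpot.smooth _ (fun θ : Fin n → ℂ => ((pt 1 0, θ) : Cov n)) θ
      ⟨jetPlot_const _, contDiffAt_id⟩ (hE 1 0 one_pos).1
  refine not_lifts hg hxy ?_ ?_
  · convert l1 using 1
    rw [hric, hric]
    simp
  · convert l2 using 1
    rw [hric, hric]
    have h2 : (PowerSeries.C (2 : ℂ) : ℂ⟦X⟧) = 1 + 1 := by
      rw [← map_one PowerSeries.C, ← map_add]; norm_num
    refine Prod.ext ?_ (Prod.ext ?_ ?_)
    · simp only [Prod.fst_sub, Complex.ofReal_ofNat, Complex.ofReal_one, h2, map_one]; ring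
    · simp
    · simp only [Prod.snd_sub, Complex.ofReal_ofNat, Complex.ofReal_one, h2, map_one]; ring

end System

end SDeform

end

theorem mainTheorem2 (η₁ η₂ : ℝ → ℝ) (I J : Set ℝ) (hI : IsOpen I) (hJ : IsOpen J)
    (hη₁ : ContDiffOn ℝ ∞ η₁ I) (hη₂ : ContDiffOn ℝ ∞ η₂ J)
    (hne : ∃ x ∈ I, ∃ y ∈ J, η₁ x ≠ η₂ y) (s : ℕ) :
    SDeform.IsConservationLaw η₁ η₂ I J (n := s)
        (SDeform.omegaX η₁ η₂ s) (SDeform.omegaY η₁ η₂ s) ∧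
      ¬ SDeform.IsTrivialForm η₁ η₂ I J (n := s)
        (SDeform.omegaX η₁ η₂ s) (SDeform.omegaY η₁ η₂ s) :=
  ⟨SDeform.isConservationLaw_omega ⟨hI, hJ, hη₁, hη₂⟩ s,
    SDeform.not_isTrivialForm_omega ⟨hI, hJ, hη₁, hη₂⟩ hne⟩
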